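/- For a compactly supported probability measure $\mu$ on $\mathbb R$ let $G_\mu(z)=\int_{\mathbb R}\frac{d\mu(x)}{z-x}$ be its Cauchy transform, and let $R_\mu$ be its $R$-transform, that is, the germ of a holomorphic function at $0$ with $\frac1{G_\mu(z)}+R_\mu(G_\mu(z))=z$ for all sufficiently large $z\in\mathbb C$. For real $k\ge 1$ let $\mu^{\boxplus k}$ be the compactly supported probability measure with $R_{\mu^{\boxplus k}}(s)=kR_\mu(s)$ for all sufficiently small $s$, and let $k^{-1/2}_*\mu^{\boxplus k}$ be its pushforward under $x\mapsto k^{-1/2}x$. The free Fisher information is $\Phi(\mu)=\frac{4\pi^2}{3}\int_{\mathbb R}\left(\frac{d\mu}{dx}\right)^3dx$, with $\Phi(\mu)=+\infty$ if $\mu$ is not absolutely continuous. The Hilbert transform is $Hf(y)=\mathrm{p.v.}\,\frac1\pi\int_{\mathbb R}\frac{f(x)}{y-x}\,dx$. **Proposition 3.2.** Let $\mu$ be a compactly supported probability measure on $\mathbb R$. Suppose that for some $k_0>1$ one has $d(k^{-1/2}_*\mu^{\boxplus k})=f_k(x)\,dx$ for all $1\le k<k_0$, where each $f_k:\mathbb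 R\to[0,\infty)$ is compactly supported and $(k,x)\mapsto f_k(x)$ is twice continuously differentiable on $[1,k_0)\times\mathbb R$. Write $f=f_1$, $G(z)=\int_{\mathbb R}\frac{f(x)}{z-x}\,dx$, and for $z,w\in\mathbb C\setminus\mathbb R$ $$K(z,w)=\frac{1}{G(z)G(w)}\left(\frac{G(z)-G(w)}{z-w}+G(z)G(w)\right)^2,$$ where the difference quotient is read as $G'(w)$ if $z=w$. Then the principal value $Hf(y)$ exists for every $y\in\mathbb R$; $f$ and $Hf$ are differentiable; $\Phi(k^{-1/2}_*\mu^{\boxplus k})<\infty$ for $1\le k<k_0$; the integrands of all the integrals below are integrable (for every $\varepsilon>0$ in (ii)), a quotient being read as $0$ where its denominator vanishes; and: (i) The one-sided derivative of $k\mapsto\Phi(k^{-1/2}_*\mu^{\boxplus k})$ at $k=1$ exists, and $$\partial_k\Phi(k^{-1/2}_*\mu^{\boxplus k})\big|_{k=1}=\frac{8\pi^2}{3}\int_{\mathbb R}f^3\,dx+4\pi\int_{\mathbb R}\frac{Hf\,\partial_xf-f\,\partial_xHf}{(Hf)^2+f^2}\,f^2\,dx.$$ (ii) With $x_{\alpha\varepsilon}=x+i\alpha\varepsilon$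 and $y_{\beta\varepsilon}=y+i\beta\varepsilon$, $$\lim_{\varepsilon\to0^+}\sum_{\alpha,\beta\in\{-1,+1\}}\int_{\mathbb R}\int_{\mathbb R}f(x)f(y)K(x_{\alpha\varepsilon},y_{\beta\varepsilon})\,dx\,dy=-\frac{8\pi^2}{3}\int_{\mathbb R}f^3\,dx-4\pi\int_{\mathbb R}\frac{Hf\,\partial_xf-f\,\partial_xHf}{(Hf)^2+f^2}\,f^2\,dx.$$ (iii) The kernel $K(z,\overline w)$ is positive semi-definite: for all $n\ge0$, $z_1,\dots,z_n\in\mathbb C\setminus\mathbb R$ and $c_1,\dots,c_n\in\mathbb C$, $$\sum_{j=1}^n\sum_{l=1}^nc_j\overline{c_l}\,K(z_j,\overline{z_l})\ge0.$$ -/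

import Mathlib

open MeasureTheory Filter Topology Set
open scoped ENNReal ComplexOrder ComplexConjugate

noncomputable section

namespace FreeProb

/-- The Cauchy transform `G_μ(z) = ∫ dμ(x) / (z - x)`. -/
def cauchyTransform (μ : Measure ℝ) (z : ℂ) : ℂ :=
  ∫ x : ℝ, (z - (x : ℂ))⁻¹ ∂μ

/-- `R` is (a representative of the germ at `0` of) the `R`-transform of `μ`: it is holomorphic near
`0` and `1 / G_μ(z) + R (G_μ(z)) = z` for all sufficiently large complex `z`. As `G_μ` maps
neighbourhoods of infinity onto punctured neighbourhoods of `0`, the germ of `R` is unique. -/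
def IsRTransform (μ : Measure ℝ) (R : ℂ → ℂ) : Prop :=
  AnalyticAt ℂ R 0 ∧
    ∀ᶠ z in Bornology.cobounded ℂ, (cauchyTransform μ z)⁻¹ + R (cauchyTransform μ z) = z

/-- `ν` is a compactly supported probability measure with `R_ν(s) = k R_μ(s)` for all sufficiently
small `s`. -/
def IsFreeConvPow (μ : Measure ℝ) (k : ℝ) (ν : Measure ℝ) : Prop :=
  IsProbabilityMeasure ν ∧ IsCompact ν.support ∧
    ∃ R S : ℂ → ℂ, IsRTransform μ R ∧ IsRTransform ν S ∧ ∀ᶠ s in 𝓝 (0 : ℂ), S s = (k : ℂ) * R s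

open Classical in
/-- The fractional free convolution power `μ^{⊞k}`: the compactly supported probability measure whose
`R`-transform is `k R_μ` (and `0` if there is none, which does not happen for real `k ≥ 1` and a
compactly supported probability measure `μ`). -/
def freeConvPow (μ : Measure ℝ) (k : ℝ) : Measure ℝ :=
  if h : ∃ ν, IsFreeConvPow μ k ν then h.choose else 0

/-- The dilate `c_* μ`, the pushforward of `μ` under `x ↦ c x`. -/
def dilate (c : ℝ) (μ : Measure ℝ) : Measure ℝ :=
  μ.map (fun x => c * x)

/-- The normalized free convolution power `k^{-1/2}_* μ^{⊞k}`. -/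
def normFreeConvPow (μ : Measure ℝ) (k : ℝ) : Measure ℝ :=
  dilate (√k)⁻¹ (freeConvPow μ k)

open Classical in
/-- The free Fisher information `Φ(μ) = (4π²/3) ∫ (dμ/dx)³ dx`, with `Φ(μ) = ∞` if `μ` is not
absolutely continuous. -/
def freeFisher (μ : Measure ℝ) : ℝ≥0∞ :=
  if μ ≪ volume then
    ENNReal.ofReal (4 * Real.pi ^ 2 / 3) * ∫⁻ x : ℝ, (μ.rnDeriv volume x) ^ 3
  else ∞

/-- The truncated Hilbert transform `(1/π) ∫_{|y - x| > η} f(x) / (y - x) dx`. -/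
def truncHilbert (f : ℝ → ℝ) (η y : ℝ) : ℝ :=
  1 / Real.pi * ∫ x in {x : ℝ | η < |y - x|}, f x / (y - x)

/-- The Hilbert transform `Hf(y) = p.v. (1/π) ∫ f(x) / (y - x) dx`. -/
def hilbert (f : ℝ → ℝ) (y : ℝ) : ℝ :=
  limUnder (𝓝[>] (0 : ℝ)) (fun η => truncHilbert f η y)

/-- The kernel `K(z, w) = ((G(z) - G(w)) / (z - w) + G(z) G(w))² / (G(z) G(w))`. The removable
singularity at `z = w` is removed: `dslope G w z` is the difference quotient
`(G(z) - G(w)) / (z - w)` for `z ≠ w` and the derivative `G'(w)` for `z = w`. -/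
def kernelK (G : ℂ → ℂ) (z w : ℂ) : ℂ :=
  1 / (G z * G w) * (dslope G w z + G z * G w) ^ 2

end FreeProb

end

open MeasureTheory Filter Topology Set
open scoped ENNReal ComplexOrder ComplexConjugate

noncomputable section

namespace FreeProb

/-! ### Logarithmic potentials -/

/-! Write f for the density at k = 1, G for its Cauchy transform and G₊, G₋ for the boundary values
of G from above and below. Integration by parts turns the Cauchy kernel into a logarithm
(`cau_eq_logPot`), which is integrable across its singularity. Hence G and G' extend continuously to
the real axis, with G₊ = π(Hf − i f).

Positivity (iii). Under f dt, the covariance matrix of the functions 1/(z_j − t) has entries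
−(difference quotient of G + product of values of G). The matrix of K(z_j, conj z_l) is the
entrywise square of this matrix, divided by G(z_j) conj G(z_l), so the Schur product theorem
applies.

Derivative (i). For σ = G(z), the relation 1/G + R(G) = z says that the normalized k-th power has
Cauchy transform √k σ at (1/σ + k R(σ))/√k (`eventually_cau_eq`). Differentiating at k = 1 shows
that g, the right derivative of the density, has Cauchy transform G/2 − zG'/2 + G'/G. Imaginary
parts on the boundary give g wherever f ≠ 0, and 3∫ f² g is then computed with ∫ x f' f² = −(1/3)∫
f³. Dominated convergence needs supports bounded uniformly for k near 1. These come from an inverse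
function theorem jointly in k and σ (`exists_invertsRecipK`, `InvertsRecipK.cauchyTransform_eq`):
over a neighbourhood of infinity independent of k, the Cauchy transforms continue across the real
axis, so the densities vanish there.

Kernel limit (ii). Let D be the difference quotient of G at z, w. Then K = D²/(G(z)G(w)) + 2D +
G(z)G(w). In the sum over signs the last terms cancel, and the middle ones add up to −2∫ f (G₊ +
G₋)² in the limit, which the identity 3∫ f (Hf)² = ∫ f³ evaluates. Off the diagonal, D²/(G(z)G(w)) =
(G(z)/G(w) + G(w)/G(z) − 2)/(z − w)², so the singular part is a combination of forms ∬ u(x) v(y)/(x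
− y − iδ)² with u, v among fG, f/G and f. Two integrations by parts leave a logarithmic kernel
between u' and v', and the limit exists once these derivatives are bounded
(`ConvFamily.tendsto_pairing`). For f/G this is the crux: `exists_bound_by_horiz` shows f = O(|G|²)
and f' = O(|G|) uniformly up to the axis, because G₊ has only simple zeros and a nonnegative f
vanishes there to second order.

The limit is evaluated from `cau_symMul`, by which f(G₊ + G₋) has Cauchy transform G². Against f/G,
the derivative 2GG' of this transform cancels the denominator; the remaining form is treated through
f G₋ = f(G₊ + G₋)/2 + iπ f². -/

theorem norm_log_le_abs_log_add {s δ A D : ℝ} (hs : s ≠ 0) (hA : |s| ≤ A) (hδ : 0 ≤ δ)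
    (hD : δ ≤ D) :
    ‖Complex.log (s + δ * Complex.I)‖ ≤ |Real.log s| + |Real.log (A + D)| + Real.pi := by
  set z : ℂ := s + δ * Complex.I with hz
  have hre : z.re = s := by simp [hz]
  have him : z.im = δ := by simp [hz]
  have hs0 : 0 < |s| := abs_pos.2 hs
  have h1 : |s| ≤ ‖z‖ := by simpa [hre] using Complex.abs_re_le_norm z
  have h2 : ‖z‖ ≤ A + D := by
    refine (Complex.norm_le_abs_re_add_abs_im z).trans ?_
    rw [hre, him, abs_of_nonneg hδ]
    linarith
  have h3 : |Real.log ‖z‖| ≤ |Real.log s| + |Real.log (A + D)| := by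
    have e1 : Real.log |s| ≤ Real.log ‖z‖ := Real.log_le_log hs0 h1
    have e2 : Real.log ‖z‖ ≤ Real.log (A + D) := Real.log_le_log (hs0.trans_le h1) h2
    rw [Real.log_abs] at e1
    have := neg_abs_le (Real.log s)
    have := le_abs_self (Real.log (A + D))
    have := abs_nonneg (Real.log s)
    have := abs_nonneg (Real.log (A + D))
    rw [abs_le]
    constructor <;> linarith
  have h4 := Complex.norm_le_abs_re_add_abs_im (Complex.log z)
  rw [Complex.log_re, Complex.log_im] at h4
  have := Complex.abs_arg_le_pi z
  linarith

theorem integrableOn_log_majorant (A c : ℝ) :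
    IntegrableOn (fun s => |Real.log s| + c) (Icc (-A) A) := by
  rcases le_or_gt 0 A with hA | hA
  · rw [integrableOn_Icc_iff_integrableOn_Ioc, ← intervalIntegrable_iff_integrableOn_Ioc_of_le
      (by linarith)]
    exact (intervalIntegral.intervalIntegrable_log'.abs).add intervalIntegrable_const
  · rw [Icc_eq_empty (by linarith)]
    exact integrableOn_empty

/-- The integral of a logarithmic majorant on `[-A, A]`. -/
def logMass (A D : ℝ) : ℝ :=
  ∫ s in Icc (-A) A, (|Real.log s| + (|Real.log (A + D)| + Real.pi))

theorem norm_mul_log_le {w : ℝ → ℂ} {A C D δ : ℝ} (hδ : 0 ≤ δ) (hD : δ ≤ D)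
    (hw : ∀ s, A < |s| → w s = 0) (hC : ∀ s, ‖w s‖ ≤ C) {s : ℝ} (hs : s ≠ 0) :
    ‖w s * Complex.log (s + δ * Complex.I)‖ ≤
      (Icc (-A) A).indicator (fun s => C * (|Real.log s| + (|Real.log (A + D)| + Real.pi))) s := by
  have hC0 : 0 ≤ C := (norm_nonneg _).trans (hC 0)
  by_cases h : s ∈ Icc (-A) A
  · rw [indicator_of_mem h, norm_mul]
    have := norm_log_le_abs_log_add hs (abs_le.2 h) hδ hD
    gcongr
    · exact hC s
    · linarith
  · rw [indicator_of_notMem h, hw s, zero_mul, norm_zero]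
    by_contra h'
    exact h (abs_le.1 (not_lt.1 h'))

theorem integrable_indicator_log_majorant (A C D : ℝ) :
    Integrable ((Icc (-A) A).indicator
      (fun s => C * (|Real.log s| + (|Real.log (A + D)| + Real.pi)))) :=
  (integrable_indicator_iff measurableSet_Icc).2 ((integrableOn_log_majorant A _).const_mul C)

theorem ae_ne_zero_real : ∀ᵐ s : ℝ, s ≠ 0 := by
  simp [ae_iff]

/-- The majorant of the logarithm is integrable across 0 and does not depend on δ in [0, D], so the
bound persists down to the real axis. -/
theorem norm_integral_mul_log_le {w : ℝ → ℂ} {A C D δ : ℝ} (hδ : 0 ≤ δ) (hD : δ ≤ D)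
    (hw : ∀ s, A < |s| → w s = 0) (hC : ∀ s, ‖w s‖ ≤ C) :
    ‖∫ s : ℝ, w s * Complex.log (s + δ * Complex.I)‖ ≤ C * logMass A D := by
  refine (norm_integral_le_of_norm_le (integrable_indicator_log_majorant A C D)
    (ae_ne_zero_real.mono fun s hs => norm_mul_log_le hδ hD hw hC hs)).trans ?_
  rw [integral_indicator measurableSet_Icc, integral_const_mul, logMass]

theorem measurable_log_add (δ : ℝ) : Measurable fun s : ℝ => Complex.log (s + δ * Complex.I) := by
  fun_prop

/-- The principal branch jumps across the negative axis but is continuous there from the closed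
upper half-plane, which is why the heights must be nonnegative. -/
theorem tendsto_log_add {ι : Type*} {l : Filter ι} {δ : ι → ℝ} {δ₀ s : ℝ} (hs : s ≠ 0)
    (hδ : Tendsto δ l (𝓝 δ₀)) (hδ' : ∀ᶠ i in l, 0 ≤ δ i) :
    Tendsto (fun i => Complex.log (s + δ i * Complex.I)) l
      (𝓝 (Complex.log (s + δ₀ * Complex.I))) := by
  have hcont : Tendsto (fun i => (s : ℂ) + δ i * Complex.I) l (𝓝 (s + δ₀ * Complex.I)) :=
    tendsto_const_nhds.add (((Complex.continuous_ofReal.tendsto _).comp hδ).mul_const _)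
  by_cases h : s < 0 ∧ δ₀ = 0
  · have := Complex.continuousWithinAt_log_of_re_neg_of_im_zero
      (z := (s : ℂ) + δ₀ * Complex.I) (by simpa using h.1) (by simpa using h.2)
    refine this.tendsto.comp (tendsto_nhdsWithin_iff.2 ⟨hcont, ?_⟩)
    filter_upwards [hδ'] with i hi
    simpa using hi
  · refine (continuousAt_clog ?_).tendsto.comp hcont
    rw [Complex.mem_slitPlane_iff]
    simp only [Complex.add_re, Complex.ofReal_re, Complex.mul_re, Complex.I_re, mul_zero,
      Complex.ofReal_im, Complex.I_im, sub_zero, add_zero, Complex.add_im,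
      Complex.mul_im, mul_one, zero_add]
    rcases lt_or_gt_of_ne hs with h' | h'
    · exact Or.inr fun h0 => h ⟨h', h0⟩
    · exact Or.inl h'

theorem tendsto_integral_mul_log {ι : Type*} {l : Filter ι} [l.IsCountablyGenerated]
    {w : ι → ℝ → ℂ} {w₀ : ℝ → ℂ} {δ : ι → ℝ} {δ₀ A C : ℝ}
    (hmeas : ∀ᶠ i in l, AEStronglyMeasurable (w i))
    (hsupp : ∀ᶠ i in l, ∀ s, A < |s| → w i s = 0) (hbd : ∀ᶠ i in l, ∀ s, ‖w i s‖ ≤ C)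
    (hlim : ∀ s, Tendsto (fun i => w i s) l (𝓝 (w₀ s)))
    (hδ : Tendsto δ l (𝓝 δ₀)) (hδ' : ∀ᶠ i in l, 0 ≤ δ i) :
    Tendsto (fun i => ∫ s : ℝ, w i s * Complex.log (s + δ i * Complex.I)) l
      (𝓝 (∫ s : ℝ, w₀ s * Complex.log (s + δ₀ * Complex.I))) := by
  have hD : ∀ᶠ i in l, δ i ≤ δ₀ + 1 := (hδ.eventually_lt_const (lt_add_one _)).mono fun _ => le_of_lt
  refine tendsto_integral_filter_of_dominated_convergence _ ?_ ?_
    (integrable_indicator_log_majorant A C (δ₀ + 1)) ?_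
  · filter_upwards [hmeas] with i hi
    exact hi.mul (measurable_log_add _).aestronglyMeasurable
  · filter_upwards [hsupp, hbd, hδ', hD] with i h1 h2 h3 h4
    exact ae_ne_zero_real.mono fun s hs => norm_mul_log_le h3 h4 h1 h2 hs
  · exact ae_ne_zero_real.mono fun s hs => (hlim s).mul (tendsto_log_add hs hδ hδ')

/-- The logarithmic potential of `w` at the point `x + iε` of the closed upper half-plane. -/
def logPot (w : ℝ → ℂ) (x ε : ℝ) : ℂ :=
  ∫ s : ℝ, w (x - s) * Complex.log (s + ε * Complex.I)

/-- The Cauchy transform of a function. -/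
def cau (g : ℝ → ℂ) (z : ℂ) : ℂ :=
  ∫ x : ℝ, g x / (z - x)

theorem logPot_eq (w : ℝ → ℂ) (x ε : ℝ) :
    logPot w x ε = ∫ s : ℝ, w s * Complex.log ((x - s : ℝ) + ε * Complex.I) := by
  rw [logPot, ← integral_sub_left_eq_self _ volume x]
  simp

theorem continuous_eq_zero_of_hasCompactSupport {w : ℝ → ℂ} (hc : HasCompactSupport w) :
    ∃ A, 0 < A ∧ ∀ s, A < |s| → w s = 0 := by
  obtain ⟨A, hA, hA'⟩ := hc.isCompact.isBounded.exists_pos_norm_le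
  refine ⟨A, hA, fun s hs => ?_⟩
  by_contra h
  exact absurd (hA' s (subset_tsupport _ h)) (by simpa using hs)

theorem exists_bound_of_hasCompactSupport {w : ℝ → ℂ} (hw : Continuous w)
    (hc : HasCompactSupport w) : ∃ C, ∀ s, ‖w s‖ ≤ C :=
  hw.bounded_above_of_compact_support hc

/-- In the convolution form of `logPot` the point x moves only inside w, while the singularity of
the logarithm stays at s = 0. A single majorant therefore works near any point, including those on
the boundary. -/
theorem continuousOn_logPot {w : ℝ → ℂ} (hw : Continuous w) (hc : HasCompactSupport w) :
    ContinuousOn (fun p : ℝ × ℝ => logPot w p.1 p.2) (univ ×ˢ Ici 0) := by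
  rintro ⟨x, ε⟩ -
  obtain ⟨A, hA, hsupp⟩ := continuous_eq_zero_of_hasCompactSupport hc
  obtain ⟨C, hC⟩ := exists_bound_of_hasCompactSupport hw hc
  have h1 : Tendsto (fun p : ℝ × ℝ => p.1) (𝓝[univ ×ˢ Ici 0] (x, ε)) (𝓝 x) :=
    (continuous_fst.tendsto _).mono_left nhdsWithin_le_nhds
  have h2 : Tendsto (fun p : ℝ × ℝ => p.2) (𝓝[univ ×ˢ Ici 0] (x, ε)) (𝓝 ε) :=
    (continuous_snd.tendsto _).mono_left nhdsWithin_le_nhds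
  refine tendsto_integral_mul_log (w := fun p : ℝ × ℝ => fun s => w (p.1 - s))
    (A := A + |x| + 1) (C := C) ?_ ?_ ?_ ?_ h2 ?_
  · exact Eventually.of_forall fun p => (hw.comp (by fun_prop)).aestronglyMeasurable
  · filter_upwards [h1.eventually (Metric.ball_mem_nhds x one_pos)] with p hp s hs
    apply hsupp
    rw [Real.dist_eq] at hp
    have := abs_sub_abs_le_abs_sub s p.1
    have := abs_sub_abs_le_abs_sub p.1 x
    rw [abs_sub_comm p.1 s]
    linarith
  · exact Eventually.of_forall fun p s => hC _
  · intro s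
    exact (hw.tendsto _).comp (h1.sub_const s)
  · filter_upwards [self_mem_nhdsWithin] with p hp
    exact hp.2

theorem hasDerivAt_clog_sub {x ε : ℝ} (hε : 0 < ε) (s : ℝ) :
    HasDerivAt (fun s : ℝ => Complex.log ((x : ℂ) + ε * Complex.I - s))
      (-(1 / ((x : ℂ) + ε * Complex.I - s))) s := by
  have h : HasDerivAt (fun s : ℝ => (x : ℂ) + ε * Complex.I - s) (-1) s := by
    simpa using (Complex.ofRealCLM.hasDerivAt (x := s)).const_sub ((x : ℂ) + ε * Complex.I)
  have := h.clog_real (by rw [Complex.mem_slitPlane_iff]; right; simpa using hε.ne')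
  simpa [neg_div] using this

theorem ofReal_add_mul_I_sub_ne_zero {x ε : ℝ} (hε : ε ≠ 0) (s : ℝ) :
    (x : ℂ) + ε * Complex.I - s ≠ 0 := by
  intro h
  have := congrArg Complex.im h
  simp at this
  exact hε this

theorem sub_ofReal_ne_zero {z : ℂ} (hz : z.im ≠ 0) (s : ℝ) : z - s ≠ 0 := by
  intro h
  have := congrArg Complex.im h
  simp at this
  exact hz this

/-- Integration by parts. The right side, unlike the Cauchy kernel, makes sense at ε = 0 and defines
the boundary values. -/
theorem cau_eq_logPot {g : ℝ → ℂ} (hg : ContDiff ℝ 1 g) (hc : HasCompactSupport g) {x ε : ℝ}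
    (hε : 0 < ε) : cau g (x + ε * Complex.I) = logPot (deriv g) x ε := by
  have hne := fun s : ℝ => ofReal_add_mul_I_sub_ne_zero (x := x) hε.ne' s
  have hlog : Continuous fun s : ℝ => Complex.log ((x : ℂ) + ε * Complex.I - s) :=
    continuous_iff_continuousAt.2 fun s => (hasDerivAt_clog_sub hε s).continuousAt
  have hinv : Continuous fun s : ℝ => -(1 / ((x : ℂ) + ε * Complex.I - s)) := by
    fun_prop (disch := exact hne _)
  have key := integral_mul_deriv_eq_deriv_mul_of_integrable (u := g) (u' := deriv g)
    (v := fun s : ℝ => Complex.log ((x : ℂ) + ε * Complex.I - s))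
    (v' := fun s : ℝ => -(1 / ((x : ℂ) + ε * Complex.I - s)))
    (fun s _ => (hg.differentiable one_ne_zero s).hasDerivAt)
    (fun s _ => hasDerivAt_clog_sub hε s)
    ((hg.continuous.mul hinv).integrable_of_hasCompactSupport hc.mul_right)
    (((hg.continuous_deriv le_rfl).mul hlog).integrable_of_hasCompactSupport hc.deriv.mul_right)
    ((hg.continuous.mul hlog).integrable_of_hasCompactSupport hc.mul_right)
  rw [logPot_eq, cau]
  simp only [mul_neg, integral_neg, neg_inj, mul_one_div] at key
  rw [key]
  congr 1 with s
  congr 2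
  push_cast
  ring

/-- On the axis `logPot` is a convolution with the locally integrable function log, so the
derivative may be put on the smooth factor. -/
theorem hasDerivAt_logPot_zero {w : ℝ → ℂ} (hw : ContDiff ℝ 1 w) (hc : HasCompactSupport w)
    (x : ℝ) : HasDerivAt (fun x => logPot w x 0) (logPot (deriv w) x 0) x := by
  have hloc : LocallyIntegrable (fun s : ℝ => Complex.log s) := by
    rw [locallyIntegrable_iff]
    intro K hK
    obtain ⟨A, hA, hA'⟩ := hK.isBounded.exists_pos_norm_le
    refine IntegrableOn.mono_set (t := Icc (-A) A) ?_ fun s hs => abs_le.1 (hA' s hs)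
    refine Integrable.mono' (integrableOn_log_majorant A (|Real.log (A + 0)| + Real.pi)) ?_ ?_
    · exact (Complex.measurable_log.comp Complex.measurable_ofReal).aestronglyMeasurable
    · rw [ae_restrict_iff' measurableSet_Icc]
      filter_upwards [ae_ne_zero_real] with s hs hs'
      simpa [add_assoc] using norm_log_le_abs_log_add (δ := 0) (D := 0) hs (abs_le.2 hs') le_rfl le_rfl
  have := hc.hasDerivAt_convolution_right (ContinuousLinearMap.mul ℝ ℂ) hloc hw x
  have e : ∀ v : ℝ → ℂ, (fun x => logPot v x 0) =
      convolution (fun s : ℝ => Complex.log s) v (ContinuousLinearMap.mul ℝ ℂ) volume := by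
    intro v
    ext y
    simp [logPot, convolution, mul_comm]
  rw [e, show logPot (deriv w) x 0 = (fun x => logPot (deriv w) x 0) x from rfl, e]
  exact this

/-! ### Cauchy transforms of functions -/

theorem abs_im_le_norm_sub (z : ℂ) (x : ℝ) : |z.im| ≤ ‖z - x‖ := by
  simpa using Complex.abs_im_le_norm (z - x)

theorem integrable_div_sub_pow {g : ℝ → ℂ} (hg : Integrable g) {z : ℂ} (hz : z.im ≠ 0) (n : ℕ) :
    Integrable fun x : ℝ => g x / (z - x) ^ n := by
  simp only [div_eq_mul_inv]
  refine hg.mul_bdd (c := (|z.im| ^ n)⁻¹) ?_ (Eventually.of_forall fun x => ?_)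
  · exact Measurable.aestronglyMeasurable (by fun_prop)
  · rw [norm_inv, norm_pow]
    have := abs_im_le_norm_sub z x
    have := abs_pos.2 hz
    gcongr

theorem hasDerivAt_cau {g : ℝ → ℂ} (hg : Integrable g) {z : ℂ} (hz : z.im ≠ 0) :
    HasDerivAt (cau g) (-∫ x : ℝ, g x / (z - x) ^ 2) z := by
  have hpos : 0 < |z.im| / 2 := by have := abs_pos.2 hz; positivity
  have hball : ∀ w ∈ Metric.ball z (|z.im| / 2), |z.im| / 2 ≤ |w.im| := by
    intro w hw
    rw [Metric.mem_ball, dist_eq_norm] at hw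
    have h1 := Complex.abs_im_le_norm (w - z)
    rw [Complex.sub_im] at h1
    have h2 := abs_sub_abs_le_abs_sub z.im w.im
    rw [abs_sub_comm] at h2
    linarith
  have hne : ∀ w ∈ Metric.ball z (|z.im| / 2), w.im ≠ 0 := fun w hw =>
    abs_pos.1 (hpos.trans_le (hball w hw))
  have key := hasDerivAt_integral_of_dominated_loc_of_deriv_le (μ := volume)
    (F := fun (w : ℂ) (x : ℝ) => g x / (w - x)) (F' := fun (w : ℂ) (x : ℝ) => -(g x / (w - x) ^ 2))
    (x₀ := z) (s := Metric.ball z (|z.im| / 2))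
    (bound := fun x => ‖g x‖ / (|z.im| / 2) ^ 2) (Metric.ball_mem_nhds z hpos)
    ?_ ?_ ?_ ?_ ?_ ?_
  · have h := key.2
    rw [integral_neg] at h
    exact h
  · filter_upwards [Metric.ball_mem_nhds z hpos] with w hw
    simpa using (integrable_div_sub_pow hg (hne w hw) 1).aestronglyMeasurable
  · simpa using integrable_div_sub_pow hg hz 1
  · exact (integrable_div_sub_pow hg hz 2).neg.aestronglyMeasurable
  · refine Eventually.of_forall fun x w hw => ?_
    rw [norm_neg, norm_div, norm_pow]
    have := (hball w hw).trans (abs_im_le_norm_sub w x)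
    gcongr
  · exact hg.norm.div_const _
  · refine Eventually.of_forall fun x w hw => ?_
    have hw' := sub_ofReal_ne_zero (hne w hw) x
    have := (((hasDerivAt_id w).sub_const (x : ℂ)).fun_inv hw').const_mul (g x)
    refine this.congr_deriv ?_
    simp [div_eq_mul_inv]

theorem integral_div_sub_sq {g : ℝ → ℂ} (hg : ContDiff ℝ 1 g) (hc : HasCompactSupport g) {z : ℂ}
    (hz : z.im ≠ 0) : ∫ x : ℝ, g x / (z - x) ^ 2 = -cau (deriv g) z := by
  have hne := fun s : ℝ => sub_ofReal_ne_zero hz s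
  have hne2 := fun s : ℝ => pow_ne_zero 2 (sub_ofReal_ne_zero hz s)
  have h1 : Continuous fun s : ℝ => (z - s)⁻¹ := by fun_prop (disch := exact hne _)
  have h2 : Continuous fun s : ℝ => 1 / (z - s) ^ 2 := by fun_prop (disch := exact hne2 _)
  have hd : ∀ s : ℝ, HasDerivAt (fun s : ℝ => (z - s)⁻¹) (1 / (z - s) ^ 2) s := by
    intro s
    have h : HasDerivAt (fun s : ℝ => z - s) (-1) s := by
      simpa using (Complex.ofRealCLM.hasDerivAt (x := s)).const_sub z
    simpa using h.fun_inv (hne s)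
  have key := integral_mul_deriv_eq_deriv_mul_of_integrable (u := g) (u' := deriv g)
    (v := fun s : ℝ => (z - s)⁻¹) (v' := fun s : ℝ => 1 / (z - s) ^ 2)
    (fun s _ => (hg.differentiable one_ne_zero s).hasDerivAt) (fun s _ => hd s)
    ((hg.continuous.mul h2).integrable_of_hasCompactSupport hc.mul_right)
    (((hg.continuous_deriv le_rfl).mul h1).integrable_of_hasCompactSupport hc.deriv.mul_right)
    ((hg.continuous.mul h1).integrable_of_hasCompactSupport hc.mul_right)
  simpa [mul_one_div, cau, div_eq_mul_inv] using key

theorem hasDerivAt_cau_of_contDiff {g : ℝ → ℂ} (hg : ContDiff ℝ 1 g) (hc : HasCompactSupport g)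
    {z : ℂ} (hz : z.im ≠ 0) : HasDerivAt (cau g) (cau (deriv g) z) z := by
  have := hasDerivAt_cau (hg.continuous.integrable_of_hasCompactSupport hc) hz
  rwa [integral_div_sub_sq hg hc hz, neg_neg] at this

theorem cau_conj (g : ℝ → ℂ) (z : ℂ) : cau (fun x => conj (g x)) (conj z) = conj (cau g z) := by
  rw [cau, cau, ← integral_conj]
  simp

theorem cau_ofReal_conj (f : ℝ → ℝ) (z : ℂ) :
    cau (fun x => (f x : ℂ)) (conj z) = conj (cau (fun x => (f x : ℂ)) z) := by
  rw [← cau_conj]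
  simp

/-- The jump iπ on the negative half-line is the source of the imaginary part of the boundary
values. -/
theorem clog_ofReal_eq (s : ℝ) :
    Complex.log s = Real.log s + (Iio (0 : ℝ)).indicator (fun _ => Real.pi * Complex.I) s := by
  rcases lt_or_ge s 0 with h | h
  · rw [indicator_of_mem (by exact h)]
    apply Complex.ext
    · simp [Complex.log_re]
    · simp [Complex.log_im, Complex.arg_ofReal_of_neg h]
  · rw [indicator_of_notMem (by simpa using h), Complex.ofReal_log h, add_zero]

theorem integrable_mul_log {w : ℝ → ℂ} (hw : Continuous w) (hc : HasCompactSupport w) :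
    Integrable fun s : ℝ => w s * (Real.log s : ℂ) := by
  obtain ⟨A, hA, hsupp⟩ := continuous_eq_zero_of_hasCompactSupport hc
  obtain ⟨C, hC⟩ := exists_bound_of_hasCompactSupport hw hc
  have hi := (integrable_indicator_iff measurableSet_Icc).2
    (((integrableOn_log_majorant A 0).const_mul C))
  refine Integrable.mono' hi ?_ (Eventually.of_forall fun s => ?_)
  · exact hw.aestronglyMeasurable.mul
      (Complex.measurable_ofReal.comp Real.measurable_log).aestronglyMeasurable
  · by_cases h : s ∈ Icc (-A) A
    · rw [indicator_of_mem h, norm_mul, Complex.norm_real, Real.norm_eq_abs, add_zero]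
      gcongr
      exact hC s
    · rw [indicator_of_notMem h, hsupp s, zero_mul, norm_zero]
      by_contra h'
      exact h (abs_le.1 (not_lt.1 h'))

theorem hasCompactSupport_comp_const_sub {E : Type*} [Zero E] {w : ℝ → E}
    (hc : HasCompactSupport w) (x : ℝ) :
    HasCompactSupport fun s => w (x - s) :=
  hc.comp_homeomorph (Homeomorph.subLeft x)

/-- The Sokhotski–Plemelj formula: the jump iπ of the logarithm, integrated against g'(x − s) over s
< 0, contributes −iπ g(x), and log|s| contributes the principal value. -/
theorem logPot_deriv_zero {g : ℝ → ℂ} (hg : ContDiff ℝ 1 g) (hc : HasCompactSupport g) (x : ℝ) :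
    logPot (deriv g) x 0 =
      (∫ s : ℝ, deriv g (x - s) * (Real.log s : ℂ)) - Real.pi * Complex.I * g x := by
  have hw : Continuous fun s => deriv g (x - s) := (hg.continuous_deriv le_rfl).comp (by fun_prop)
  have hcw := hasCompactSupport_comp_const_sub hc.deriv x
  have hd : ∀ s, HasDerivAt (fun s => -g (x - s)) (deriv g (x - s)) s := by
    intro s
    have h : HasDerivAt (fun s => x - s) (-1) s := by simpa using (hasDerivAt_id s).const_sub x
    refine ((hg.differentiable one_ne_zero (x - s)).hasDerivAt.scomp s h).fun_neg.congr_deriv ?_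
    simp
  have hint := hw.integrable_of_hasCompactSupport (μ := volume) hcw
  have hlim : Tendsto (fun s => -g (x - s)) atBot (𝓝 0) := by
    have h0 : (fun s => -g (x - s)) =ᶠ[cocompact ℝ] fun _ => 0 := by
      have := (hasCompactSupport_comp_const_sub hc x)
      rw [hasCompactSupport_iff_eventuallyEq, coclosedCompact_eq_cocompact] at this
      filter_upwards [this] with s hs
      simp [hs]
    exact (tendsto_const_nhds.congr' h0.symm).mono_left atBot_le_cocompact
  have h1 : ∫ s in Iic (0 : ℝ), deriv g (x - s) = -g x := by
    rw [integral_Iic_of_hasDerivAt_of_tendsto' (fun s _ => hd s) hint.integrableOn hlim]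
    simp
  rw [logPot]
  have h2 : ∀ s : ℝ, deriv g (x - s) * Complex.log (s + (0 : ℝ) * Complex.I) =
      deriv g (x - s) * (Real.log s : ℂ) +
        (Iio (0 : ℝ)).indicator (fun s => deriv g (x - s) * (Real.pi * Complex.I)) s := by
    intro s
    rw [Complex.ofReal_zero, zero_mul, add_zero, clog_ofReal_eq, mul_add]
    by_cases h : s ∈ Iio (0 : ℝ) <;> simp [h]
  simp_rw [h2]
  rw [integral_add (integrable_mul_log hw hcw), integral_indicator measurableSet_Iio,
    ← integral_Iic_eq_integral_Iio, integral_mul_const, h1]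
  · ring
  · exact (hint.mul_const _).indicator measurableSet_Iio

/-! ### The Hilbert transform -/

theorem integrable_mul_log_real {w : ℝ → ℝ} (hw : Continuous w) (hc : HasCompactSupport w) :
    Integrable fun s : ℝ => w s * Real.log s := by
  have := (integrable_mul_log (w := fun s => (w s : ℂ)) (by fun_prop)
    (hc.comp_left (g := fun x : ℝ => (x : ℂ)) rfl)).re
  simpa using this

theorem integral_Ioi_div_eq {F : ℝ → ℝ} (hF : ContDiff ℝ 1 F) (hc : HasCompactSupport F) {η : ℝ}
    (hη : 0 < η) :
    ∫ s in Ioi η, F s / s = -(F η * Real.log η) - ∫ s in Ioi η, deriv F s * Real.log s := by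
  have hint := hF.continuous.integrable_of_hasCompactSupport (μ := volume) hc
  have hcont : ContinuousAt (fun s => F s * Real.log s) η :=
    hF.continuous.continuousAt.mul (Real.continuousAt_log hη.ne')
  have h0 : (fun s => F s * Real.log s) =ᶠ[cocompact ℝ] fun _ => 0 := by
    rw [hasCompactSupport_iff_eventuallyEq, coclosedCompact_eq_cocompact] at hc
    filter_upwards [hc] with s hs
    simp [hs]
  have key := integral_Ioi_mul_deriv_eq_deriv_mul (u := F) (u' := deriv F) (v := Real.log)
    (v' := fun s => s⁻¹) (a := η) (a' := F η * Real.log η) (b' := 0)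
    (fun s _ => (hF.differentiable one_ne_zero s).hasDerivAt)
    (fun s hs => Real.hasDerivAt_log (hη.trans hs).ne') ?_ ?_
    (hcont.tendsto.mono_left nhdsWithin_le_nhds)
    ((tendsto_const_nhds.congr' h0.symm).mono_left atTop_le_cocompact)
  · simpa [div_eq_mul_inv] using key
  · refine Integrable.mono' (hint.norm.div_const η).integrableOn ?_ ?_
    · exact (hF.continuous.measurable.mul measurable_inv).aestronglyMeasurable
    · rw [ae_restrict_iff' measurableSet_Ioi]
      refine Eventually.of_forall fun s hs => ?_
      have hs' : η < s := hs
      rw [Pi.mul_apply, norm_mul, norm_inv, ← div_eq_mul_inv, Real.norm_of_nonneg (hη.trans hs').le]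
      gcongr
  · exact (integrable_mul_log_real (hF.continuous_deriv le_rfl) hc.deriv).integrableOn

/-- Integration by parts on each of the two half-lines leaves the boundary term (F(−η) − F(η)) log
η. It is O(η log η) because F is differentiable at 0; the remaining integrals converge since log is
locally integrable. -/
theorem tendsto_truncHilbert {f : ℝ → ℝ} (hf : ContDiff ℝ 1 f) (hc : HasCompactSupport f)
    (y : ℝ) :
    Tendsto (fun η => truncHilbert f η y) (𝓝[>] 0)
      (𝓝 (1 / Real.pi * ∫ s : ℝ, deriv f (y - s) * Real.log s)) := by
  set F : ℝ → ℝ := fun s => f (y - s) with hFdef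
  have hF : ContDiff ℝ 1 F := hf.comp (by fun_prop)
  have hcF : HasCompactSupport F := hasCompactSupport_comp_const_sub hc y
  have hdF : ∀ s, deriv F s = -deriv f (y - s) := fun s => deriv_comp_const_sub f y s
  set F' : ℝ → ℝ := fun s => F (-s) with hF'def
  have hF' : ContDiff ℝ 1 F' := hF.comp contDiff_neg
  have hcF' : HasCompactSupport F' := hcF.comp_homeomorph (Homeomorph.neg ℝ)
  have hdF' : ∀ s, deriv F' s = -deriv F (-s) := fun s => deriv_comp_neg F s
  have hint : Integrable fun s => deriv F s * Real.log s :=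
    integrable_mul_log_real (hF.continuous_deriv le_rfl) hcF.deriv
  have hdivint : ∀ η > (0 : ℝ), IntegrableOn (fun s => F s / s) {s | η < |s|} := by
    intro η hη
    have hmeas : MeasurableSet {s : ℝ | η < |s|} := measurableSet_lt measurable_const measurable_abs
    refine Integrable.mono'
      ((hF.continuous.integrable_of_hasCompactSupport hcF).norm.div_const η).integrableOn ?_ ?_
    · exact (hF.continuous.measurable.div measurable_id).aestronglyMeasurable
    · rw [ae_restrict_iff' hmeas]
      refine Eventually.of_forall fun s hs => ?_
      have hs' : η < |s| := hs
      rw [norm_div, Real.norm_eq_abs s]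
      gcongr
  have hunion : ∀ η : ℝ, {s : ℝ | η < |s|} = Ioi η ∪ Iio (-η) := by
    intro η
    ext s
    simp [lt_abs, lt_neg]
  have hneg : ∀ (φ : ℝ → ℝ) (η : ℝ), ∫ s in Iio (-η), φ s = ∫ s in Ioi η, φ (-s) := by
    intro φ η
    rw [integral_comp_neg_Ioi, integral_Iic_eq_integral_Iio]
  have hdisj : ∀ η > (0 : ℝ), Disjoint (Ioi η) (Iio (-η)) := by
    intro η hη
    rw [Set.disjoint_left]
    intro s hs hs'
    simp only [mem_Ioi, mem_Iio] at hs hs'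
    linarith
  have hform : ∀ η > (0 : ℝ), truncHilbert f η y = 1 / Real.pi *
      ((F (-η) - F η) * Real.log η - ∫ s in {s : ℝ | η < |s|}, deriv F s * Real.log s) := by
    intro η hη
    have e1 : ∫ x in {x : ℝ | η < |y - x|}, f x / (y - x) = ∫ s in {s : ℝ | η < |s|}, F s / s := by
      have m1 : MeasurableSet {x : ℝ | η < |y - x|} :=
        measurableSet_lt measurable_const (by fun_prop)
      have m2 : MeasurableSet {s : ℝ | η < |s|} := measurableSet_lt measurable_const measurable_abs
      rw [← integral_indicator m1, ← integral_indicator m2, ← integral_sub_left_eq_self _ volume y]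
      congr 1 with s
      by_cases h : η < |s| <;> simp [indicator, hFdef, h]
    rw [truncHilbert, e1]
    have i1 := hdivint η hη
    have i2 := hint.integrableOn (s := {s : ℝ | η < |s|})
    rw [hunion η] at i1 i2 ⊢
    rw [setIntegral_union (hdisj η hη) measurableSet_Iio i1.left_of_union i1.right_of_union,
      setIntegral_union (hdisj η hη) measurableSet_Iio i2.left_of_union i2.right_of_union,
      hneg, hneg, integral_Ioi_div_eq hF hcF hη]
    have e2 : ∫ s in Ioi η, F (-s) / -s = -∫ s in Ioi η, F' s / s := by
      rw [← integral_neg]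
      simp [hF'def, div_neg]
    have e3 : ∫ s in Ioi η, deriv F (-s) * Real.log (-s) =
        -∫ s in Ioi η, deriv F' s * Real.log s := by
      rw [← integral_neg]
      simp [hdF']
    rw [e2, e3, integral_Ioi_div_eq hF' hcF' hη]
    simp only [hF'def]
    ring
  have hlim1 : Tendsto (fun η : ℝ => (F (-η) - F η) * Real.log η) (𝓝[>] 0) (𝓝 0) := by
    have hd : HasDerivAt (fun η => F (-η) - F η) (-deriv F 0 - deriv F 0) 0 := by
      have h1 := (hF'.differentiable one_ne_zero 0).hasDerivAt
      rw [hdF', neg_zero] at h1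
      exact h1.sub (hF.differentiable one_ne_zero 0).hasDerivAt
    have h1 := (hasDerivAt_iff_tendsto_slope.1 hd).mono_left
      (nhdsWithin_mono 0 (fun x (hx : x ∈ Ioi (0 : ℝ)) => (ne_of_gt hx : x ≠ 0)))
    have h2 : Tendsto (fun η : ℝ => Real.log η * η) (𝓝[>] 0) (𝓝 0) := by
      simpa using tendsto_log_mul_rpow_nhdsGT_zero one_pos
    have h3 := h1.mul h2
    rw [mul_zero] at h3
    refine h3.congr' ?_
    filter_upwards [self_mem_nhdsWithin] with η hη
    have : η ≠ 0 := ne_of_gt hη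
    simp only [slope_def_field, neg_zero, sub_self, sub_zero]
    field_simp
  have hlim2 : Tendsto (fun η : ℝ => ∫ s in {s : ℝ | η < |s|}, deriv F s * Real.log s) (𝓝[>] 0)
      (𝓝 (∫ s, deriv F s * Real.log s)) := by
    have m2 : ∀ η, MeasurableSet {s : ℝ | η < |s|} := fun η =>
      measurableSet_lt measurable_const measurable_abs
    simp_rw [← integral_indicator (m2 _)]
    refine tendsto_integral_filter_of_dominated_convergence _ ?_ ?_ hint.norm ?_
    · exact Eventually.of_forall fun η => hint.aestronglyMeasurable.indicator (m2 η)
    · exact Eventually.of_forall fun η => Eventually.of_forall fun s => norm_indicator_le_norm_self _ _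
    · filter_upwards [ae_ne_zero_real] with s hs
      refine tendsto_const_nhds.congr' ?_
      filter_upwards [nhdsWithin_le_nhds (Iio_mem_nhds (abs_pos.2 hs))] with η hη
      rw [indicator_of_mem]
      exact hη
  have hfinal := (hlim1.sub hlim2).const_mul (1 / Real.pi)
  have e : 0 - ∫ s, deriv F s * Real.log s = ∫ s, deriv f (y - s) * Real.log s := by
    simp [hdF, integral_neg]
  rw [e] at hfinal
  refine hfinal.congr' ?_
  filter_upwards [self_mem_nhdsWithin] with η hη
  exact (hform η hη).symm

theorem hilbert_eq {f : ℝ → ℝ} (hf : ContDiff ℝ 1 f) (hc : HasCompactSupport f) (y : ℝ) :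
    hilbert f y = 1 / Real.pi * ∫ s : ℝ, deriv f (y - s) * Real.log s :=
  (tendsto_truncHilbert hf hc y).limUnder_eq

theorem deriv_ofReal_comp {f : ℝ → ℝ} (hf : Differentiable ℝ f) :
    deriv (fun x => (f x : ℂ)) = fun x => ((deriv f x : ℝ) : ℂ) :=
  funext fun x => ((hf x).hasDerivAt.ofReal_comp).deriv

theorem hasCompactSupport_ofReal {f : ℝ → ℝ} (hc : HasCompactSupport f) :
    HasCompactSupport fun x => (f x : ℂ) :=
  hc.comp_left (g := fun x : ℝ => (x : ℂ)) rfl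

theorem contDiff_ofReal_comp {f : ℝ → ℝ} {n : WithTop ℕ∞} (hf : ContDiff ℝ n f) :
    ContDiff ℝ n fun x => (f x : ℂ) :=
  Complex.ofRealCLM.contDiff.comp hf

theorem logPot_deriv_ofReal {f : ℝ → ℝ} (hf : ContDiff ℝ 1 f) (hc : HasCompactSupport f) (x : ℝ) :
    logPot (deriv fun x => (f x : ℂ)) x 0 = Real.pi * (hilbert f x - Complex.I * f x) := by
  rw [logPot_deriv_zero (contDiff_ofReal_comp hf) (hasCompactSupport_ofReal hc),
    deriv_ofReal_comp (hf.differentiable one_ne_zero), hilbert_eq hf hc]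
  have : ∫ s : ℝ, ((deriv f (x - s) : ℝ) : ℂ) * (Real.log s : ℂ) =
      ((∫ s : ℝ, deriv f (x - s) * Real.log s : ℝ) : ℂ) := by
    rw [← integral_complex_ofReal]
    simp
  rw [this]
  have hpi : (Real.pi : ℂ) ≠ 0 := by simp [Real.pi_ne_zero]
  push_cast
  field_simp

/-! ### The singular bilinear form `∬ u(x) v(y) / (x - y - iδ)²` and its limit as `δ → 0` -/

theorem hasCompactSupport_of_eq_zero {E : Type*} [Zero E] {w : ℝ → E} {A : ℝ}
    (h : ∀ s, A < |s| → w s = 0) : HasCompactSupport w :=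
  HasCompactSupport.of_support_subset_isCompact (isCompact_Icc (a := -A) (b := A)) fun s hs => by
    by_contra h'
    exact hs (h s (not_le.1 fun h'' => h' (abs_le.1 h'')))

/-- Dominated convergence for uniformly bounded functions supported in a fixed interval. -/
theorem tendsto_integral_of_bounded {E : Type*} [NormedAddCommGroup E] [NormedSpace ℝ E]
    {ι : Type*} {l : Filter ι} [l.IsCountablyGenerated] {F : ι → ℝ → E} {F₀ : ℝ → E} {A C : ℝ} (hmeas : ∀ᶠ i in l, AEStronglyMeasurable (F i))
    (hsupp : ∀ᶠ i in l, ∀ s, A < |s| → F i s = 0)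
    (hbd : ∀ᶠ i in l, ∀ s, |s| ≤ A → ‖F i s‖ ≤ C)
    (hlim : ∀ s, Tendsto (fun i => F i s) l (𝓝 (F₀ s))) :
    Tendsto (fun i => ∫ s, F i s) l (𝓝 (∫ s, F₀ s)) := by
  refine tendsto_integral_filter_of_dominated_convergence ((Icc (-A) A).indicator fun _ => C)
    hmeas ?_ ?_ (Eventually.of_forall hlim)
  · filter_upwards [hsupp, hbd] with i h1 h2
    refine Eventually.of_forall fun s => ?_
    by_cases h : s ∈ Icc (-A) A
    · rw [indicator_of_mem h]
      exact h2 s (abs_le.2 h)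
    · rw [indicator_of_notMem h, h1 s (not_le.1 fun h' => h (abs_le.1 h')), norm_zero]
  · exact (integrable_indicator_iff measurableSet_Icc).2 (integrableOn_const (by simp))

/-- The singular bilinear form `∬ u(x) v(y) / (x - y - iδ)² dx dy`. -/
def pairing (δ : ℝ) (u v : ℝ → ℂ) : ℂ :=
  ∫ x : ℝ, ∫ y : ℝ, u x * v y / (x - y - δ * Complex.I) ^ 2

theorem sub_sub_mul_I_ne_zero {δ : ℝ} (hδ : δ ≠ 0) (x y : ℝ) :
    (x : ℂ) - y - δ * Complex.I ≠ 0 := by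
  intro h
  have := congrArg Complex.im h
  simp at this
  exact hδ this

theorem continuous_pairing_integrand {δ : ℝ} (hδ : δ ≠ 0) {u v : ℝ → ℂ} (hu : Continuous u)
    (hv : Continuous v) :
    Continuous fun p : ℝ × ℝ => u p.1 * v p.2 / ((p.1 : ℂ) - p.2 - δ * Complex.I) ^ 2 := by
  have := fun p : ℝ × ℝ => pow_ne_zero 2 (sub_sub_mul_I_ne_zero hδ p.1 p.2)
  fun_prop (disch := exact this _)

theorem hasCompactSupport_of_prod {E : Type*} [Zero E] {A : ℝ} {F : ℝ × ℝ → E}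
    (h1 : ∀ p, A < |p.1| → F p = 0) (h2 : ∀ p, A < |p.2| → F p = 0) : HasCompactSupport F := by
  refine HasCompactSupport.of_support_subset_isCompact
    ((isCompact_Icc (a := -A) (b := A)).prod (isCompact_Icc (a := -A) (b := A))) fun p hp => ?_
  constructor
  · by_contra h'
    exact hp (h1 p (not_le.1 fun h'' => h' (abs_le.1 h'')))
  · by_contra h'
    exact hp (h2 p (not_le.1 fun h'' => h' (abs_le.1 h'')))

theorem hasCompactSupport_pairing_integrand {δ : ℝ} {u v : ℝ → ℂ} (hu : HasCompactSupport u)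
    (hv : HasCompactSupport v) :
    HasCompactSupport
      fun p : ℝ × ℝ => u p.1 * v p.2 / ((p.1 : ℂ) - p.2 - δ * Complex.I) ^ 2 := by
  obtain ⟨A, -, hA⟩ := continuous_eq_zero_of_hasCompactSupport hu
  obtain ⟨B, -, hB⟩ := continuous_eq_zero_of_hasCompactSupport hv
  refine hasCompactSupport_of_prod (A := max A B) (fun p hp => ?_) fun p hp => ?_
  · rw [hA _ ((le_max_left _ _).trans_lt hp)]; simp
  · rw [hB _ ((le_max_right _ _).trans_lt hp)]; simp

theorem integrable_pairing_integrand {δ : ℝ} (hδ : δ ≠ 0) {u v : ℝ → ℂ} (hu : Continuous u)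
    (hv : Continuous v) (hcu : HasCompactSupport u) (hcv : HasCompactSupport v) :
    Integrable fun p : ℝ × ℝ => u p.1 * v p.2 / ((p.1 : ℂ) - p.2 - δ * Complex.I) ^ 2 :=
  (continuous_pairing_integrand hδ hu hv).integrable_of_hasCompactSupport
    (hasCompactSupport_pairing_integrand hcu hcv)

theorem pairing_eq_integral_prod {δ : ℝ} (hδ : δ ≠ 0) {u v : ℝ → ℂ} (hu : Continuous u)
    (hv : Continuous v) (hcu : HasCompactSupport u) (hcv : HasCompactSupport v) :
    pairing δ u v =
      ∫ p : ℝ × ℝ, u p.1 * v p.2 / ((p.1 : ℂ) - p.2 - δ * Complex.I) ^ 2 := by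
  rw [Measure.volume_eq_prod, integral_prod _ (integrable_pairing_integrand hδ hu hv hcu hcv)]
  rfl

theorem pairing_add_left {δ : ℝ} (hδ : δ ≠ 0) {u₁ u₂ v : ℝ → ℂ} (hu₁ : Continuous u₁)
    (hu₂ : Continuous u₂) (hv : Continuous v) (hcu₁ : HasCompactSupport u₁)
    (hcu₂ : HasCompactSupport u₂) (hcv : HasCompactSupport v) :
    pairing δ (fun x => u₁ x + u₂ x) v = pairing δ u₁ v + pairing δ u₂ v := by
  rw [pairing_eq_integral_prod hδ (u := fun x => u₁ x + u₂ x) (hu₁.add hu₂) hv (hcu₁.add hcu₂) hcv,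
    pairing_eq_integral_prod hδ hu₁ hv hcu₁ hcv, pairing_eq_integral_prod hδ hu₂ hv hcu₂ hcv,
    ← integral_add (integrable_pairing_integrand hδ hu₁ hv hcu₁ hcv)
      (integrable_pairing_integrand hδ hu₂ hv hcu₂ hcv)]
  congr 1 with p
  ring

theorem pairing_swap {δ : ℝ} (hδ : δ ≠ 0) {u v : ℝ → ℂ} (hu : Continuous u)
    (hv : Continuous v) (hcu : HasCompactSupport u) (hcv : HasCompactSupport v) :
    pairing δ u v = ∫ y : ℝ, ∫ x : ℝ, u x * v y / (x - y - δ * Complex.I) ^ 2 :=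
  integral_integral_swap_of_hasCompactSupport
    (f := fun x y : ℝ => u x * v y / (x - y - δ * Complex.I) ^ 2)
    (continuous_pairing_integrand hδ hu hv) (hasCompactSupport_pairing_integrand hcu hcv)

/-- Conjugation changes the sign of δ in the kernel, and exchanging x and y changes it back. -/
theorem pairing_conj {δ : ℝ} (hδ : δ ≠ 0) {u v : ℝ → ℂ} (hu : Continuous u)
    (hv : Continuous v) (hcu : HasCompactSupport u) (hcv : HasCompactSupport v) :
    pairing δ (fun x => conj (v x)) (fun x => conj (u x)) = conj (pairing δ u v) := by
  rw [pairing_swap hδ hu hv hcu hcv, pairing, ← integral_conj]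
  congr 1 with y
  rw [← integral_conj]
  congr 1 with x
  simp only [map_div₀, map_mul, map_pow, map_sub, Complex.conj_ofReal, Complex.conj_I]
  rw [mul_comm]
  congr 1
  ring

/-- For fixed y the kernel is that of a differentiated Cauchy transform at y + iδ, so an integration
by parts in x passes the derivative to u. -/
theorem pairing_eq_neg_integral_mul_cau {δ : ℝ} (hδ : δ ≠ 0) {u v : ℝ → ℂ} (hu : ContDiff ℝ 1 u)
    (hv : Continuous v) (hcu : HasCompactSupport u) (hcv : HasCompactSupport v) :
    pairing δ u v = -∫ y : ℝ, v y * cau (deriv u) (y + δ * Complex.I) := by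
  rw [pairing_swap hδ hu.continuous hv hcu hcv, ← integral_neg]
  congr 1 with y
  rw [← mul_neg, ← integral_div_sub_sq hu hcu (by simpa using hδ), ← integral_const_mul]
  congr 1 with x
  rw [mul_comm (u x), mul_div_assoc]
  congr 2
  ring

theorem hasDerivAt_cau_horizontal {g : ℝ → ℂ} (hg : ContDiff ℝ 1 g) (hc : HasCompactSupport g)
    {δ : ℝ} (hδ : δ ≠ 0) (y : ℝ) :
    HasDerivAt (fun y : ℝ => cau g (y + δ * Complex.I)) (cau (deriv g) (y + δ * Complex.I)) y := by
  have h1 := hasDerivAt_cau_of_contDiff hg hc (z := y + δ * Complex.I) (by simpa using hδ)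
  have h2 : HasDerivAt (fun y : ℝ => (y : ℂ) + δ * Complex.I) 1 y :=
    (Complex.ofRealCLM.hasDerivAt (x := y)).add_const _
  exact (h1.comp y h2).congr_deriv (mul_one _)

theorem continuous_cau_horizontal {g : ℝ → ℂ} (hg : Integrable g) {δ : ℝ} (hδ : δ ≠ 0) :
    Continuous (fun y : ℝ => cau g (y + δ * Complex.I)) := by
  refine continuous_iff_continuousAt.2 fun y => ?_
  have h1 := (hasDerivAt_cau hg (z := y + δ * Complex.I) (by simpa using hδ)).continuousAt
  exact ContinuousAt.comp (f := fun y : ℝ => (y : ℂ) + δ * Complex.I) h1 (by fun_prop)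

/-- The second integration by parts, now in y. Together with `cau_eq_logPot` it spreads the two
orders of singularity over u and v, and only a logarithmic kernel is left. -/
theorem pairing_eq_integral_deriv_mul_cau {δ : ℝ} (hδ : δ ≠ 0) {u v : ℝ → ℂ}
    (hu : ContDiff ℝ 1 u) (hv : ContDiff ℝ 1 v) (hcu : HasCompactSupport u)
    (hcv : HasCompactSupport v) :
    pairing δ u v = ∫ y : ℝ, deriv v y * cau u (y + δ * Complex.I) := by
  rw [pairing_eq_neg_integral_mul_cau hδ hu hv.continuous hcu hcv]
  have c1 := continuous_cau_horizontal
    (hu.continuous.integrable_of_hasCompactSupport (μ := volume) hcu) hδ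
  have c2 := continuous_cau_horizontal
    ((hu.continuous_deriv le_rfl).integrable_of_hasCompactSupport (μ := volume) hcu.deriv) hδ
  rw [integral_mul_deriv_eq_deriv_mul_of_integrable (u := v) (u' := deriv v)
    (v := fun y : ℝ => cau u (y + δ * Complex.I))
    (v' := fun y : ℝ => cau (deriv u) (y + δ * Complex.I))
    (fun s _ => (hv.differentiable one_ne_zero s).hasDerivAt)
    (fun s _ => hasDerivAt_cau_horizontal hu hcu hδ s)
    ((hv.continuous.mul c2).integrable_of_hasCompactSupport hcv.mul_right)
    (((hv.continuous_deriv le_rfl).mul c1).integrable_of_hasCompactSupport hcv.deriv.mul_right)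
    ((hv.continuous.mul c1).integrable_of_hasCompactSupport hcv.mul_right), neg_neg]

/-- The limit of `pairing δ` as `δ → 0+`, in terms of the derivatives of the arguments. -/
def logForm (w w' : ℝ → ℂ) : ℂ :=
  ∫ y : ℝ, w' y * logPot w y 0

theorem tendsto_half_nhdsGT : Tendsto (fun ε : ℝ => ε / 2) (𝓝[>] 0) (𝓝[>] 0) := by
  refine tendsto_nhdsWithin_iff.2 ⟨?_, ?_⟩
  · have : Tendsto (fun ε : ℝ => ε / 2) (𝓝 0) (𝓝 (0 / 2)) := tendsto_id.div_const 2
    rw [zero_div] at this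
    exact this.mono_left nhdsWithin_le_nhds
  · filter_upwards [self_mem_nhdsWithin] with ε hε
    exact half_pos (mem_Ioi.1 hε)

theorem tendsto_two_mul_nhdsGT : Tendsto (fun ε : ℝ => 2 * ε) (𝓝[>] 0) (𝓝[>] 0) := by
  refine tendsto_nhdsWithin_iff.2 ⟨?_, ?_⟩
  · have : Tendsto (fun ε : ℝ => 2 * ε) (𝓝 0) (𝓝 (2 * 0)) := tendsto_id.const_mul 2
    rw [mul_zero] at this
    exact this.mono_left nhdsWithin_le_nhds
  · filter_upwards [self_mem_nhdsWithin] with ε hε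
    exact mul_pos two_pos (mem_Ioi.1 hε)

/-- A family of continuously differentiable functions, uniformly Lipschitz and supported in a fixed
interval, whose derivatives converge pointwise to `w` as `ε → 0+`. -/
structure ConvFamily (A C : ℝ) (u : ℝ → ℝ → ℂ) (w : ℝ → ℂ) : Prop where
  contDiff : ∀ ε, 0 < ε → ε ≤ 1 → ContDiff ℝ 1 (u ε)
  eq_zero : ∀ ε, 0 < ε → ε ≤ 1 → ∀ x, A < |x| → u ε x = 0
  bound : ∀ ε, 0 < ε → ε ≤ 1 → ∀ x, ‖deriv (u ε) x‖ ≤ C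
  tendsto : ∀ x, Tendsto (fun ε => deriv (u ε) x) (𝓝[>] 0) (𝓝 (w x))

namespace ConvFamily

variable {A C C' : ℝ} {u v : ℝ → ℝ → ℂ} {w w' : ℝ → ℂ}

theorem hasCompactSupport (h : ConvFamily A C u w) {ε : ℝ} (h0 : 0 < ε) (h1 : ε ≤ 1) :
    HasCompactSupport (u ε) :=
  hasCompactSupport_of_eq_zero (h.eq_zero ε h0 h1)

theorem deriv_eq_zero (h : ConvFamily A C u w) {ε : ℝ} (h0 : 0 < ε) (h1 : ε ≤ 1) {x : ℝ}
    (hx : A < |x|) : deriv (u ε) x = 0 := by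
  have : u ε =ᶠ[𝓝 x] fun _ => 0 := by
    filter_upwards [continuous_abs.tendsto x |>.eventually (lt_mem_nhds hx)] with y hy
    exact h.eq_zero ε h0 h1 y hy
  rw [this.deriv_eq, deriv_const]

theorem add (h : ConvFamily A C u w) (h' : ConvFamily A C' v w') :
    ConvFamily A (C + C') (fun ε x => u ε x + v ε x) (fun x => w x + w' x) := by
  have hd : ∀ ε, 0 < ε → ε ≤ 1 → ∀ x,
      deriv (fun x => u ε x + v ε x) x = deriv (u ε) x + deriv (v ε) x := fun ε h0 h1 x =>
    deriv_fun_add ((h.contDiff ε h0 h1).differentiable one_ne_zero x)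
      ((h'.contDiff ε h0 h1).differentiable one_ne_zero x)
  refine ⟨fun ε h0 h1 => (h.contDiff ε h0 h1).add (h'.contDiff ε h0 h1), ?_, ?_, ?_⟩
  · intro ε h0 h1 x hx
    simp [h.eq_zero ε h0 h1 x hx, h'.eq_zero ε h0 h1 x hx]
  · intro ε h0 h1 x
    rw [hd ε h0 h1]
    exact (norm_add_le _ _).trans (add_le_add (h.bound ε h0 h1 x) (h'.bound ε h0 h1 x))
  · intro x
    refine ((h.tendsto x).add (h'.tendsto x)).congr' ?_
    filter_upwards [Ioc_mem_nhdsGT one_pos] with ε hε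
    exact (hd ε hε.1 hε.2 x).symm

theorem conjugate (h : ConvFamily A C u w) :
    ConvFamily A C (fun ε x => conj (u ε x)) (fun x => conj (w x)) := by
  have hd : ∀ ε, 0 < ε → ε ≤ 1 → ∀ x,
      HasDerivAt (fun x => (starRingEnd ℂ) (u ε x)) ((starRingEnd ℂ) (deriv (u ε) x)) x :=
    fun ε h0 h1 x => ((h.contDiff ε h0 h1).differentiable one_ne_zero x).hasDerivAt.star
  refine ⟨fun ε h0 h1 => Complex.conjCLE.contDiff.comp (h.contDiff ε h0 h1), ?_, ?_, ?_⟩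
  · intro ε h0 h1 x hx
    simp [h.eq_zero ε h0 h1 x hx]
  · intro ε h0 h1 x
    rw [(hd ε h0 h1 x).deriv, RCLike.norm_conj]
    exact h.bound ε h0 h1 x
  · intro x
    refine ((Complex.continuous_conj.tendsto _).comp (h.tendsto x)).congr' ?_
    filter_upwards [Ioc_mem_nhdsGT one_pos] with ε hε
    exact (hd ε hε.1 hε.2 x).deriv.symm

/-- Halving the parameter makes two distinct heights available, as `singInt_eq_pairing` requires. -/
theorem half (h : ConvFamily A C u w) : ConvFamily A C (fun ε => u (ε / 2)) w := by
  refine ⟨fun ε h0 h1 => h.contDiff _ (by linarith) (by linarith),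
    fun ε h0 h1 => h.eq_zero _ (by linarith) (by linarith),
    fun ε h0 h1 => h.bound _ (by linarith) (by linarith),
    fun x => (h.tendsto x).comp tendsto_half_nhdsGT⟩

theorem const {g : ℝ → ℂ} (hg : ContDiff ℝ 1 g) (hA : ∀ x, A < |x| → g x = 0)
    (hC : ∀ x, ‖deriv g x‖ ≤ C) : ConvFamily A C (fun _ => g) (deriv g) :=
  ⟨fun _ _ _ => hg, fun _ _ _ => hA, fun _ _ _ => hC, fun _ => tendsto_const_nhds⟩

theorem exists_const {g : ℝ → ℂ} (hg : ContDiff ℝ 1 g)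
    (hA : ∀ x, A < |x| → g x = 0) : ∃ C, ConvFamily A C (fun _ => g) (deriv g) := by
  obtain ⟨C, hC⟩ := (hg.continuous_deriv le_rfl).bounded_above_of_compact_support
    (hasCompactSupport_of_eq_zero hA).deriv
  exact ⟨C, ConvFamily.const hg hA hC⟩

/-- With one derivative on each argument, dominated convergence needs only bounded, pointwise
convergent derivatives; the limits w and w' need not be continuous. -/
theorem tendsto_pairing (h : ConvFamily A C u w) (h' : ConvFamily A C' v w') {δ : ℝ → ℝ}
    (hδ : Tendsto δ (𝓝[>] 0) (𝓝[>] 0)) :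
    Tendsto (fun ε => pairing (δ ε) (u ε) (v ε)) (𝓝[>] 0) (𝓝 (logForm w w')) := by
  have hδ0 : Tendsto δ (𝓝[>] 0) (𝓝 0) := hδ.mono_right nhdsWithin_le_nhds
  have hδ1 : ∀ᶠ ε in 𝓝[>] (0 : ℝ), 0 < δ ε := hδ.eventually self_mem_nhdsWithin
  have hδ2 : ∀ᶠ ε in 𝓝[>] (0 : ℝ), δ ε ≤ 1 :=
    (hδ0.eventually_lt_const one_pos).mono fun _ => le_of_lt
  have hε : ∀ᶠ ε in 𝓝[>] (0 : ℝ), ε ∈ Ioc (0 : ℝ) 1 := Ioc_mem_nhdsGT one_pos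
  have key : Tendsto (fun ε => ∫ y : ℝ, deriv (v ε) y * logPot (deriv (u ε)) y (δ ε)) (𝓝[>] 0)
      (𝓝 (logForm w w')) := by
    -- For |y| ≤ A the function s ↦ u'(y − s) vanishes once |s| > 2A, hence the interval `A + A`.
    refine tendsto_integral_of_bounded (A := A) (C := C' * (C * logMass (A + A) 1)) ?_ ?_ ?_ ?_
    · filter_upwards [hε, hδ1] with ε hε hδ
      have hu := h.contDiff ε hε.1 hε.2
      have hcu := h.hasCompactSupport hε.1 hε.2
      simp_rw [← cau_eq_logPot hu hcu hδ]
      exact (((h'.contDiff ε hε.1 hε.2).continuous_deriv le_rfl).mul (continuous_cau_horizontal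
        (hu.continuous.integrable_of_hasCompactSupport hcu) hδ.ne')).aestronglyMeasurable
    · filter_upwards [hε] with ε hε y hy
      rw [h'.deriv_eq_zero hε.1 hε.2 hy, zero_mul]
    · filter_upwards [hε, hδ1, hδ2] with ε hε hδ1 hδ2 y hy
      rw [norm_mul]
      have h1 := h'.bound ε hε.1 hε.2 y
      have h2 : ‖logPot (deriv (u ε)) y (δ ε)‖ ≤ C * logMass (A + A) 1 := by
        refine norm_integral_mul_log_le (w := fun s => deriv (u ε) (y - s)) hδ1.le hδ2 ?_ ?_
        · intro s hs
          refine h.deriv_eq_zero hε.1 hε.2 ?_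
          have := abs_sub_abs_le_abs_sub s y
          rw [abs_sub_comm y s]
          linarith
        · exact fun s => h.bound ε hε.1 hε.2 _
      exact mul_le_mul h1 h2 (norm_nonneg _) ((norm_nonneg _).trans h1)
    · intro y
      refine (h'.tendsto y).mul ?_
      refine tendsto_integral_mul_log (w := fun ε s => deriv (u ε) (y - s)) (A := A + |y|) (C := C)
        ?_ ?_ ?_ (fun s => h.tendsto _) hδ0 (hδ1.mono fun _ => le_of_lt)
      · filter_upwards [hε] with ε hε
        exact (((h.contDiff ε hε.1 hε.2).continuous_deriv le_rfl).comp
          (by fun_prop)).aestronglyMeasurable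
      · filter_upwards [hε] with ε hε s hs
        refine h.deriv_eq_zero hε.1 hε.2 ?_
        have := abs_sub_abs_le_abs_sub s y
        rw [abs_sub_comm y s]
        linarith
      · filter_upwards [hε] with ε hε s
        exact h.bound ε hε.1 hε.2 _
  refine key.congr' ?_
  filter_upwards [hε, hδ1] with ε hε hδ
  have hu := h.contDiff ε hε.1 hε.2
  have hcu := h.hasCompactSupport hε.1 hε.2
  rw [pairing_eq_integral_deriv_mul_cau hδ.ne' hu (h'.contDiff ε hε.1 hε.2) hcu
    (h'.hasCompactSupport hε.1 hε.2)]
  simp_rw [cau_eq_logPot hu hcu hδ]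

/-- Additivity is inherited from `pairing` by uniqueness of limits, which avoids all integrability
questions for the limit derivatives. The conjugation rule `logForm_conj` is obtained in the same
way. -/
theorem logForm_add_left {C'' : ℝ} {v' : ℝ → ℝ → ℂ} {w'' : ℝ → ℂ} (h : ConvFamily A C u w)
    (h' : ConvFamily A C' v w') (h'' : ConvFamily A C'' v' w'') :
    logForm (fun x => w x + w' x) w'' = logForm w w'' + logForm w' w'' := by
  refine tendsto_nhds_unique ((h.add h').tendsto_pairing h'' tendsto_id) ?_
  refine ((h.tendsto_pairing h'' tendsto_id).add (h'.tendsto_pairing h'' tendsto_id)).congr' ?_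
  filter_upwards [Ioc_mem_nhdsGT one_pos] with ε hε
  have h0 := hε.1
  have h1 := hε.2
  exact (pairing_add_left h0.ne' (h.contDiff ε h0 h1).continuous (h'.contDiff ε h0 h1).continuous
    (h''.contDiff ε h0 h1).continuous (h.hasCompactSupport h0 h1) (h'.hasCompactSupport h0 h1)
    (h''.hasCompactSupport h0 h1)).symm

theorem logForm_conj (h : ConvFamily A C u w) (h' : ConvFamily A C' v w') :
    logForm (fun x => (starRingEnd ℂ) (w' x)) (fun x => (starRingEnd ℂ) (w x)) =
      (starRingEnd ℂ) (logForm w w') := by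
  refine tendsto_nhds_unique (h'.conjugate.tendsto_pairing h.conjugate tendsto_id) ?_
  refine ((Complex.continuous_conj.tendsto _).comp (h.tendsto_pairing h' tendsto_id)).congr' ?_
  filter_upwards [Ioc_mem_nhdsGT one_pos] with ε hε
  have h0 := hε.1
  have h1 := hε.2
  exact (pairing_conj h0.ne' (h.contDiff ε h0 h1).continuous (h'.contDiff ε h0 h1).continuous
    (h.hasCompactSupport h0 h1) (h'.hasCompactSupport h0 h1)).symm

end ConvFamily

/-! ### Boundary values of the Cauchy transform of a smooth density -/

/-- A nonnegative, twice continuously differentiable, compactly supported function of total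
mass `1`. -/
structure IsSmoothDensity (f : ℝ → ℝ) : Prop where
  contDiff : ContDiff ℝ 2 f
  hasCompactSupport : HasCompactSupport f
  nonneg : ∀ x, 0 ≤ f x
  integral_eq_one : ∫ x, f x = 1

/-- The Cauchy transform of `f` on the horizontal line at height `ε`. -/
def horiz (f : ℝ → ℝ) (ε x : ℝ) : ℂ :=
  cau (fun t => (f t : ℂ)) (x + ε * Complex.I)

/-- The boundary values of the Cauchy transform of `f` from the upper half-plane. -/
def bdry (f : ℝ → ℝ) (x : ℝ) : ℂ :=
  logPot (fun t => ((deriv f t : ℝ) : ℂ)) x 0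

section C1

variable {f : ℝ → ℝ} (hf : ContDiff ℝ 1 f) (hc : HasCompactSupport f)

include hf hc

theorem horiz_eq_logPot {ε : ℝ} (hε : 0 < ε) (x : ℝ) :
    horiz f ε x = logPot (fun t => ((deriv f t : ℝ) : ℂ)) x ε := by
  rw [horiz, cau_eq_logPot (contDiff_ofReal_comp hf) (hasCompactSupport_ofReal hc) hε,
    deriv_ofReal_comp (hf.differentiable one_ne_zero)]

theorem continuousOn_logPot_deriv :
    ContinuousOn (fun p : ℝ × ℝ => logPot (fun t => ((deriv f t : ℝ) : ℂ)) p.1 p.2)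
      (univ ×ˢ Ici 0) := by
  refine continuousOn_logPot ?_ (hasCompactSupport_ofReal hc.deriv)
  have := hf.continuous_deriv le_rfl
  fun_prop

theorem tendsto_horiz (x : ℝ) : Tendsto (fun ε => horiz f ε x) (𝓝[>] 0) (𝓝 (bdry f x)) := by
  have h := (continuousOn_logPot_deriv hf hc) (x, 0) ⟨mem_univ _, self_mem_Ici⟩
  have h2 : Tendsto (fun ε : ℝ => (x, ε)) (𝓝[>] 0) (𝓝[univ ×ˢ Ici 0] (x, 0)) := by
    refine tendsto_nhdsWithin_iff.2 ⟨?_, ?_⟩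
    · exact ((Continuous.prodMk_right x).tendsto 0).mono_left nhdsWithin_le_nhds
    · filter_upwards [self_mem_nhdsWithin] with ε hε
      exact ⟨mem_univ _, (le_of_lt hε : (0 : ℝ) ≤ ε)⟩
  refine (h.tendsto.comp h2).congr' ?_
  filter_upwards [self_mem_nhdsWithin] with ε hε
  exact (horiz_eq_logPot hf hc hε x).symm

theorem continuous_bdry : Continuous (bdry f) := by
  have h := (continuousOn_logPot_deriv hf hc)
  exact h.comp_continuous (f := fun x : ℝ => (x, (0 : ℝ))) (by fun_prop)
    fun x => ⟨mem_univ _, self_mem_Ici⟩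

theorem bdry_eq (x : ℝ) : bdry f x = Real.pi * (hilbert f x - Complex.I * f x) := by
  rw [← logPot_deriv_ofReal hf hc, deriv_ofReal_comp (hf.differentiable one_ne_zero), bdry]

theorem bdry_re (x : ℝ) : (bdry f x).re = Real.pi * hilbert f x := by
  simp [bdry_eq hf hc]

theorem bdry_im (x : ℝ) : (bdry f x).im = -(Real.pi * f x) := by
  simp [bdry_eq hf hc]

theorem exists_bound_horiz (A : ℝ) :
    ∃ B, 0 ≤ B ∧ ∀ ε, 0 < ε → ε ≤ 1 → ∀ x, |x| ≤ A → ‖horiz f ε x‖ ≤ B := by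
  have hK : IsCompact (Icc (-A) A ×ˢ Icc (0 : ℝ) 1) := isCompact_Icc.prod isCompact_Icc
  obtain ⟨B, hB⟩ := hK.exists_bound_of_continuousOn ((continuousOn_logPot_deriv hf hc).mono
    (fun p hp => ⟨mem_univ _, hp.2.1⟩))
  refine ⟨max B 0, le_max_right _ _, fun ε h0 h1 x hx => ?_⟩
  rw [horiz_eq_logPot hf hc h0]
  exact (hB (x, ε) ⟨abs_le.1 hx, h0.le, h1⟩).trans (le_max_left _ _)

theorem integrable_ofReal : Integrable fun x => (f x : ℂ) :=
  (contDiff_ofReal_comp hf).continuous.integrable_of_hasCompactSupport (hasCompactSupport_ofReal hc)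

theorem hasDerivAt_horiz {ε : ℝ} (hε : ε ≠ 0) (x : ℝ) :
    HasDerivAt (horiz f ε) (horiz (deriv f) ε x) x := by
  have := hasDerivAt_cau_horizontal (contDiff_ofReal_comp hf) (hasCompactSupport_ofReal hc) hε x
  rw [deriv_ofReal_comp (hf.differentiable one_ne_zero)] at this
  exact this

theorem continuous_horiz {ε : ℝ} (hε : ε ≠ 0) : Continuous (horiz f ε) :=
  continuous_iff_continuousAt.2 fun x => (hasDerivAt_horiz hf hc hε x).continuousAt

theorem hasDerivAt_cau_ofReal {z : ℂ} (hz : z.im ≠ 0) :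
    HasDerivAt (cau fun t => (f t : ℂ)) (cau (fun t => ((deriv f t : ℝ) : ℂ)) z) z := by
  have := hasDerivAt_cau_of_contDiff (contDiff_ofReal_comp hf) (hasCompactSupport_ofReal hc) hz
  rwa [deriv_ofReal_comp (hf.differentiable one_ne_zero)] at this

end C1

theorem contDiff_deriv {f : ℝ → ℝ} (hf : ContDiff ℝ 2 f) : ContDiff ℝ 1 (deriv f) :=
  ((contDiff_succ_iff_deriv (n := 1)).1 hf).2.2

theorem hasDerivAt_bdry {f : ℝ → ℝ} (hf : ContDiff ℝ 2 f) (hc : HasCompactSupport f) (x : ℝ) :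
    HasDerivAt (bdry f) (bdry (deriv f) x) x := by
  have h1 := contDiff_deriv hf
  have := hasDerivAt_logPot_zero (contDiff_ofReal_comp h1) (hasCompactSupport_ofReal hc.deriv) x
  rw [deriv_ofReal_comp (h1.differentiable one_ne_zero)] at this
  exact this

theorem hasDerivAt_hilbert {f : ℝ → ℝ} (hf : ContDiff ℝ 2 f) (hc : HasCompactSupport f) (x : ℝ) :
    HasDerivAt (hilbert f) (hilbert (deriv f) x) x := by
  have hf1 : ContDiff ℝ 1 f := hf.of_le one_le_two
  have h := Complex.reCLM.hasFDerivAt.comp_hasDerivAt x (hasDerivAt_bdry hf hc x)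
  have e : hilbert f = fun x => Real.pi⁻¹ * (bdry f x).re := by
    ext y
    rw [bdry_re hf1 hc, inv_mul_cancel_left₀ Real.pi_ne_zero]
  rw [e]
  refine (h.const_mul Real.pi⁻¹).congr_deriv ?_
  simp only [Complex.reCLM_apply]
  rw [bdry_re (contDiff_deriv hf) hc.deriv, inv_mul_cancel_left₀ Real.pi_ne_zero]

theorem continuous_hilbert {f : ℝ → ℝ} (hf : ContDiff ℝ 1 f) (hc : HasCompactSupport f) :
    Continuous (hilbert f) := by
  have e : hilbert f = fun x => Real.pi⁻¹ * (bdry f x).re := by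
    ext y
    rw [bdry_re hf hc, inv_mul_cancel_left₀ Real.pi_ne_zero]
  rw [e]
  exact continuous_const.mul (Complex.continuous_re.comp (continuous_bdry hf hc))

/-- A Taylor estimate at a boundary zero of the Cauchy transform. -/
theorem norm_horiz_sub_le {f : ℝ → ℝ} (hf : ContDiff ℝ 2 f) (hc : HasCompactSupport f) {x₀ : ℝ}
    (h0 : bdry f x₀ = 0) {η : ℝ} (hη : 0 < η) :
    ∃ r > 0, ∀ x ε : ℝ, |x - x₀| < r → 0 < ε → ε < r →
      ‖horiz f ε x - bdry (deriv f) x₀ * ((x - x₀ : ℝ) + ε * Complex.I)‖ ≤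
        η * ‖((x - x₀ : ℝ) : ℂ) + ε * Complex.I‖ := by
  have hf1 : ContDiff ℝ 1 f := hf.of_le one_le_two
  have hf' := contDiff_deriv hf
  set c := bdry (deriv f) x₀ with hcdef
  set G := cau (fun t => (f t : ℂ)) with hG
  have hcont := (continuousOn_logPot_deriv hf' hc.deriv) (x₀, 0) ⟨mem_univ _, self_mem_Ici⟩
  rw [Metric.continuousWithinAt_iff] at hcont
  obtain ⟨r, hr, hr'⟩ := hcont η hη
  refine ⟨r, hr, ?_⟩
  -- On this convex box above x₀ the derivative of G(z) − c z has norm at most η, because G' is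
  -- continuous up to the axis with value c at x₀. The mean value inequality then applies between
  -- any two points of the box.
  set V : Set ℂ := Complex.re ⁻¹' (Metric.ball x₀ r) ∩ Complex.im ⁻¹' (Ioo 0 r) with hV
  have hconv : Convex ℝ V :=
    ((convex_ball x₀ r).linear_preimage Complex.reLm).inter
      ((convex_Ioo 0 r).linear_preimage Complex.imLm)
  have hder : ∀ z ∈ V, HasDerivWithinAt (fun z => G z - c * z)
      (cau (fun t => ((deriv f t : ℝ) : ℂ)) z - c) V z := by
    intro z hz
    have h1 := hasDerivAt_cau_ofReal hf1 hc (z := z) (ne_of_gt hz.2.1)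
    have h2 := h1.sub ((hasDerivAt_id z).const_mul c)
    rw [mul_one] at h2
    exact h2.hasDerivWithinAt
  have hbd : ∀ z ∈ V, ‖cau (fun t => ((deriv f t : ℝ) : ℂ)) z - c‖ ≤ η := by
    intro z hz
    have e1 := horiz_eq_logPot hf' hc.deriv hz.2.1 z.re
    rw [horiz, Complex.re_add_im] at e1
    have := hr' (x := (z.re, z.im)) ⟨mem_univ _, (le_of_lt hz.2.1 : (0 : ℝ) ≤ z.im)⟩ (by
      rw [Prod.dist_eq, max_lt_iff]
      refine ⟨hz.1, ?_⟩
      have h0 : (0 : ℝ) < z.im := hz.2.1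
      have h1 : z.im < r := hz.2.2
      simpa [Real.dist_eq, abs_of_pos h0] using h1)
    rw [dist_eq_norm] at this
    rw [e1]
    exact this.le
  intro x ε hx hε hεr
  have hz : ((x : ℂ) + ε * Complex.I) ∈ V := by
    refine ⟨?_, ?_⟩
    · simpa [Real.dist_eq] using hx
    · simpa using ⟨hε, hεr⟩
  -- The base point x₀ + is is lowered to the axis, where the value of G tends to 0.
  have hlim : Tendsto (fun s : ℝ => ((x : ℂ) + ε * Complex.I) - (x₀ + s * Complex.I)) (𝓝[>] 0)
      (𝓝 (((x - x₀ : ℝ) : ℂ) + ε * Complex.I)) := by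
    have : Continuous fun s : ℝ => ((x : ℂ) + ε * Complex.I) - (x₀ + s * Complex.I) := by fun_prop
    have h := (this.tendsto 0).mono_left (nhdsWithin_le_nhds (s := Ioi 0))
    convert h using 2
    push_cast
    ring
  have hlimG : Tendsto (fun s : ℝ => horiz f s x₀) (𝓝[>] 0) (𝓝 0) := by
    rw [← h0]
    exact tendsto_horiz hf1 hc x₀
  have hlim2 : Tendsto (fun s : ℝ => ‖horiz f ε x - horiz f s x₀ -
      c * (((x : ℂ) + ε * Complex.I) - (x₀ + s * Complex.I))‖) (𝓝[>] 0)
      (𝓝 ‖horiz f ε x - 0 - c * (((x - x₀ : ℝ) : ℂ) + ε * Complex.I)‖) :=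
    ((tendsto_const_nhds.sub hlimG).sub (hlim.const_mul c)).norm
  rw [sub_zero] at hlim2
  refine le_of_tendsto_of_tendsto hlim2 (hlim.norm.const_mul η) ?_
  filter_upwards [Ioo_mem_nhdsGT hr] with s hs
  have hz' : ((x₀ : ℂ) + s * Complex.I) ∈ V := by
    refine ⟨?_, ?_⟩
    · simpa using hr
    · simpa using hs
  have := hconv.norm_image_sub_le_of_norm_hasDerivWithin_le hder hbd hz' hz
  refine le_of_eq_of_le (congrArg _ ?_) this
  simp only [horiz, hG]
  ring

namespace IsSmoothDensity

variable {f : ℝ → ℝ} (hf : IsSmoothDensity f)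

include hf

theorem contDiff_one : ContDiff ℝ 1 f :=
  hf.contDiff.of_le one_le_two

theorem integrable : Integrable f :=
  hf.contDiff.continuous.integrable_of_hasCompactSupport hf.hasCompactSupport

theorem deriv_eq_zero {x : ℝ} (hx : f x = 0) : deriv f x = 0 := by
  refine IsLocalMin.deriv_eq_zero (Eventually.of_forall fun y => ?_)
  rw [hx]
  exact hf.nonneg y

theorem exists_support_bound :
    ∃ A, 0 < A ∧ ∀ x, A < |x| → f x = 0 := by
  obtain ⟨A, hA, h⟩ := continuous_eq_zero_of_hasCompactSupport
    (hasCompactSupport_ofReal hf.hasCompactSupport)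
  exact ⟨A, hA, fun x hx => by exact_mod_cast h x hx⟩

theorem im_horiz_eq {ε : ℝ} (hε : ε ≠ 0) (x : ℝ) :
    (horiz f ε x).im = -(ε * ∫ t, f t / ((x - t) ^ 2 + ε ^ 2)) := by
  have hint := integrable_div_sub_pow (integrable_ofReal hf.contDiff_one hf.hasCompactSupport)
    (z := x + ε * Complex.I) (by simpa using hε) 1
  simp only [pow_one] at hint
  have h : (horiz f ε x).im = ∫ t : ℝ, ((f t : ℂ) / (x + ε * Complex.I - t)).im :=
    (integral_im hint).symm
  rw [h, ← integral_const_mul, ← integral_neg]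
  congr 1 with t
  rw [Complex.div_im]
  simp [Complex.normSq_apply]
  ring

/-- −Im G is ε times the integral of f(t)/((x − t)² + ε²). For t in the support, |t| ≤ B, and the
denominator is at most (A + B)² + 1, while f has mass one. -/
theorem exists_im_horiz_le (A : ℝ) :
    ∃ c > 0, ∀ ε, 0 < ε → ε ≤ 1 → ∀ x, |x| ≤ A → c * ε ≤ ‖horiz f ε x‖ := by
  obtain ⟨B, hB, hsupp⟩ := hf.exists_support_bound
  refine ⟨1 / ((A + B) ^ 2 + 1), by positivity, fun ε h0 h1 x hx => ?_⟩
  refine le_trans ?_ (Complex.abs_im_le_norm _)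
  rw [hf.im_horiz_eq h0.ne', abs_neg, abs_mul, abs_of_pos h0, mul_comm]
  gcongr
  refine le_trans ?_ (le_abs_self _)
  have e : 1 / ((A + B) ^ 2 + 1) = ∫ t, f t / ((A + B) ^ 2 + 1) := by
    rw [integral_div, hf.integral_eq_one]
  rw [e]
  refine integral_mono (hf.integrable.div_const _) ?_ fun t => ?_
  · have : ∀ t, (x - t) ^ 2 + ε ^ 2 ≠ 0 := fun t => by positivity
    have hcont : Continuous fun t => f t / ((x - t) ^ 2 + ε ^ 2) := by
      have := hf.contDiff.continuous
      fun_prop (disch := assumption)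
    refine hcont.integrable_of_hasCompactSupport ?_
    simp only [div_eq_mul_inv]
    exact hf.hasCompactSupport.mul_right
  · rcases le_or_gt |t| B with ht | ht
    · have hx' := abs_le.1 hx
      have ht' := abs_le.1 ht
      have h3 : (x - t) ^ 2 ≤ (A + B) ^ 2 := by
        apply sq_le_sq'
        · linarith
        · linarith
      have h4 : ε ^ 2 ≤ 1 := by nlinarith
      have := hf.nonneg t
      have : 0 < (x - t) ^ 2 + ε ^ 2 := by positivity
      show f t / _ ≤ f t / _
      gcongr
    · simp [hsupp t ht]

theorem horiz_ne_zero {ε : ℝ} (hε : 0 < ε) (h1 : ε ≤ 1) (x : ℝ) : horiz f ε x ≠ 0 := by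
  obtain ⟨c, hc, h⟩ := hf.exists_im_horiz_le |x|
  have := h ε hε h1 x le_rfl
  rw [← norm_pos_iff]
  exact (mul_pos hc hε).trans_le this

/-- Zeros of the boundary value are simple: if the derivative vanished too, G would be o(ε) at
height ε above x₀, against the linear lower bound of `exists_im_horiz_le`. -/
theorem bdry_deriv_ne_zero {x₀ : ℝ} (h0 : bdry f x₀ = 0) : bdry (deriv f) x₀ ≠ 0 := by
  intro hd
  obtain ⟨c, hc, h⟩ := hf.exists_im_horiz_le |x₀|
  obtain ⟨r, hr, hr'⟩ := norm_horiz_sub_le hf.contDiff hf.hasCompactSupport h0 (half_pos hc)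
  set ε := min (r / 2) 1
  have hε : 0 < ε := by positivity
  have h1 := h ε hε (min_le_right _ _) x₀ le_rfl
  have h2 := hr' x₀ ε (by simpa using hr) hε ((min_le_left _ _).trans_lt (half_lt_self hr))
  rw [hd] at h2
  simp [abs_of_pos hε] at h2
  have := mul_pos hc hε
  linarith

/-- A zero of a nonnegative function is a minimum, so f' vanishes there as well, and a bound on f''
gives both estimates by the mean value inequality. -/
theorem exists_quadratic_bound {x₀ : ℝ} (h0 : f x₀ = 0) :
    ∃ M, 0 ≤ M ∧ ∀ x, |deriv f x| ≤ M * |x - x₀| ∧ f x ≤ M * |x - x₀| ^ 2 := by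
  have hf' := contDiff_deriv hf.contDiff
  obtain ⟨M, hM⟩ := (hf'.continuous_deriv le_rfl).bounded_above_of_compact_support
    hf.hasCompactSupport.deriv.deriv
  have hM0 : 0 ≤ M := (norm_nonneg _).trans (hM 0)
  have h1 : ∀ x, |deriv f x| ≤ M * |x - x₀| := by
    intro x
    have := convex_univ.norm_image_sub_le_of_norm_deriv_le
      (fun y _ => hf'.differentiable one_ne_zero y) (fun y _ => hM y) (mem_univ x₀) (mem_univ x)
    rwa [hf.deriv_eq_zero h0, sub_zero] at this
  refine ⟨M, hM0, fun x => ⟨h1 x, ?_⟩⟩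
  have := (convex_uIcc x₀ x).norm_image_sub_le_of_norm_deriv_le (f := f) (C := M * |x - x₀|)
    (fun y _ => hf.contDiff_one.differentiable one_ne_zero y) (fun y hy => ?_)
    left_mem_uIcc right_mem_uIcc
  · rw [h0, sub_zero, Real.norm_eq_abs, Real.norm_eq_abs] at this
    refine (le_abs_self _).trans (this.trans_eq ?_)
    ring
  · rw [Real.norm_eq_abs]
    refine (h1 y).trans ?_
    gcongr M * ?_
    rw [abs_sub_comm y, abs_sub_comm x]
    rw [abs_sub_comm x₀ y, abs_sub_comm x₀ x]
    exact abs_sub_left_of_mem_uIcc hy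

/-- Near the boundary the density is controlled by the square of the Cauchy transform, and its
derivative by the Cauchy transform: both vanish together only at simple zeros. -/
theorem exists_bound_by_horiz :
    ∃ C, 0 ≤ C ∧ ∀ ε, 0 < ε → ε ≤ 1 → ∀ x,
      f x ≤ C * ‖horiz f ε x‖ ^ 2 ∧ |deriv f x| ≤ C * ‖horiz f ε x‖ := by
  obtain ⟨A, hA, hsupp⟩ := hf.exists_support_bound
  obtain ⟨F₀, hF₀⟩ := hf.contDiff.continuous.bounded_above_of_compact_support hf.hasCompactSupport
  obtain ⟨F₁, hF₁⟩ := (contDiff_deriv hf.contDiff).continuous.bounded_above_of_compact_support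
    hf.hasCompactSupport.deriv
  have hF₀' : 0 ≤ F₀ := (norm_nonneg _).trans (hF₀ 0)
  have hF₁' : 0 ≤ F₁ := (norm_nonneg _).trans (hF₁ 0)
  have hK : IsCompact (Icc (-A) A ×ˢ Icc (0 : ℝ) 1) := isCompact_Icc.prod isCompact_Icc
  have key : ∃ C, 0 ≤ C ∧ ∀ p ∈ Icc (-A) A ×ˢ Icc (0 : ℝ) 1, 0 < p.2 →
      f p.1 ≤ C * ‖horiz f p.2 p.1‖ ^ 2 ∧ |deriv f p.1| ≤ C * ‖horiz f p.2 p.1‖ := by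
    -- Compactness of the closed box, bottom edge included, reduces the uniform estimate to a
    -- neighbourhood of each of its points.
    refine hK.induction_on (p := fun s => ∃ C, 0 ≤ C ∧ ∀ p ∈ s, 0 < p.2 →
      f p.1 ≤ C * ‖horiz f p.2 p.1‖ ^ 2 ∧ |deriv f p.1| ≤ C * ‖horiz f p.2 p.1‖) ?_ ?_ ?_ ?_
    · exact ⟨0, le_rfl, fun p hp => absurd hp (notMem_empty p)⟩
    · rintro s t hst ⟨C, hC, h⟩
      exact ⟨C, hC, fun p hp => h p (hst hp)⟩
    · rintro s t ⟨C, hC, h⟩ ⟨C', hC', h'⟩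
      refine ⟨max C C', hC.trans (le_max_left _ _), fun p hp h0 => ?_⟩
      rcases hp with hp | hp
      · obtain ⟨e1, e2⟩ := h p hp h0
        refine ⟨e1.trans ?_, e2.trans ?_⟩ <;> gcongr <;> exact le_max_left _ _
      · obtain ⟨e1, e2⟩ := h' p hp h0
        refine ⟨e1.trans ?_, e2.trans ?_⟩ <;> gcongr <;> exact le_max_right _ _
    · rintro ⟨x₀, ε₀⟩ ⟨hx₀, hε₀⟩
      simp only at hx₀ hε₀
      -- G has no zero at positive height, so a zero lies on the bottom edge. Since it is simple,
      -- |G| dominates |x − x₀| nearby, while f and f' are of second and first order. Away from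
      -- zeros |G| is locally bounded below.
      by_cases hz : logPot (fun t => ((deriv f t : ℝ) : ℂ)) x₀ ε₀ = 0
      · have hε₀' : ε₀ = 0 := by
          by_contra h
          have hpos : 0 < ε₀ := lt_of_le_of_ne hε₀.1 (Ne.symm h)
          rw [← horiz_eq_logPot hf.contDiff_one hf.hasCompactSupport hpos] at hz
          exact hf.horiz_ne_zero hpos hε₀.2 x₀ hz
        subst hε₀'
        have hz' : bdry f x₀ = 0 := hz
        have hd := hf.bdry_deriv_ne_zero hz'
        have hf0 : f x₀ = 0 := by
          have := bdry_im hf.contDiff_one hf.hasCompactSupport x₀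
          rw [hz', Complex.zero_im, zero_eq_neg, mul_eq_zero] at this
          exact this.resolve_left Real.pi_ne_zero
        obtain ⟨M, hM, hM'⟩ := hf.exists_quadratic_bound hf0
        -- With half the slope as the error allowance in the Taylor estimate, the other half remains
        -- as a lower bound for |G|.
        set c := ‖bdry (deriv f) x₀‖ / 2 with hcdef
        have hcpos : 0 < c := half_pos (norm_pos_iff.2 hd)
        obtain ⟨r, hr, hr'⟩ := norm_horiz_sub_le hf.contDiff hf.hasCompactSupport hz' hcpos
        refine ⟨Metric.ball x₀ r ×ˢ Iio r, ?_, M / c ^ 2 + M / c, by positivity, ?_⟩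
        · exact nhdsWithin_le_nhds (prod_mem_nhds (Metric.ball_mem_nhds x₀ hr) (Iio_mem_nhds hr))
        · rintro ⟨x, ε⟩ ⟨hx, hε⟩ h0
          simp only at hx hε h0 ⊢
          have h1 := hr' x ε (by simpa [Real.dist_eq] using hx) h0 hε
          have h2 := norm_sub_norm_le (bdry (deriv f) x₀ * ((x - x₀ : ℝ) + ε * Complex.I))
            (horiz f ε x)
          rw [norm_sub_rev, norm_mul] at h2
          have h3 : |x - x₀| ≤ ‖((x - x₀ : ℝ) : ℂ) + ε * Complex.I‖ := by
            simpa using Complex.abs_re_le_norm (((x - x₀ : ℝ) : ℂ) + ε * Complex.I)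
          have h4 : c * |x - x₀| ≤ ‖horiz f ε x‖ := by
            have e : ‖bdry (deriv f) x₀‖ = 2 * c := by rw [hcdef]; ring
            rw [e] at h2
            have := mul_le_mul_of_nonneg_left h3 hcpos.le
            linarith
          have h5 : |x - x₀| ≤ ‖horiz f ε x‖ / c := by
            rw [le_div_iff₀ hcpos]
            linarith
          have hn := norm_nonneg (horiz f ε x)
          obtain ⟨e1, e2⟩ := hM' x
          constructor
          · calc f x ≤ M * |x - x₀| ^ 2 := e2
              _ ≤ M * (‖horiz f ε x‖ / c) ^ 2 := by gcongr
              _ = M / c ^ 2 * ‖horiz f ε x‖ ^ 2 := by field_simp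
              _ ≤ _ := by
                gcongr
                have : 0 ≤ M / c := by positivity
                linarith
          · calc |deriv f x| ≤ M * |x - x₀| := e1
              _ ≤ M * (‖horiz f ε x‖ / c) := by gcongr
              _ = M / c * ‖horiz f ε x‖ := by field_simp
              _ ≤ _ := by
                gcongr
                have : 0 ≤ M / c ^ 2 := by positivity
                linarith
      · have hcont := (continuousOn_logPot_deriv hf.contDiff_one hf.hasCompactSupport)
          (x₀, ε₀) ⟨mem_univ _, hε₀.1⟩
        set c := ‖logPot (fun t => ((deriv f t : ℝ) : ℂ)) x₀ ε₀‖ / 2 with hcdef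
        have hpos := norm_pos_iff.2 hz
        have hcpos : 0 < c := half_pos hpos
        have hev := hcont.norm.eventually (lt_mem_nhds (half_lt_self hpos))
        have hsub : Icc (-A) A ×ˢ Icc (0 : ℝ) 1 ⊆ univ ×ˢ Ici 0 := fun p hp =>
          ⟨mem_univ _, hp.2.1⟩
        refine ⟨_, nhdsWithin_mono _ hsub hev, F₀ / c ^ 2 + F₁ / c, by positivity, ?_⟩
        rintro ⟨x, ε⟩ hx h0
        simp only [mem_ofPred_eq] at hx h0 ⊢
        rw [← horiz_eq_logPot hf.contDiff_one hf.hasCompactSupport h0] at hx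
        have hx' : c ≤ ‖horiz f ε x‖ := hx.le
        constructor
        · calc f x ≤ F₀ := (le_abs_self _).trans (hF₀ x)
            _ = F₀ / c ^ 2 * c ^ 2 := by field_simp
            _ ≤ (F₀ / c ^ 2 + F₁ / c) * ‖horiz f ε x‖ ^ 2 := by
              gcongr
              have : 0 ≤ F₁ / c := by positivity
              linarith
        · calc |deriv f x| ≤ F₁ := hF₁ x
            _ = F₁ / c * c := by field_simp
            _ ≤ _ := by
              gcongr
              have : 0 ≤ F₀ / c ^ 2 := by positivity
              linarith
  obtain ⟨C, hC, h⟩ := key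
  refine ⟨C, hC, fun ε h0 h1 x => ?_⟩
  rcases le_or_gt |x| A with hx | hx
  · exact h (x, ε) ⟨abs_le.1 hx, h0.le, h1⟩ h0
  · have hx0 := hsupp x hx
    rw [hx0, hf.deriv_eq_zero hx0, abs_zero]
    constructor <;> positivity

end IsSmoothDensity

/-! ### The families f G and f / G, and the Cauchy transform of f (G₊ + G₋) -/

theorem ae_fst_ne_snd : ∀ᵐ p : ℝ × ℝ, p.1 ≠ p.2 := by
  rw [ae_iff, Measure.volume_eq_prod]
  have : MeasurableSet {p : ℝ × ℝ | ¬p.1 ≠ p.2} := by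
    simp only [ne_eq, not_not]
    exact measurableSet_eq_fun measurable_fst measurable_snd
  rw [Measure.measure_prod_null this]
  refine Eventually.of_forall fun x => ?_
  have : Prod.mk x ⁻¹' {p : ℝ × ℝ | ¬p.1 ≠ p.2} = {x} := by
    ext y
    simp [eq_comm]
  show volume (Prod.mk x ⁻¹' {p : ℝ × ℝ | ¬p.1 ≠ p.2}) = 0
  rw [this]
  simp

/-- Dominated convergence for uniformly bounded functions supported in a fixed square. -/
theorem tendsto_integral_prod_of_bounded {ι : Type*} {l : Filter ι} [l.IsCountablyGenerated]
    {F : ι → ℝ × ℝ → ℂ} {F₀ : ℝ × ℝ → ℂ} {A C : ℝ}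
    (hmeas : ∀ᶠ i in l, AEStronglyMeasurable (F i))
    (hsupp : ∀ᶠ i in l, ∀ p : ℝ × ℝ, A < |p.1| ∨ A < |p.2| → F i p = 0)
    (hbd : ∀ᶠ i in l, ∀ p : ℝ × ℝ, |p.1| ≤ A → |p.2| ≤ A → ‖F i p‖ ≤ C)
    (hlim : ∀ p : ℝ × ℝ, p.1 ≠ p.2 → Tendsto (fun i => F i p) l (𝓝 (F₀ p))) :
    Tendsto (fun i => ∫ p, F i p) l (𝓝 (∫ p, F₀ p)) := by
  refine tendsto_integral_filter_of_dominated_convergence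
    ((Icc (-A) A ×ˢ Icc (-A) A).indicator fun _ => C) hmeas ?_ ?_ (ae_fst_ne_snd.mono hlim)
  · filter_upwards [hsupp, hbd] with i h1 h2
    refine Eventually.of_forall fun p => ?_
    by_cases h : p ∈ Icc (-A) A ×ˢ Icc (-A) A
    · rw [indicator_of_mem h]
      exact h2 p (abs_le.2 h.1) (abs_le.2 h.2)
    · rw [indicator_of_notMem h, h1 p, norm_zero]
      by_contra h'
      rw [not_or, not_lt, not_lt] at h'
      exact h ⟨abs_le.1 h'.1, abs_le.1 h'.2⟩
  · refine (integrable_indicator_iff (measurableSet_Icc.prod measurableSet_Icc)).2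
      (integrableOn_const ?_)
    rw [Measure.volume_eq_prod, Measure.prod_prod]
    exact (ENNReal.mul_lt_top (by simp) (by simp)).ne

theorem horiz_neg (f : ℝ → ℝ) (ε x : ℝ) : horiz f (-ε) x = conj (horiz f ε x) := by
  rw [horiz, horiz, ← cau_ofReal_conj]
  congr 1
  simp

theorem contDiff_horiz {f : ℝ → ℝ} (hf : ContDiff ℝ 2 f) (hc : HasCompactSupport f) {ε : ℝ}
    (hε : ε ≠ 0) : ContDiff ℝ 1 (horiz f ε) := by
  have h := hasDerivAt_horiz (hf.of_le one_le_two) hc hε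
  rw [contDiff_one_iff_deriv]
  refine ⟨fun x => (h x).differentiableAt, ?_⟩
  rw [funext fun x => (h x).deriv]
  exact continuous_horiz (contDiff_deriv hf) hc.deriv hε

theorem contDiff_bdry {f : ℝ → ℝ} (hf : ContDiff ℝ 2 f) (hc : HasCompactSupport f) :
    ContDiff ℝ 1 (bdry f) := by
  have h := hasDerivAt_bdry hf hc
  rw [contDiff_one_iff_deriv]
  refine ⟨fun x => (h x).differentiableAt, ?_⟩
  rw [funext fun x => (h x).deriv]
  exact continuous_bdry (contDiff_deriv hf) hc.deriv

/-- The derivative of the product of the density and its Cauchy transform on the boundary. -/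
def mulDeriv (f : ℝ → ℝ) (x : ℝ) : ℂ :=
  deriv f x * bdry f x + f x * bdry (deriv f) x

/-- The derivative of the quotient of the density by its Cauchy transform on the boundary. -/
def divDeriv (f : ℝ → ℝ) (x : ℝ) : ℂ :=
  deriv f x / bdry f x - f x * bdry (deriv f) x / bdry f x ^ 2

/-- The function `f(x) (G(x + i0) + G(x - i0))`. -/
def symMul (f : ℝ → ℝ) (x : ℝ) : ℂ :=
  f x * (bdry f x + conj (bdry f x))

namespace IsSmoothDensity

variable {f : ℝ → ℝ} (hf : IsSmoothDensity f) {A : ℝ}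

include hf

theorem contDiff_deriv_one : ContDiff ℝ 1 (deriv f) :=
  contDiff_deriv hf.contDiff

theorem hasDerivAt_ofReal (x : ℝ) :
    HasDerivAt (fun x => (f x : ℂ)) ((deriv f x : ℝ) : ℂ) x :=
  (hf.contDiff_one.differentiable one_ne_zero x).hasDerivAt.ofReal_comp

theorem continuous_ofReal : Continuous fun x => (f x : ℂ) :=
  (contDiff_ofReal_comp hf.contDiff).continuous

theorem hasCompactSupport_ofReal : HasCompactSupport fun x => (f x : ℂ) :=
  FreeProb.hasCompactSupport_ofReal hf.hasCompactSupport

theorem exists_bounds (A : ℝ) :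
    ∃ B, 0 ≤ B ∧ (∀ x, f x ≤ B) ∧ (∀ x, |deriv f x| ≤ B) ∧
      ∀ ε, 0 < ε → ε ≤ 1 → ∀ x, |x| ≤ A → ‖horiz f ε x‖ ≤ B ∧ ‖horiz (deriv f) ε x‖ ≤ B := by
  obtain ⟨F₀, hF₀⟩ := hf.contDiff.continuous.bounded_above_of_compact_support hf.hasCompactSupport
  obtain ⟨F₁, hF₁⟩ := hf.contDiff_deriv_one.continuous.bounded_above_of_compact_support
    hf.hasCompactSupport.deriv
  obtain ⟨B₀, hB₀, h0⟩ := exists_bound_horiz hf.contDiff_one hf.hasCompactSupport A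
  obtain ⟨B₁, hB₁, h1⟩ := exists_bound_horiz hf.contDiff_deriv_one hf.hasCompactSupport.deriv A
  have hF₀' : 0 ≤ F₀ := (norm_nonneg _).trans (hF₀ 0)
  have hF₁' : 0 ≤ F₁ := (norm_nonneg _).trans (hF₁ 0)
  refine ⟨F₀ + F₁ + B₀ + B₁, by positivity, fun x => ?_, fun x => ?_, fun ε e0 e1 x hx => ⟨?_, ?_⟩⟩
  · have := (le_abs_self _).trans (hF₀ x); linarith
  · have := hF₁ x; rw [Real.norm_eq_abs] at this; linarith
  · have := h0 ε e0 e1 x hx; linarith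
  · have := h1 ε e0 e1 x hx; linarith

theorem hasDerivAt_mul_horiz {ε : ℝ} (hε : ε ≠ 0) (x : ℝ) :
    HasDerivAt (fun x => f x * horiz f ε x)
      (deriv f x * horiz f ε x + f x * horiz (deriv f) ε x) x :=
  (hf.hasDerivAt_ofReal x).mul (hasDerivAt_horiz hf.contDiff_one hf.hasCompactSupport hε x)

theorem hasDerivAt_div_horiz {ε : ℝ} (h0 : 0 < ε) (h1 : ε ≤ 1) (x : ℝ) :
    HasDerivAt (fun x => f x / horiz f ε x)
      (deriv f x / horiz f ε x - f x * horiz (deriv f) ε x / horiz f ε x ^ 2) x := by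
  have hne := hf.horiz_ne_zero h0 h1 x
  refine ((hf.hasDerivAt_ofReal x).fun_div
    (hasDerivAt_horiz hf.contDiff_one hf.hasCompactSupport h0.ne' x) hne).congr_deriv ?_
  field_simp

theorem tendsto_horiz (x : ℝ) : Tendsto (fun ε => horiz f ε x) (𝓝[>] 0) (𝓝 (bdry f x)) :=
  FreeProb.tendsto_horiz hf.contDiff_one hf.hasCompactSupport x

theorem tendsto_horiz_deriv (x : ℝ) :
    Tendsto (fun ε => horiz (deriv f) ε x) (𝓝[>] 0) (𝓝 (bdry (deriv f) x)) :=
  FreeProb.tendsto_horiz hf.contDiff_deriv_one hf.hasCompactSupport.deriv x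

theorem bdry_ne_zero {x : ℝ} (hx : f x ≠ 0) : bdry f x ≠ 0 := by
  intro h
  have := bdry_im hf.contDiff_one hf.hasCompactSupport x
  rw [h, Complex.zero_im, zero_eq_neg, mul_eq_zero] at this
  exact hx (this.resolve_left Real.pi_ne_zero)

theorem exists_convFamily_mul (hA : ∀ x, A < |x| → f x = 0) :
    ∃ C, ConvFamily A C (fun ε x => f x * horiz f ε x) (mulDeriv f) := by
  obtain ⟨B, hB, b0, b1, b2⟩ := hf.exists_bounds A
  refine ⟨B * B + B * B, ?_, ?_, ?_, ?_⟩
  · intro ε h0 h1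
    exact (contDiff_ofReal_comp hf.contDiff_one).mul
      (contDiff_horiz hf.contDiff hf.hasCompactSupport h0.ne')
  · intro ε h0 h1 x hx
    simp [hA x hx]
  · intro ε h0 h1 x
    rw [(hf.hasDerivAt_mul_horiz h0.ne' x).deriv]
    rcases le_or_gt |x| A with hx | hx
    · obtain ⟨e1, e2⟩ := b2 ε h0 h1 x hx
      have e3 : ‖(f x : ℂ)‖ ≤ B := by
        rw [Complex.norm_of_nonneg (hf.nonneg x)]; exact b0 x
      have e4 : ‖((deriv f x : ℝ) : ℂ)‖ ≤ B := by
        rw [Complex.norm_real]; exact b1 x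
      refine (norm_add_le _ _).trans ?_
      rw [norm_mul, norm_mul]
      gcongr
    · simp only [hA x hx, hf.deriv_eq_zero (hA x hx), Complex.ofReal_zero, zero_mul, add_zero,
        norm_zero]
      positivity
  · intro x
    have : Tendsto (fun ε => deriv f x * horiz f ε x + f x * horiz (deriv f) ε x) (𝓝[>] 0)
        (𝓝 (mulDeriv f x)) :=
      ((hf.tendsto_horiz x).const_mul _).add ((hf.tendsto_horiz_deriv x).const_mul _)
    refine this.congr' ?_
    filter_upwards [self_mem_nhdsWithin] with ε hε
    exact (hf.hasDerivAt_mul_horiz (ne_of_gt hε) x).deriv.symm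

/-- The derivative f'/G − f G'/G² is bounded precisely because f' = O(|G|) and f = O(|G|²). Where f
vanishes so does f', and the derivative is 0 at every height and in the limit, even if the boundary
value of G is zero. -/
theorem exists_convFamily_div (hA : ∀ x, A < |x| → f x = 0) :
    ∃ C, ConvFamily A C (fun ε x => f x / horiz f ε x) (divDeriv f) := by
  obtain ⟨B, hB, b0, b1, b2⟩ := hf.exists_bounds A
  obtain ⟨C, hC, hC'⟩ := hf.exists_bound_by_horiz
  refine ⟨C + C * B, ?_, ?_, ?_, ?_⟩
  · intro ε h0 h1
    simp only [div_eq_mul_inv]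
    exact (contDiff_ofReal_comp hf.contDiff_one).mul
      ((contDiff_horiz hf.contDiff hf.hasCompactSupport h0.ne').inv (hf.horiz_ne_zero h0 h1))
  · intro ε h0 h1 x hx
    simp [hA x hx]
  · intro ε h0 h1 x
    rw [(hf.hasDerivAt_div_horiz h0 h1 x).deriv]
    rcases le_or_gt |x| A with hx | hx
    · obtain ⟨e1, e2⟩ := b2 ε h0 h1 x hx
      obtain ⟨c1, c2⟩ := hC' ε h0 h1 x
      have hpos := norm_pos_iff.2 (hf.horiz_ne_zero h0 h1 x)
      refine (norm_sub_le _ _).trans (add_le_add ?_ ?_)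
      · rw [norm_div, Complex.norm_real, Real.norm_eq_abs, div_le_iff₀ hpos]
        exact c2
      · rw [mul_div_right_comm, norm_mul, norm_div, norm_pow, Complex.norm_of_nonneg (hf.nonneg x)]
        gcongr
        rw [div_le_iff₀ (by positivity)]
        exact c1
    · simp only [hA x hx, hf.deriv_eq_zero (hA x hx), Complex.ofReal_zero, zero_mul, zero_div,
        sub_zero, norm_zero]
      positivity
  · intro x
    have : Tendsto (fun ε => deriv f x / horiz f ε x -
        f x * horiz (deriv f) ε x / horiz f ε x ^ 2) (𝓝[>] 0) (𝓝 (divDeriv f x)) := by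
      by_cases hx : f x = 0
      · simp only [divDeriv, hx, hf.deriv_eq_zero hx, Complex.ofReal_zero, zero_mul, zero_div,
          sub_zero]
        exact tendsto_const_nhds
      · have hne := hf.bdry_ne_zero hx
        exact (tendsto_const_nhds.div (hf.tendsto_horiz x) hne).sub
          (((hf.tendsto_horiz_deriv x).const_mul _).div ((hf.tendsto_horiz x).pow 2)
            (pow_ne_zero 2 hne))
    refine this.congr' ?_
    filter_upwards [Ioc_mem_nhdsGT one_pos] with ε hε
    exact (hf.hasDerivAt_div_horiz hε.1 hε.2 x).deriv.symm

theorem hasDerivAt_symMul (x : ℝ) :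
    HasDerivAt (symMul f) (mulDeriv f x + conj (mulDeriv f x)) x := by
  have h := hasDerivAt_bdry hf.contDiff hf.hasCompactSupport x
  have h' : HasDerivAt (fun x => conj (bdry f x)) (conj (bdry (deriv f) x)) x := h.star
  refine ((hf.hasDerivAt_ofReal x).mul (h.add h')).congr_deriv ?_
  simp only [mulDeriv, map_add, map_mul, Complex.conj_ofReal, Pi.add_apply]
  ring

theorem contDiff_symMul : ContDiff ℝ 1 (symMul f) :=
  (contDiff_ofReal_comp hf.contDiff_one).mul
    ((contDiff_bdry hf.contDiff hf.hasCompactSupport).add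
      (Complex.conjCLE.contDiff.comp (contDiff_bdry hf.contDiff hf.hasCompactSupport)))

theorem hasCompactSupport_symMul : HasCompactSupport (symMul f) :=
  hf.hasCompactSupport_ofReal.mul_right

/-- The sum of the two sides has a kernel that is odd in x − t, the property exploited by the
symmetrization in `cau_symMul`. -/
theorem add_conj_horiz_eq {η : ℝ} (hη : η ≠ 0) (x : ℝ) :
    horiz f η x + conj (horiz f η x) =
      ∫ t : ℝ, (f t : ℂ) * ((2 * (x - t) / ((x - t) ^ 2 + η ^ 2) : ℝ) : ℂ) := by
  have hi : ∀ {s : ℝ}, s ≠ 0 → Integrable fun t : ℝ => (f t : ℂ) / (x + s * Complex.I - t) := by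
    intro s hs
    simpa using integrable_div_sub_pow (integrable_ofReal hf.contDiff_one hf.hasCompactSupport)
      (z := x + s * Complex.I) (by simpa using hs) 1
  rw [← horiz_neg, horiz, horiz, cau, cau, ← integral_add (hi hη) (hi (neg_ne_zero.2 hη))]
  congr 1 with t
  have h1 := ofReal_add_mul_I_sub_ne_zero (x := x) hη t
  have e : (x : ℂ) + (-η : ℝ) * Complex.I - t = x - η * Complex.I - t := by
    push_cast
    ring
  have h2 := ofReal_add_mul_I_sub_ne_zero (x := x) (neg_ne_zero.2 hη) t
  rw [e] at h2
  rw [e]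
  have h3 : ((x : ℂ) - t) ^ 2 + η ^ 2 =
      (x + η * Complex.I - t) * (x - η * Complex.I - t) := by
    linear_combination (η : ℂ) ^ 2 * Complex.I_sq
  push_cast
  rw [h3]
  field_simp
  ring

/-- The Cauchy transform of `f (G₊ + G₋)` is the square of the Cauchy transform of `f`. -/
theorem cau_symMul {z : ℂ} (hz : z.im ≠ 0) :
    cau (symMul f) z = cau (fun t => (f t : ℂ)) z ^ 2 := by
  obtain ⟨A, hApos, hA⟩ := hf.exists_support_bound
  obtain ⟨B, hB, b0, b1, b2⟩ := hf.exists_bounds A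
  have hF := hf.continuous_ofReal
  have hne : ∀ x : ℝ, z - x ≠ 0 := sub_ofReal_ne_zero hz
  have hzpos : 0 < |z.im| := abs_pos.2 hz
  set S : ℝ → ℂ := fun η => ∫ x : ℝ, (f x : ℂ) * (horiz f η x + conj (horiz f η x)) / (z - x)
    with hS
  have lim1 : Tendsto S (𝓝[>] 0) (𝓝 (cau (symMul f) z)) := by
    refine tendsto_integral_of_bounded (A := A) (C := B * (B + B) / |z.im|) ?_ ?_ ?_ ?_
    · filter_upwards [self_mem_nhdsWithin] with η hη
      have h := continuous_horiz hf.contDiff_one hf.hasCompactSupport (ne_of_gt hη)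
      have h' := Complex.continuous_conj.comp h
      have : Continuous fun x : ℝ =>
          (f x : ℂ) * (horiz f η x + conj (horiz f η x)) / (z - x) :=
        (hF.mul (h.add h')).div (by fun_prop) hne
      exact this.aestronglyMeasurable
    · exact Eventually.of_forall fun η x hx => by simp [hA x hx]
    · filter_upwards [Ioc_mem_nhdsGT one_pos] with η hη x hx
      have e1 := (b2 η hη.1 hη.2 x hx).1
      rw [norm_div, norm_mul, Complex.norm_of_nonneg (hf.nonneg x)]
      have e2 := abs_im_le_norm_sub z x
      have e3 : ‖horiz f η x + conj (horiz f η x)‖ ≤ B + B := by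
        refine (norm_add_le _ _).trans ?_
        rw [RCLike.norm_conj]
        linarith
      have e4 := b0 x
      gcongr
    · intro x
      have h := hf.tendsto_horiz x
      exact ((h.add ((Complex.continuous_conj.tendsto _).comp h)).const_mul _).div_const _
  set H : ℝ → ℝ × ℝ → ℂ := fun η p => (f p.1 : ℂ) * f p.2 *
    ((2 * (p.1 - p.2) ^ 2 / ((p.1 - p.2) ^ 2 + η ^ 2) : ℝ) : ℂ) / ((z - p.1) * (z - p.2)) with hH
  have hcH : ∀ η ≠ 0, Continuous (H η) := by
    intro η hη
    have e1 : ∀ p : ℝ × ℝ, (p.1 - p.2) ^ 2 + η ^ 2 ≠ 0 := fun p => by positivity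
    have e2 : ∀ p : ℝ × ℝ, (z - p.1) * (z - p.2) ≠ 0 := fun p => mul_ne_zero (hne _) (hne _)
    have e3 : Continuous fun p : ℝ × ℝ => 2 * (p.1 - p.2) ^ 2 / ((p.1 - p.2) ^ 2 + η ^ 2) := by
      fun_prop (disch := exact e1 _)
    refine Continuous.div ?_ (by fun_prop) e2
    exact ((hF.comp continuous_fst).mul (hF.comp continuous_snd)).mul
      (Complex.continuous_ofReal.comp e3)
  -- The factor (x − t)²/((x − t)² + η²) is at most 1 and tends to 1 off the diagonal, which is a
  -- null set.
  have lim2 : Tendsto (fun η => ∫ p, H η p) (𝓝[>] 0)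
      (𝓝 (∫ p : ℝ × ℝ, (f p.1 : ℂ) * f p.2 * (2 : ℝ) / ((z - p.1) * (z - p.2)))) := by
    refine tendsto_integral_prod_of_bounded (A := A) (C := B * B * 2 / (|z.im| * |z.im|)) ?_ ?_ ?_ ?_
    · filter_upwards [self_mem_nhdsWithin] with η hη
      exact (hcH η (ne_of_gt hη)).aestronglyMeasurable
    · refine Eventually.of_forall fun η p hp => ?_
      rcases hp with hp | hp <;> simp [hH, hA _ hp]
    · filter_upwards [self_mem_nhdsWithin] with η hη p _ _
      have hη' : (0 : ℝ) < η := hη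
      simp only [hH]
      rw [norm_div, norm_mul, norm_mul, norm_mul, Complex.norm_of_nonneg (hf.nonneg _),
        Complex.norm_of_nonneg (hf.nonneg _), Complex.norm_of_nonneg (by positivity)]
      have e1 := abs_im_le_norm_sub z p.1
      have e2 := abs_im_le_norm_sub z p.2
      have e3 := b0 p.1
      have e4 := b0 p.2
      have e5 := hf.nonneg p.1
      have e6 := hf.nonneg p.2
      have e7 : 2 * (p.1 - p.2) ^ 2 / ((p.1 - p.2) ^ 2 + η ^ 2) ≤ 2 := by
        rw [div_le_iff₀ (by positivity)]
        nlinarith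
      gcongr
    · intro p hp
      have hp' : p.1 - p.2 ≠ 0 := sub_ne_zero.2 hp
      have hc : ContinuousAt (fun η : ℝ => 2 * (p.1 - p.2) ^ 2 / ((p.1 - p.2) ^ 2 + η ^ 2)) 0 := by
        have : (p.1 - p.2) ^ 2 + (0 : ℝ) ^ 2 ≠ 0 := by positivity
        fun_prop (disch := assumption)
      have h := hc.tendsto.mono_left (nhdsWithin_le_nhds (s := Ioi 0))
      rw [show 2 * (p.1 - p.2) ^ 2 / ((p.1 - p.2) ^ 2 + (0 : ℝ) ^ 2) = 2 by field_simp; simp] at h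
      exact (((Complex.continuous_ofReal.tendsto _).comp h).const_mul _).div_const _
  -- Symmetrization: adding the integrand with x and t exchanged, the odd kernel multiplies 1/(z −
  -- x) − 1/(z − t) = (x − t)/((z − x)(z − t)), and the extra factor x − t removes the singularity.
  have heq : ∀ η > (0 : ℝ), 2 * S η = ∫ p, H η p := by
    intro η hη
    have e1 : ∀ p : ℝ × ℝ, (p.1 - p.2) ^ 2 + η ^ 2 ≠ 0 := fun p => by positivity
    set k : ℝ × ℝ → ℂ := fun p => (f p.1 : ℂ) * f p.2 *
      ((2 * (p.1 - p.2) / ((p.1 - p.2) ^ 2 + η ^ 2) : ℝ) : ℂ) / (z - p.1) with hk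
    have hkc : Continuous k := by
      have e3 : Continuous fun p : ℝ × ℝ => 2 * (p.1 - p.2) / ((p.1 - p.2) ^ 2 + η ^ 2) := by
        fun_prop (disch := exact e1 _)
      refine Continuous.div ?_ (by fun_prop) fun p => hne p.1
      exact ((hF.comp continuous_fst).mul (hF.comp continuous_snd)).mul
        (Complex.continuous_ofReal.comp e3)
    have hki : Integrable k := by
      refine hkc.integrable_of_hasCompactSupport (hasCompactSupport_of_prod (A := A) ?_ ?_)
      · intro p hp; simp [hk, hA _ hp]
      · intro p hp; simp [hk, hA _ hp]
    have hSk : S η = ∫ p, k p := by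
      rw [Measure.volume_eq_prod, integral_prod _ hki]
      simp only [hS]
      congr 1 with x
      rw [hf.add_conj_horiz_eq hη.ne', ← integral_const_mul, ← integral_div]
      congr 1 with t
      simp only [hk]
      ring
    have hSk' : S η = ∫ p : ℝ × ℝ, k p.swap := by
      rw [hSk, Measure.volume_eq_prod, integral_prod_swap]
    rw [two_mul]
    nth_rewrite 1 [hSk]
    rw [hSk', ← integral_add (g := fun p : ℝ × ℝ => k p.swap) hki hki.swap]
    congr 1 with p
    have h1 := hne p.1
    have h2 := hne p.2
    have h3 : ((p.1 : ℂ) - p.2) ^ 2 + η ^ 2 ≠ 0 := by exact_mod_cast e1 p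
    have h4 : ((p.2 : ℂ) - p.1) ^ 2 + η ^ 2 = ((p.1 : ℂ) - p.2) ^ 2 + η ^ 2 := by ring
    simp only [hk, hH, Prod.fst_swap, Prod.snd_swap]
    push_cast
    rw [h4]
    field_simp
    ring
  have hlim := tendsto_nhds_unique ((lim1.const_mul 2).congr' (by
    filter_upwards [self_mem_nhdsWithin] with η hη
    exact heq η hη)) lim2
  have hfin : ∫ p : ℝ × ℝ, (f p.1 : ℂ) * f p.2 * (2 : ℝ) / ((z - p.1) * (z - p.2)) =
      2 * cau (fun t => (f t : ℂ)) z ^ 2 := by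
    rw [sq, cau, ← integral_prod_mul, ← integral_const_mul, ← Measure.volume_eq_prod]
    congr 1 with p
    have h1 := hne p.1
    have h2 := hne p.2
    field_simp
    push_cast
    ring
  rw [hfin] at hlim
  exact mul_left_cancel₀ two_ne_zero hlim

end IsSmoothDensity

/-! ### Difference quotients of the Cauchy transform -/

/-- The difference quotient of the Cauchy transform of `f`. -/
def divDiff (f : ℝ → ℝ) (z w : ℂ) : ℂ :=
  -∫ t : ℝ, (f t : ℂ) / ((z - t) * (w - t))

theorem integrable_div_mul {g : ℝ → ℂ} (hg : Integrable g) {z w : ℂ} (hz : z.im ≠ 0)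
    (hw : w.im ≠ 0) : Integrable fun t : ℝ => g t / ((z - t) * (w - t)) := by
  have h1 : Integrable fun t : ℝ => g t / (z - t) := by
    simpa using integrable_div_sub_pow hg hz 1
  have h2 := integrable_div_sub_pow h1 hw 1
  simpa [div_div] using h2

theorem divDiff_of_ne {f : ℝ → ℝ} (hf : Integrable fun t => (f t : ℂ)) {z w : ℂ} (hz : z.im ≠ 0)
    (hw : w.im ≠ 0) (h : z ≠ w) :
    divDiff f z w = (cau (fun t => (f t : ℂ)) z - cau (fun t => (f t : ℂ)) w) / (z - w) := by
  have i1 : Integrable fun t : ℝ => (f t : ℂ) / (z - t) := by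
    simpa using integrable_div_sub_pow hf hz 1
  have i2 : Integrable fun t : ℝ => (f t : ℂ) / (w - t) := by
    simpa using integrable_div_sub_pow hf hw 1
  rw [divDiff, cau, cau, ← integral_sub i1 i2, ← integral_neg, ← integral_div]
  congr 1 with t
  have h1 := sub_ofReal_ne_zero hz t
  have h2 := sub_ofReal_ne_zero hw t
  have h3 := sub_ne_zero.2 h
  field_simp
  ring

theorem dslope_cau {f : ℝ → ℝ} (hf : Integrable fun t => (f t : ℂ)) {z w : ℂ} (hz : z.im ≠ 0)
    (hw : w.im ≠ 0) : dslope (cau fun t => (f t : ℂ)) w z = divDiff f z w := by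
  rcases eq_or_ne z w with rfl | h
  · rw [dslope_same, (hasDerivAt_cau hf hz).deriv, divDiff]
    simp only [sq]
  · rw [dslope_of_ne _ h, slope_def_field, divDiff_of_ne hf hz hw h]

theorem add_mul_I_im (x s : ℝ) : ((x : ℂ) + s * Complex.I).im = s := by
  simp

namespace IsSmoothDensity

variable {f : ℝ → ℝ} (hf : IsSmoothDensity f)

include hf

theorem integrable_complex : Integrable fun t => (f t : ℂ) :=
  integrable_ofReal hf.contDiff_one hf.hasCompactSupport

theorem continuous_divDiff {s t : ℝ} (hs : s ≠ 0) (ht : t ≠ 0) :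
    Continuous fun p : ℝ × ℝ => divDiff f (p.1 + s * Complex.I) (p.2 + t * Complex.I) := by
  have hne : ∀ (p : ℝ × ℝ) (r : ℝ),
      ((p.1 : ℂ) + s * Complex.I - r) * (p.2 + t * Complex.I - r) ≠ 0 := fun p r =>
    mul_ne_zero (ofReal_add_mul_I_sub_ne_zero hs r) (ofReal_add_mul_I_sub_ne_zero ht r)
  refine Continuous.neg ?_
  refine continuous_of_dominated (bound := fun r => f r / (|s| * |t|)) ?_ ?_
    (hf.integrable.div_const _) ?_
  · intro p
    exact (hf.continuous_ofReal.div (by fun_prop) (hne p)).aestronglyMeasurable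
  · intro p
    refine Eventually.of_forall fun r => ?_
    rw [norm_div, norm_mul, Complex.norm_of_nonneg (hf.nonneg r)]
    have h1 := abs_im_le_norm_sub (p.1 + s * Complex.I) r
    have h2 := abs_im_le_norm_sub (p.2 + t * Complex.I) r
    rw [add_mul_I_im] at h1 h2
    have := abs_pos.2 hs
    have := abs_pos.2 ht
    have := hf.nonneg r
    gcongr
  · refine Eventually.of_forall fun r => ?_
    exact continuous_const.div (by fun_prop) fun p => hne p r

/-- The Poisson-type integral of a nonzero nonnegative continuous f is strictly positive. Thus G has
no zero off the real axis, at any height, and the denominators of the kernel never vanish. -/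
theorem im_horiz_ne_zero {s : ℝ} (hs : s ≠ 0) (x : ℝ) : (horiz f s x).im ≠ 0 := by
  rw [hf.im_horiz_eq hs]
  have hpos : ∀ t, 0 < (x - t) ^ 2 + s ^ 2 := fun t => by positivity
  have hcont : Continuous fun t => f t / ((x - t) ^ 2 + s ^ 2) := by
    have := hf.contDiff.continuous
    fun_prop (disch := exact fun t => (hpos t).ne')
  have hsupp : HasCompactSupport fun t => f t / ((x - t) ^ 2 + s ^ 2) := by
    simp only [div_eq_mul_inv]
    exact hf.hasCompactSupport.mul_right
  refine neg_ne_zero.2 (mul_ne_zero hs (ne_of_gt ?_))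
  have hex : ∃ t, f t ≠ 0 := by
    by_contra! h
    have := hf.integral_eq_one
    simp [h] at this
  obtain ⟨t, ht⟩ := hex
  exact hcont.integral_pos_of_hasCompactSupport_nonneg_nonzero hsupp
    (fun t => div_nonneg (hf.nonneg t) (hpos t).le) (x := t) (div_ne_zero ht (hpos t).ne')

theorem horiz_ne_zero' {s : ℝ} (hs : s ≠ 0) (x : ℝ) : horiz f s x ≠ 0 := fun h =>
  hf.im_horiz_ne_zero hs x (by rw [h, Complex.zero_im])

theorem continuous_horiz {s : ℝ} (hs : s ≠ 0) : Continuous (horiz f s) :=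
  FreeProb.continuous_horiz hf.contDiff_one hf.hasCompactSupport hs

theorem integrable_of_continuous {k : ℝ × ℝ → ℂ} (hk : Continuous k) :
    Integrable fun p : ℝ × ℝ => (f p.1 : ℂ) * f p.2 * k p := by
  obtain ⟨A, -, hA⟩ := hf.exists_support_bound
  have hF := hf.continuous_ofReal
  refine Continuous.integrable_of_hasCompactSupport
    (((hF.comp continuous_fst).mul (hF.comp continuous_snd)).mul hk) (hasCompactSupport_of_prod (A := A) ?_ ?_)
  · intro p hp
    simp [hA _ hp]
  · intro p hp
    simp [hA _ hp]

theorem integral_swap_of_continuous {k : ℝ × ℝ → ℂ} (hk : Continuous k) :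
    ∫ x : ℝ, ∫ y : ℝ, (f x : ℂ) * f y * k (x, y) = ∫ y : ℝ, ∫ x : ℝ, (f x : ℂ) * f y * k (x, y) :=
  integral_integral_swap (f := fun x y : ℝ => (f x : ℂ) * f y * k (x, y))
    (hf.integrable_of_continuous hk)

/-- The boundary form of `∫ f ((Hf)² - f²/3) = 0`. -/
theorem integral_mul_bdry_sq :
    ∫ x, (f x : ℂ) * bdry f x ^ 2 = -∫ x, symMul f x * conj (bdry f x) := by
  obtain ⟨A, hApos, hA⟩ := hf.exists_support_bound
  obtain ⟨B, hB, b0, b1, b2⟩ := hf.exists_bounds A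
  obtain ⟨U, hU⟩ := hf.contDiff_symMul.continuous.bounded_above_of_compact_support
    hf.hasCompactSupport_symMul
  have hU0 : 0 ≤ U := (norm_nonneg _).trans (hU 0)
  have hF := hf.continuous_ofReal
  have hu := hf.contDiff_symMul.continuous
  have lim1 : Tendsto (fun ε => ∫ x, (f x : ℂ) * horiz f ε x ^ 2) (𝓝[>] 0)
      (𝓝 (∫ x, (f x : ℂ) * bdry f x ^ 2)) := by
    refine tendsto_integral_of_bounded (A := A) (C := B * B ^ 2) ?_ ?_ ?_ ?_
    · filter_upwards [self_mem_nhdsWithin] with ε hε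
      exact (hF.mul ((hf.continuous_horiz (ne_of_gt hε)).pow 2)).aestronglyMeasurable
    · exact Eventually.of_forall fun ε x hx => by simp [hA x hx]
    · filter_upwards [Ioc_mem_nhdsGT one_pos] with ε hε x hx
      rw [norm_mul, norm_pow, Complex.norm_of_nonneg (hf.nonneg x)]
      have := (b2 ε hε.1 hε.2 x hx).1
      have := b0 x
      gcongr
    · exact fun x => ((hf.tendsto_horiz x).pow 2).const_mul _
  have lim2 : Tendsto (fun ε => -∫ x, symMul f x * conj (horiz f ε x)) (𝓝[>] 0)
      (𝓝 (-∫ x, symMul f x * conj (bdry f x))) := by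
    refine Tendsto.neg ?_
    refine tendsto_integral_of_bounded (A := A) (C := U * B) ?_ ?_ ?_ ?_
    · filter_upwards [self_mem_nhdsWithin] with ε hε
      exact (hu.mul
        (Complex.continuous_conj.comp (hf.continuous_horiz (ne_of_gt hε)))).aestronglyMeasurable
    · exact Eventually.of_forall fun ε x hx => by simp [symMul, hA x hx]
    · filter_upwards [Ioc_mem_nhdsGT one_pos] with ε hε x hx
      rw [norm_mul, RCLike.norm_conj]
      have := (b2 ε hε.1 hε.2 x hx).1
      have := hU x
      gcongr
    · exact fun x => ((Complex.continuous_conj.tendsto _).comp (hf.tendsto_horiz x)).const_mul _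
  refine tendsto_nhds_unique lim1 (lim2.congr' ?_)
  filter_upwards [self_mem_nhdsWithin] with ε hε
  have hε' : ε ≠ 0 := ne_of_gt hε
  -- At positive height `cau_symMul` rewrites G² as a Cauchy integral of `symMul f`. Fubini then
  -- returns the kernel to f, where its reversal yields minus the transform at the opposite height.
  have h1 : ∫ x, (f x : ℂ) * horiz f ε x ^ 2 =
      ∫ y : ℝ, ∫ x : ℝ, (f y : ℂ) * symMul f x / (y + ε * Complex.I - x) := by
    congr 1 with y
    rw [horiz, ← hf.cau_symMul (by simpa using hε'), cau, ← integral_const_mul]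
    congr 1 with x
    rw [mul_div_assoc]
  have hcont : Continuous (Function.uncurry fun y x : ℝ =>
      (f y : ℂ) * symMul f x / (y + ε * Complex.I - x)) := by
    refine Continuous.div ((hF.comp continuous_fst).mul (hu.comp continuous_snd)) (by fun_prop)
      fun p => ?_
    exact ofReal_add_mul_I_sub_ne_zero hε' _
  rw [h1, integral_integral_swap_of_hasCompactSupport hcont, ← integral_neg]
  · congr 1 with x
    rw [← horiz_neg, horiz, cau, ← integral_const_mul, ← integral_neg]
    congr 1 with y
    rw [mul_comm (f y : ℂ), mul_div_assoc, ← mul_neg, ← div_neg]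
    congr 2
    push_cast
    ring
  · refine hasCompactSupport_of_prod (A := A) ?_ ?_
    · intro p hp
      simp [Function.uncurry, hA _ hp]
    · intro p hp
      simp [Function.uncurry, symMul, hA _ hp]

theorem continuous_hilbert : Continuous (hilbert f) :=
  FreeProb.continuous_hilbert hf.contDiff_one hf.hasCompactSupport

theorem integrable_mul_of_continuous {k : ℝ → ℝ} (hk : Continuous k) :
    Integrable fun x => f x * k x :=
  (hf.contDiff.continuous.mul hk).integrable_of_hasCompactSupport hf.hasCompactSupport.mul_right

/-- Real parts of `integral_mul_bdry_sq`: the integrands are π²(f (Hf)² − f³) on the left and 2π² f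
(Hf)² under the minus sign on the right. -/
theorem integral_mul_hilbert_sq :
    3 * ∫ x, f x * hilbert f x ^ 2 = ∫ x, f x ^ 3 := by
  have h := congrArg Complex.re hf.integral_mul_bdry_sq
  have hF := hf.continuous_ofReal
  have hb := continuous_bdry hf.contDiff_one hf.hasCompactSupport
  have i1 : Integrable fun x => (f x : ℂ) * bdry f x ^ 2 :=
    (hF.mul (hb.pow 2)).integrable_of_hasCompactSupport hf.hasCompactSupport_ofReal.mul_right
  have i2 : Integrable fun x => symMul f x * conj (bdry f x) :=
    (hf.contDiff_symMul.continuous.mul (Complex.continuous_conj.comp hb)).integrable_of_hasCompactSupport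
      hf.hasCompactSupport_symMul.mul_right
  rw [Complex.neg_re, show (∫ x, (f x : ℂ) * bdry f x ^ 2).re =
    ∫ x, ((f x : ℂ) * bdry f x ^ 2).re from (integral_re i1).symm,
    show (∫ x, symMul f x * conj (bdry f x)).re =
    ∫ x, (symMul f x * conj (bdry f x)).re from (integral_re i2).symm] at h
  have hre := bdry_re hf.contDiff_one hf.hasCompactSupport
  have him := bdry_im hf.contDiff_one hf.hasCompactSupport
  have e1 : ∀ x, ((f x : ℂ) * bdry f x ^ 2).re =
      Real.pi ^ 2 * (f x * hilbert f x ^ 2 - f x ^ 3) := by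
    intro x
    rw [Complex.re_ofReal_mul, sq, Complex.mul_re, hre, him]
    ring
  have e2 : ∀ x, (symMul f x * conj (bdry f x)).re =
      Real.pi ^ 2 * (2 * (f x * hilbert f x ^ 2)) := by
    intro x
    simp only [symMul, Complex.mul_re, Complex.mul_im, Complex.add_re, Complex.add_im,
      Complex.ofReal_re, Complex.ofReal_im, Complex.conj_re, Complex.conj_im, hre, him]
    ring
  simp_rw [e1, e2, integral_const_mul] at h
  have j1 := hf.integrable_mul_of_continuous (k := fun x => hilbert f x ^ 2)
    (hf.continuous_hilbert.pow 2)
  have j2 : Integrable fun x => f x ^ 3 :=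
    (hf.integrable_mul_of_continuous (k := fun x => f x ^ 2) (hf.contDiff.continuous.pow 2)).congr
      (Eventually.of_forall fun x => by ring)
  rw [integral_sub j1 j2] at h
  have hpi : Real.pi ^ 2 ≠ 0 := by positivity
  have h' : Real.pi ^ 2 * ((∫ x, f x * hilbert f x ^ 2) - ∫ x, f x ^ 3) =
      Real.pi ^ 2 * -(2 * ∫ x, f x * hilbert f x ^ 2) := by linarith
  have := mul_left_cancel₀ hpi h'
  linarith

/-! ### The regular part of the kernel -/

/-- Exchanging the two variables negates the kernel and reverses the height. This is what cancels
the terms G(z)G(w) in the sum over signs. -/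
theorem integral_mul_horiz_neg {s : ℝ} (hs : s ≠ 0) :
    ∫ x, (f x : ℂ) * horiz f (-s) x = -∫ x, (f x : ℂ) * horiz f s x := by
  have hc : ∀ {s : ℝ}, s ≠ 0 → Continuous fun p : ℝ × ℝ => ((p.1 : ℂ) + s * Complex.I - p.2)⁻¹ :=
    fun hs => Continuous.inv₀ (by fun_prop) fun p => ofReal_add_mul_I_sub_ne_zero hs _
  have e : ∀ s : ℝ, ∫ x, (f x : ℂ) * horiz f s x =
      ∫ x : ℝ, ∫ y : ℝ, (f x : ℂ) * f y * ((x : ℂ) + s * Complex.I - y)⁻¹ := by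
    intro s
    congr 1 with x
    rw [horiz, cau, ← integral_const_mul]
    congr 1 with y
    rw [div_eq_mul_inv, mul_assoc]
  rw [e, e, hf.integral_swap_of_continuous (hc hs), ← integral_neg]
  congr 1 with x
  rw [← integral_neg]
  congr 1 with y
  rw [← mul_neg, ← inv_neg, mul_comm (f x : ℂ)]
  congr 2
  push_cast
  ring

/-- `divDiff` is minus an integral of f(r)/((z − r)(w − r)). Integrating over x and y before r gives
two Cauchy transforms at r; each reversal of a kernel costs a sign and flips the height. -/
theorem integral_integral_divDiff {s t : ℝ} (hs : s ≠ 0) (ht : t ≠ 0) :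
    ∫ x : ℝ, ∫ y : ℝ, (f x : ℂ) * f y * divDiff f (x + s * Complex.I) (y + t * Complex.I) =
      -∫ r : ℝ, (f r : ℂ) * (horiz f (-s) r * horiz f (-t) r) := by
  have hF := hf.continuous_ofReal
  have hne : ∀ {s : ℝ}, s ≠ 0 → ∀ x r : ℝ, (x : ℂ) + s * Complex.I - r ≠ 0 := fun hs x r =>
    ofReal_add_mul_I_sub_ne_zero hs r
  have hrev : ∀ s r : ℝ, ∫ x : ℝ, (f x : ℂ) * (x + s * Complex.I - r)⁻¹ = -horiz f (-s) r := by
    intro s r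
    rw [horiz, cau, ← integral_neg]
    congr 1 with x
    rw [← div_eq_mul_inv, ← div_neg]
    congr 1
    push_cast
    ring
  have h1 : ∀ x : ℝ, ∫ y : ℝ, (f x : ℂ) * f y *
        divDiff f (x + s * Complex.I) (y + t * Complex.I) =
      ∫ r : ℝ, (f x : ℂ) * f r * ((x + s * Complex.I - r)⁻¹ * horiz f (-t) r) := by
    intro x
    have hc : Continuous fun p : ℝ × ℝ =>
        ((x : ℂ) + s * Complex.I - p.2)⁻¹ * ((p.1 : ℂ) + t * Complex.I - p.2)⁻¹ :=
      (Continuous.inv₀ (by fun_prop) fun p => hne hs _ _).mul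
        (Continuous.inv₀ (by fun_prop) fun p => hne ht _ _)
    have e1 : ∀ y : ℝ, (f x : ℂ) * f y * divDiff f (x + s * Complex.I) (y + t * Complex.I) =
        -(f x : ℂ) * ∫ r : ℝ, (f y : ℂ) * f r *
          (((x : ℂ) + s * Complex.I - r)⁻¹ * ((y : ℂ) + t * Complex.I - r)⁻¹) := by
      intro y
      rw [divDiff, mul_neg, neg_mul, mul_assoc, ← integral_const_mul, ← integral_const_mul]
      rw [← integral_const_mul]
      congr 2 with r
      rw [div_eq_mul_inv, mul_inv]
      ring
    simp_rw [e1]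
    rw [integral_const_mul, hf.integral_swap_of_continuous hc, ← integral_const_mul]
    congr 1 with r
    have e2 : ∀ y : ℝ, (f y : ℂ) * f r *
        (((x : ℂ) + s * Complex.I - r)⁻¹ * ((y : ℂ) + t * Complex.I - r)⁻¹) =
        f r * ((x : ℂ) + s * Complex.I - r)⁻¹ * (f y * ((y : ℂ) + t * Complex.I - r)⁻¹) :=
      fun y => by ring
    simp_rw [e2]
    rw [integral_const_mul, hrev]
    ring
  simp_rw [h1]
  have hc2 : Continuous fun p : ℝ × ℝ =>
      ((p.1 : ℂ) + s * Complex.I - p.2)⁻¹ * horiz f (-t) p.2 :=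
    (Continuous.inv₀ (by fun_prop) fun p => hne hs _ _).mul
      ((hf.continuous_horiz (neg_ne_zero.2 ht)).comp continuous_snd)
  rw [hf.integral_swap_of_continuous hc2, ← integral_neg]
  congr 1 with r
  have e2 : ∀ x : ℝ, (f x : ℂ) * f r * (((x : ℂ) + s * Complex.I - r)⁻¹ * horiz f (-t) r) =
        f r * horiz f (-t) r * (f x * ((x : ℂ) + s * Complex.I - r)⁻¹) :=
      fun y => by ring
  simp_rw [e2]
  rw [integral_const_mul, hrev]
  ring

end IsSmoothDensity

/-! ### The singular part of the kernel -/

/-- The double integral of the singular part of the kernel on the horizontal lines at heights `s`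
and `t`. -/
def singInt (f : ℝ → ℝ) (s t : ℝ) : ℂ :=
  ∫ x : ℝ, ∫ y : ℝ, (f x : ℂ) * f y *
    (divDiff f (x + s * Complex.I) (y + t * Complex.I) ^ 2 / (horiz f s x * horiz f t y))

theorem divDiff_conj (f : ℝ → ℝ) (z w : ℂ) :
    divDiff f (conj z) (conj w) = conj (divDiff f z w) := by
  rw [divDiff, divDiff, map_neg, ← integral_conj]
  simp

theorem singInt_neg (f : ℝ → ℝ) (s t : ℝ) : singInt f (-s) (-t) = conj (singInt f s t) := by
  have e : ∀ x s : ℝ, (x : ℂ) + (-s : ℝ) * Complex.I = conj ((x : ℂ) + s * Complex.I) := by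
    intro x s
    simp
  rw [singInt, singInt, ← integral_conj]
  congr 1 with x
  rw [← integral_conj]
  congr 1 with y
  rw [horiz_neg, horiz_neg, e, e, divDiff_conj]
  simp

/-- The derivative of the square of the density. -/
theorem hasDerivAt_sq_of_differentiable {f : ℝ → ℝ} (hf : Differentiable ℝ f) (x : ℝ) :
    HasDerivAt (fun x => f x ^ 2) (2 * f x * deriv f x) x := by
  simpa using (hf x).hasDerivAt.fun_pow 2

namespace IsSmoothDensity

variable {f : ℝ → ℝ} (hf : IsSmoothDensity f)

include hf

theorem continuous_singInt_kernel {s t : ℝ} (hs : s ≠ 0) (ht : t ≠ 0) :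
    Continuous fun p : ℝ × ℝ =>
      divDiff f (p.1 + s * Complex.I) (p.2 + t * Complex.I) ^ 2 /
        (horiz f s p.1 * horiz f t p.2) :=
  ((hf.continuous_divDiff hs ht).pow 2).div
    (((hf.continuous_horiz hs).comp continuous_fst).mul
      ((hf.continuous_horiz ht).comp continuous_snd))
    fun _ => mul_ne_zero (hf.horiz_ne_zero' hs _) (hf.horiz_ne_zero' ht _)

theorem singInt_eq_integral_prod {s t : ℝ} (hs : s ≠ 0) (ht : t ≠ 0) :
    singInt f s t = ∫ p : ℝ × ℝ, (f p.1 : ℂ) * f p.2 *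
      (divDiff f (p.1 + s * Complex.I) (p.2 + t * Complex.I) ^ 2 /
        (horiz f s p.1 * horiz f t p.2)) := by
  rw [Measure.volume_eq_prod,
    integral_prod _ (hf.integrable_of_continuous (hf.continuous_singInt_kernel hs ht))]
  rfl

theorem hasCompactSupport_mul_right (k : ℝ → ℂ) : HasCompactSupport fun x => (f x : ℂ) * k x :=
  hf.hasCompactSupport_ofReal.mul_right

theorem hasCompactSupport_div_right (k : ℝ → ℂ) : HasCompactSupport fun x => (f x : ℂ) / k x := by
  simp only [div_eq_mul_inv]
  exact hf.hasCompactSupport_mul_right fun x => (k x)⁻¹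

/-- With a = G(z), b = G(w) one has (a − b)²/(ab) = a/b + b/a − 2. Distinct heights keep z − w = x −
y − i(t − s) away from 0, so that the three terms may be integrated separately. -/
theorem singInt_eq_pairing {s t : ℝ} (hs : s ≠ 0) (ht : t ≠ 0) (hst : s ≠ t) :
    singInt f s t =
      pairing (t - s) (fun x => f x * horiz f s x) (fun x => f x / horiz f t x) +
      pairing (t - s) (fun x => f x / horiz f s x) (fun x => f x * horiz f t x) -
      2 * pairing (t - s) (fun x => (f x : ℂ)) (fun x => (f x : ℂ)) := by
  have hδ : t - s ≠ 0 := sub_ne_zero.2 hst.symm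
  have hF := hf.continuous_ofReal
  have cF := hf.hasCompactSupport_ofReal
  have ha : ∀ {s : ℝ}, s ≠ 0 → Continuous fun x => (f x : ℂ) * horiz f s x := fun hs =>
    hF.mul (hf.continuous_horiz hs)
  have hb : ∀ {s : ℝ}, s ≠ 0 → Continuous fun x => (f x : ℂ) / horiz f s x := fun hs =>
    hF.div (hf.continuous_horiz hs) (hf.horiz_ne_zero' hs)
  have ca : ∀ s : ℝ, HasCompactSupport fun x => (f x : ℂ) * horiz f s x := fun s =>
    hf.hasCompactSupport_mul_right _
  have cb : ∀ s : ℝ, HasCompactSupport fun x => (f x : ℂ) / horiz f s x := fun s =>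
    hf.hasCompactSupport_div_right _
  have i1 := integrable_pairing_integrand hδ (ha hs) (hb ht) (ca s) (cb t)
  have i2 := integrable_pairing_integrand hδ (hb hs) (ha ht) (cb s) (ca t)
  have i3 := integrable_pairing_integrand hδ hF hF cF cF
  rw [hf.singInt_eq_integral_prod hs ht, pairing_eq_integral_prod hδ (ha hs) (hb ht) (ca s) (cb t),
    pairing_eq_integral_prod hδ (hb hs) (ha ht) (cb s) (ca t),
    pairing_eq_integral_prod hδ hF hF cF cF, ← integral_const_mul, ← integral_add i1 i2,
    ← integral_sub (by exact i1.add i2) (i3.const_mul 2)]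
  congr 1 with p
  have h1 := hf.horiz_ne_zero' hs p.1
  have h2 := hf.horiz_ne_zero' ht p.2
  have h3 := sub_sub_mul_I_ne_zero hδ p.1 p.2
  have e : (p.1 : ℂ) + s * Complex.I - (p.2 + t * Complex.I) =
      p.1 - p.2 - (t - s : ℝ) * Complex.I := by
    push_cast
    ring
  rw [divDiff_of_ne hf.integrable_complex (by simpa using hs) (by simpa using ht)
    (sub_ne_zero.1 (by rw [e]; exact h3)), e]
  have hh : ∀ s x : ℝ, cau (fun t => (f t : ℂ)) (x + s * Complex.I) = horiz f s x :=
    fun _ _ => rfl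
  rw [hh, hh]
  field_simp
  ring

/-- G' is bounded on a convex box reaching down to the axis, so the mean value inequality applies.
Both points must lie on the same side, since G jumps across the axis. -/
theorem exists_bound_divDiff (A : ℝ) :
    ∃ B, 0 ≤ B ∧ ∀ s t : ℝ, 0 < s → s ≤ 1 → 0 < t → t ≤ 1 → ∀ x y : ℝ, |x| ≤ A → |y| ≤ A →
      ‖divDiff f (x + s * Complex.I) (y + t * Complex.I)‖ ≤ B := by
  obtain ⟨B, hB, b0, b1, b2⟩ := hf.exists_bounds A
  refine ⟨B, hB, fun s t hs hs1 ht ht1 x y hx hy => ?_⟩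
  set V : Set ℂ := Complex.re ⁻¹' (Icc (-A) A) ∩ Complex.im ⁻¹' (Ioc 0 1) with hV
  have hconv : Convex ℝ V :=
    ((convex_Icc (-A) A).linear_preimage Complex.reLm).inter
      ((convex_Ioc 0 1).linear_preimage Complex.imLm)
  have hder : ∀ z ∈ V, HasDerivWithinAt (cau fun t => (f t : ℂ))
      (cau (fun t => ((deriv f t : ℝ) : ℂ)) z) V z := fun z hz =>
    (hasDerivAt_cau_ofReal hf.contDiff_one hf.hasCompactSupport (ne_of_gt hz.2.1)).hasDerivWithinAt
  have hbd : ∀ z ∈ V, ‖cau (fun t => ((deriv f t : ℝ) : ℂ)) z‖ ≤ B := by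
    intro z hz
    have := (b2 z.im hz.2.1 hz.2.2 z.re (abs_le.2 hz.1)).2
    rwa [horiz, Complex.re_add_im] at this
  have hz : ((x : ℂ) + s * Complex.I) ∈ V := ⟨by simpa using abs_le.1 hx, by simpa using ⟨hs, hs1⟩⟩
  have hw : ((y : ℂ) + t * Complex.I) ∈ V := ⟨by simpa using abs_le.1 hy, by simpa using ⟨ht, ht1⟩⟩
  have hzi := ne_of_gt hz.2.1
  have hwi := ne_of_gt hw.2.1
  by_cases h : (x : ℂ) + s * Complex.I = y + t * Complex.I
  · rw [← h, divDiff]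
    simp only [← sq]
    rw [integral_div_sub_sq (contDiff_ofReal_comp hf.contDiff_one) hf.hasCompactSupport_ofReal hzi,
      deriv_ofReal_comp (hf.contDiff_one.differentiable one_ne_zero), neg_neg]
    exact hbd _ hz
  · rw [divDiff_of_ne hf.integrable_complex hzi hwi h, norm_div,
      div_le_iff₀ (norm_pos_iff.2 (sub_ne_zero.2 h))]
    exact hconv.norm_image_sub_le_of_norm_hasDerivWithin_le hder hbd hw hz

/-- On one side of the axis nothing is singular: f/G and the difference quotient are bounded. The
limit is independent of how the two heights tend to 0, which lets the case of equal heights be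
computed with unequal ones. -/
theorem tendsto_singInt_same {s t : ℝ → ℝ} (hs : Tendsto s (𝓝[>] 0) (𝓝[>] 0))
    (ht : Tendsto t (𝓝[>] 0) (𝓝[>] 0)) :
    Tendsto (fun ε => singInt f (s ε) (t ε)) (𝓝[>] 0)
      (𝓝 (∫ p : ℝ × ℝ, (f p.1 : ℂ) * f p.2 *
        (((bdry f p.1 - bdry f p.2) / (p.1 - p.2)) ^ 2 / (bdry f p.1 * bdry f p.2)))) := by
  obtain ⟨A, hApos, hA⟩ := hf.exists_support_bound
  obtain ⟨B, hB, b0, b1, b2⟩ := hf.exists_bounds A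
  obtain ⟨D, hD, hD'⟩ := hf.exists_bound_divDiff A
  obtain ⟨C, hC, hC'⟩ := hf.exists_bound_by_horiz
  have hsI : ∀ᶠ ε in 𝓝[>] (0 : ℝ), s ε ∈ Ioc (0 : ℝ) 1 := hs.eventually (Ioc_mem_nhdsGT one_pos)
  have htI : ∀ᶠ ε in 𝓝[>] (0 : ℝ), t ε ∈ Ioc (0 : ℝ) 1 := ht.eventually (Ioc_mem_nhdsGT one_pos)
  have hquot : ∀ ε, 0 < ε → ε ≤ 1 → ∀ x, |x| ≤ A → ‖(f x : ℂ) / horiz f ε x‖ ≤ C * B := by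
    intro ε h0 h1 x hx
    have hpos := norm_pos_iff.2 (hf.horiz_ne_zero h0 h1 x)
    rw [norm_div, Complex.norm_of_nonneg (hf.nonneg x), div_le_iff₀ hpos]
    refine (hC' ε h0 h1 x).1.trans ?_
    have := (b2 ε h0 h1 x hx).1
    rw [sq, ← mul_assoc]
    gcongr
  refine (tendsto_integral_prod_of_bounded (A := A) (C := (C * B) * (C * B) * D ^ 2)
    (F := fun ε (p : ℝ × ℝ) => (f p.1 : ℂ) * f p.2 *
      (divDiff f (p.1 + s ε * Complex.I) (p.2 + t ε * Complex.I) ^ 2 /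
        (horiz f (s ε) p.1 * horiz f (t ε) p.2))) ?_ ?_ ?_ ?_).congr' ?_
  · filter_upwards [hsI, htI] with ε h1 h2
    exact (hf.integrable_of_continuous
      (hf.continuous_singInt_kernel h1.1.ne' h2.1.ne')).aestronglyMeasurable
  · refine Eventually.of_forall fun ε p hp => ?_
    rcases hp with hp | hp <;> simp [hA _ hp]
  · filter_upwards [hsI, htI] with ε h1 h2 p hp1 hp2
    have e : (f p.1 : ℂ) * f p.2 *
        (divDiff f (p.1 + s ε * Complex.I) (p.2 + t ε * Complex.I) ^ 2 /
        (horiz f (s ε) p.1 * horiz f (t ε) p.2)) =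
        (f p.1 / horiz f (s ε) p.1) * (f p.2 / horiz f (t ε) p.2) *
          divDiff f (p.1 + s ε * Complex.I) (p.2 + t ε * Complex.I) ^ 2 := by
      ring
    rw [e, norm_mul, norm_mul, norm_pow]
    have e1 := hquot _ h1.1 h1.2 p.1 hp1
    have e2 := hquot _ h2.1 h2.2 p.2 hp2
    have e3 := hD' _ _ h1.1 h1.2 h2.1 h2.2 p.1 p.2 hp1 hp2
    gcongr
  · intro p hp
    by_cases h1 : f p.1 = 0
    · simp [h1]
    by_cases h2 : f p.2 = 0
    · simp [h2]
    have l1 := (hf.tendsto_horiz p.1).comp hs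
    have l2 := (hf.tendsto_horiz p.2).comp ht
    have l3 : Tendsto (fun ε => ((p.1 : ℂ) + s ε * Complex.I - (p.2 + t ε * Complex.I)))
        (𝓝[>] 0) (𝓝 ((p.1 : ℂ) - p.2)) := by
      have c1 : Tendsto (fun ε => (s ε : ℂ)) (𝓝[>] 0) (𝓝 ((0 : ℝ) : ℂ)) :=
        (Complex.continuous_ofReal.tendsto _).comp (hs.mono_right nhdsWithin_le_nhds)
      have c2 : Tendsto (fun ε => (t ε : ℂ)) (𝓝[>] 0) (𝓝 ((0 : ℝ) : ℂ)) :=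
        (Complex.continuous_ofReal.tendsto _).comp (ht.mono_right nhdsWithin_le_nhds)
      have := ((c1.mul_const Complex.I).const_add (p.1 : ℂ)).sub
        ((c2.mul_const Complex.I).const_add (p.2 : ℂ))
      simpa using this
    have hne : (p.1 : ℂ) - p.2 ≠ 0 := sub_ne_zero.2 (by exact_mod_cast hp)
    refine Tendsto.const_mul _ (Tendsto.div (Tendsto.pow ?_ 2) (l1.mul l2)
      (mul_ne_zero (hf.bdry_ne_zero h1) (hf.bdry_ne_zero h2)))
    refine ((l1.sub l2).div l3 hne).congr' ?_
    filter_upwards [hsI, htI] with ε e1 e2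
    rw [divDiff_of_ne hf.integrable_complex (by simpa using e1.1.ne') (by simpa using e2.1.ne')]
    · simp [horiz]
    · intro h
      have := congrArg Complex.re h
      simp at this
      exact hp this
  · filter_upwards [hsI, htI] with ε h1 h2
    exact (hf.singInt_eq_integral_prod h1.1.ne' h2.1.ne').symm

theorem deriv_symMul : deriv (symMul f) = fun x => mulDeriv f x + conj (mulDeriv f x) :=
  funext fun x => (hf.hasDerivAt_symMul x).deriv

theorem deriv_complex : deriv (fun x => (f x : ℂ)) = fun x => ((deriv f x : ℝ) : ℂ) :=
  deriv_ofReal_comp (hf.contDiff_one.differentiable one_ne_zero)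

/-- The limits of the singular part in terms of the logarithmic form. -/
theorem tendsto_singInt_sum :
    Tendsto (fun ε => singInt f ε ε + singInt f (-ε) ε) (𝓝[>] 0)
      (𝓝 (logForm (deriv (symMul f)) (divDeriv f) +
        logForm (fun x => divDeriv f x + conj (divDeriv f x)) (mulDeriv f) -
        4 * logForm (fun x => ((deriv f x : ℝ) : ℂ)) (fun x => ((deriv f x : ℝ) : ℂ)))) := by
  obtain ⟨A, hApos, hA⟩ := hf.exists_support_bound
  obtain ⟨C₁, fa⟩ := hf.exists_convFamily_mul hA
  obtain ⟨C₂, fb⟩ := hf.exists_convFamily_div hA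
  obtain ⟨C₃, ff⟩ := ConvFamily.exists_const (contDiff_ofReal_comp hf.contDiff_one)
    (A := A) (fun x hx => by simp [hA x hx])
  rw [hf.deriv_complex] at ff
  have hhalf := tendsto_half_nhdsGT
  have htwo := tendsto_two_mul_nhdsGT
  -- Equal heights are outside the scope of `singInt_eq_pairing`, so heights ε/2 and ε are used, and
  -- `tendsto_singInt_same` transfers the limit.
  have l1 : Tendsto (fun ε => singInt f (ε / 2) ε) (𝓝[>] 0)
      (𝓝 (logForm (mulDeriv f) (divDeriv f) + logForm (divDeriv f) (mulDeriv f) -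
        2 * logForm (fun x => ((deriv f x : ℝ) : ℂ)) (fun x => ((deriv f x : ℝ) : ℂ)))) := by
    refine (((fa.half.tendsto_pairing fb hhalf).add (fb.half.tendsto_pairing fa hhalf)).sub
      ((ff.tendsto_pairing ff hhalf).const_mul 2)).congr' ?_
    filter_upwards [self_mem_nhdsWithin] with ε hε
    have h : (0 : ℝ) < ε := hε
    rw [hf.singInt_eq_pairing (by positivity) (by positivity) (by linarith), sub_half]
  have l1' : Tendsto (fun ε => singInt f ε ε) (𝓝[>] 0)
      (𝓝 (logForm (mulDeriv f) (divDeriv f) + logForm (divDeriv f) (mulDeriv f) -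
        2 * logForm (fun x => ((deriv f x : ℝ) : ℂ)) (fun x => ((deriv f x : ℝ) : ℂ)))) := by
    rw [tendsto_nhds_unique l1 (hf.tendsto_singInt_same hhalf tendsto_id)]
    exact hf.tendsto_singInt_same tendsto_id tendsto_id
  -- On opposite sides the heights differ by 2ε, and G at height −ε is the conjugate of G at height
  -- ε, whence the conjugate families.
  have l2 : Tendsto (fun ε => singInt f (-ε) ε) (𝓝[>] 0)
      (𝓝 (logForm (fun x => conj (mulDeriv f x)) (divDeriv f) +
        logForm (fun x => conj (divDeriv f x)) (mulDeriv f) -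
        2 * logForm (fun x => ((deriv f x : ℝ) : ℂ)) (fun x => ((deriv f x : ℝ) : ℂ)))) := by
    refine (((fa.conjugate.tendsto_pairing fb htwo).add (fb.conjugate.tendsto_pairing fa htwo)).sub
      ((ff.tendsto_pairing ff htwo).const_mul 2)).congr' ?_
    filter_upwards [self_mem_nhdsWithin] with ε hε
    have h : (0 : ℝ) < ε := hε
    rw [hf.singInt_eq_pairing (by linarith) (by positivity) (by linarith)]
    have e : ε - -ε = 2 * ε := by ring
    rw [e]
    simp only [horiz_neg, map_mul, map_div₀, Complex.conj_ofReal]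
  have h := l1'.add l2
  rw [hf.deriv_symMul, ConvFamily.logForm_add_left fa fa.conjugate fb,
    ConvFamily.logForm_add_left fb fb.conjugate fa]
  convert h using 2
  ring

theorem cau_deriv_symMul {z : ℂ} (hz : z.im ≠ 0) :
    cau (deriv (symMul f)) z =
      2 * (cau (fun t => (f t : ℂ)) z * cau (fun t => ((deriv f t : ℝ) : ℂ)) z) := by
  have h1 := hasDerivAt_cau_of_contDiff hf.contDiff_symMul hf.hasCompactSupport_symMul hz
  have h2 := (hasDerivAt_cau_ofReal hf.contDiff_one hf.hasCompactSupport hz).fun_pow 2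
  have h3 : cau (symMul f) =ᶠ[𝓝 z] fun w => cau (fun t => (f t : ℂ)) w ^ 2 := by
    filter_upwards [(isOpen_ne.preimage Complex.continuous_im).mem_nhds hz] with w hw
    exact hf.cau_symMul hw
  rw [(h1.congr_of_eventuallyEq h3.symm).unique h2]
  simp only [Nat.cast_ofNat, Nat.add_one_sub_one, pow_one]
  ring

end IsSmoothDensity

/-- For a fixed first argument p one integration by parts suffices. Only the product of v and the
Cauchy transform of p' has to be bounded and convergent, so cancellation between the two factors can
be used. -/
theorem ConvFamily.logForm_eq_neg_integral {A C K : ℝ} {p q : ℝ → ℂ} {v : ℝ → ℝ → ℂ} {w : ℝ → ℂ}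
    (hp : ContDiff ℝ 1 p) (hA : ∀ x, A < |x| → p x = 0) (hv : ConvFamily A C v w)
    (hlim : ∀ x, Tendsto (fun ε : ℝ => v ε x * cau (deriv p) (x + ε * Complex.I)) (𝓝[>] 0)
      (𝓝 (q x)))
    (hbd : ∀ ε : ℝ, 0 < ε → ε ≤ 1 → ∀ x : ℝ, |x| ≤ A →
      ‖v ε x * cau (deriv p) (x + ε * Complex.I)‖ ≤ K) :
    logForm (deriv p) w = -∫ x, q x := by
  obtain ⟨C', hp'⟩ := ConvFamily.exists_const hp hA
  have hcp := hasCompactSupport_of_eq_zero hA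
  have hint : Integrable (deriv p) :=
    (hp.continuous_deriv le_rfl).integrable_of_hasCompactSupport hcp.deriv
  have h1 := hp'.tendsto_pairing hv tendsto_id
  have h2 : Tendsto (fun ε : ℝ => -∫ x : ℝ, v ε x * cau (deriv p) (x + ε * Complex.I)) (𝓝[>] 0)
      (𝓝 (-∫ x, q x)) := by
    refine Tendsto.neg (tendsto_integral_of_bounded (A := A) (C := K) ?_ ?_ ?_ hlim)
    · filter_upwards [Ioc_mem_nhdsGT one_pos] with ε hε
      exact ((hv.contDiff ε hε.1 hε.2).continuous.mul
        (continuous_cau_horizontal hint hε.1.ne')).aestronglyMeasurable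
    · filter_upwards [Ioc_mem_nhdsGT one_pos] with ε hε x hx
      rw [hv.eq_zero ε hε.1 hε.2 x hx, zero_mul]
    · filter_upwards [Ioc_mem_nhdsGT one_pos] with ε hε x hx
      exact hbd ε hε.1 hε.2 x hx
  refine tendsto_nhds_unique h1 (h2.congr' ?_)
  filter_upwards [Ioc_mem_nhdsGT one_pos] with ε hε
  exact (pairing_eq_neg_integral_mul_cau hε.1.ne' hp (hv.contDiff ε hε.1 hε.2).continuous hcp
    (hv.hasCompactSupport hε.1 hε.2)).symm

/-! ### Evaluation of the limiting logarithmic forms -/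

namespace IsSmoothDensity

variable {f : ℝ → ℝ} (hf : IsSmoothDensity f)

include hf

theorem logForm_deriv_deriv :
    logForm (fun x => ((deriv f x : ℝ) : ℂ)) (fun x => ((deriv f x : ℝ) : ℂ)) =
      -∫ x, (f x : ℂ) * bdry (deriv f) x := by
  obtain ⟨A, -, hA⟩ := hf.exists_support_bound
  obtain ⟨B, hB, b0, b1, b2⟩ := hf.exists_bounds A
  obtain ⟨C, ff⟩ := ConvFamily.exists_const (contDiff_ofReal_comp hf.contDiff_one)
    (A := A) (fun x hx => by simp [hA x hx])
  have := ConvFamily.logForm_eq_neg_integral (K := B * B) (contDiff_ofReal_comp hf.contDiff_one)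
    (A := A) (fun x hx => by simp [hA x hx]) ff (q := fun x => (f x : ℂ) * bdry (deriv f) x)
    (fun x => ?_) ?_
  · rwa [hf.deriv_complex] at this
  · rw [hf.deriv_complex]
    exact (hf.tendsto_horiz_deriv x).const_mul _
  · intro ε h0 h1 x hx
    rw [hf.deriv_complex, norm_mul, Complex.norm_of_nonneg (hf.nonneg x)]
    have e1 := b0 x
    have e2 := (b2 ε h0 h1 x hx).2
    rw [horiz] at e2
    gcongr

/-- The Cauchy transform of the derivative of `symMul f` is 2GG', and its factor G cancels the
denominator of f/G before the limit is taken. -/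
theorem logForm_symMul_divDeriv :
    logForm (deriv (symMul f)) (divDeriv f) = -∫ x, 2 * ((f x : ℂ) * bdry (deriv f) x) := by
  obtain ⟨A, -, hA⟩ := hf.exists_support_bound
  obtain ⟨B, hB, b0, b1, b2⟩ := hf.exists_bounds A
  obtain ⟨C, fb⟩ := hf.exists_convFamily_div hA
  have key : ∀ ε : ℝ, 0 < ε → ε ≤ 1 → ∀ x : ℝ, (f x : ℂ) / horiz f ε x *
      cau (deriv (symMul f)) (x + ε * Complex.I) = 2 * ((f x : ℂ) * horiz (deriv f) ε x) := by
    intro ε h0 h1 x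
    have hne := hf.horiz_ne_zero h0 h1 x
    rw [hf.cau_deriv_symMul (by simpa using h0.ne')]
    rw [horiz] at hne
    rw [horiz, horiz]
    field_simp
  refine ConvFamily.logForm_eq_neg_integral (K := 2 * (B * B)) (A := A) hf.contDiff_symMul
    (fun x hx => by simp [symMul, hA x hx]) fb (fun x => ?_) ?_
  · refine (((hf.tendsto_horiz_deriv x).const_mul (f x : ℂ)).const_mul 2).congr' ?_
    filter_upwards [Ioc_mem_nhdsGT one_pos] with ε hε
    exact (key ε hε.1 hε.2 x).symm
  · intro ε h0 h1 x hx
    rw [key ε h0 h1, norm_mul, norm_mul, Complex.norm_of_nonneg (hf.nonneg x)]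
    have e1 := b0 x
    have e2 := (b2 ε h0 h1 x hx).2
    simp only [Complex.norm_ofNat]
    gcongr

theorem contDiff_sq : ContDiff ℝ 2 fun x => f x ^ 2 :=
  hf.contDiff.pow 2

theorem hasCompactSupport_sq : HasCompactSupport fun x => f x ^ 2 :=
  hf.hasCompactSupport.comp_left (g := fun x => x ^ 2) (by simp)

theorem deriv_sq : deriv (fun x => f x ^ 2) = fun x => 2 * f x * deriv f x :=
  funext fun x => (hasDerivAt_sq_of_differentiable
    (hf.contDiff_one.differentiable one_ne_zero) x).deriv

/-- Both summands have manageable Cauchy transforms: that of `symMul f` is G², and f² is a smooth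
real density. This makes f G₋ accessible. -/
theorem mul_conj_bdry_eq (x : ℝ) :
    (f x : ℂ) * conj (bdry f x) =
      (1 / 2 : ℂ) * symMul f x + Complex.I * Real.pi * ((f x ^ 2 : ℝ) : ℂ) := by
  have hz : bdry f x = (bdry f x).re + (-(Real.pi * f x) : ℝ) * Complex.I := by
    rw [← bdry_im hf.contDiff_one hf.hasCompactSupport, Complex.re_add_im]
  rw [symMul, hz]
  simp only [map_add, map_mul, Complex.conj_ofReal, Complex.conj_I]
  push_cast
  ring

theorem hasDerivAt_mul_conj_bdry (x : ℝ) :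
    HasDerivAt (fun x => (f x : ℂ) * conj (bdry f x)) (conj (mulDeriv f x)) x := by
  have h := hasDerivAt_bdry hf.contDiff hf.hasCompactSupport x
  have h' : HasDerivAt (fun x => conj (bdry f x)) (conj (bdry (deriv f) x)) x := h.star
  refine ((hf.hasDerivAt_ofReal x).mul h').congr_deriv ?_
  simp [mulDeriv]

theorem contDiff_mul_conj_bdry : ContDiff ℝ 1 fun x => (f x : ℂ) * conj (bdry f x) :=
  (contDiff_ofReal_comp hf.contDiff_one).mul
    (Complex.conjCLE.contDiff.comp (contDiff_bdry hf.contDiff hf.hasCompactSupport))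

theorem cau_conj_mulDeriv {z : ℂ} (hz : z.im ≠ 0) :
    cau (fun x => conj (mulDeriv f x)) z =
      cau (fun t => (f t : ℂ)) z * cau (fun t => ((deriv f t : ℝ) : ℂ)) z +
        Complex.I * Real.pi * cau (fun t => ((deriv (fun x => f x ^ 2) t : ℝ) : ℂ)) z := by
  have hsq := hf.contDiff_sq.of_le one_le_two
  have i1 : Integrable fun x => deriv (symMul f) x / (z - x) := by
    simpa using integrable_div_sub_pow ((hf.contDiff_symMul.continuous_deriv
      le_rfl).integrable_of_hasCompactSupport hf.hasCompactSupport_symMul.deriv) hz 1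
  have i2 : Integrable fun x => ((deriv (fun x => f x ^ 2) x : ℝ) : ℂ) / (z - x) := by
    simpa using integrable_div_sub_pow (integrable_ofReal (contDiff_deriv hf.contDiff_sq)
      hf.hasCompactSupport_sq.deriv) hz 1
  have e : ∀ x, conj (mulDeriv f x) = (1 / 2 : ℂ) * deriv (symMul f) x +
      Complex.I * Real.pi * ((deriv (fun x => f x ^ 2) x : ℝ) : ℂ) := by
    intro x
    have h1 := ((hf.contDiff_symMul.differentiable one_ne_zero x).hasDerivAt.const_mul
      (1 / 2 : ℂ)).add
      ((hsq.differentiable one_ne_zero x).hasDerivAt.ofReal_comp.const_mul (Complex.I * Real.pi))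
    refine (hf.hasDerivAt_mul_conj_bdry x).unique (h1.congr_of_eventuallyEq ?_)
    exact Eventually.of_forall fun y => hf.mul_conj_bdry_eq y
  have h2 := hf.cau_deriv_symMul hz
  have h3 : cau (fun x => conj (mulDeriv f x)) z = (1 / 2 : ℂ) * cau (deriv (symMul f)) z +
      Complex.I * Real.pi * cau (fun t => ((deriv (fun x => f x ^ 2) t : ℝ) : ℂ)) z := by
    rw [cau, cau, cau, ← integral_const_mul, ← integral_const_mul,
      ← integral_add (i1.const_mul _) (i2.const_mul _)]
    congr 1 with x
    rw [e]
    ring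
  rw [h3, h2]
  ring

theorem tendsto_div_horiz (x : ℝ) :
    Tendsto (fun ε => (f x : ℂ) / horiz f ε x) (𝓝[>] 0) (𝓝 (f x / bdry f x)) := by
  by_cases hx : f x = 0
  · simp [hx]
  · exact tendsto_const_nhds.div (hf.tendsto_horiz x) (hf.bdry_ne_zero hx)

theorem logForm_mulDeriv_divDeriv :
    logForm (fun x => conj (mulDeriv f x)) (fun x => divDeriv f x + conj (divDeriv f x)) =
      -∫ x, ((f x : ℂ) / bdry f x + conj ((f x : ℂ) / bdry f x)) *
        (bdry f x * bdry (deriv f) x +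
          Complex.I * Real.pi * bdry (deriv fun x => f x ^ 2) x) := by
  obtain ⟨A, -, hA⟩ := hf.exists_support_bound
  obtain ⟨B, hB, b0, b1, b2⟩ := hf.exists_bounds A
  obtain ⟨C, fb⟩ := hf.exists_convFamily_div hA
  obtain ⟨C', hC', hC''⟩ := hf.exists_bound_by_horiz
  have hsq1 := contDiff_deriv hf.contDiff_sq
  have hsqc := hf.hasCompactSupport_sq.deriv
  obtain ⟨B', hB', b3⟩ := exists_bound_horiz hsq1 hsqc A
  have hd : deriv (fun x => (f x : ℂ) * conj (bdry f x)) = fun x => conj (mulDeriv f x) :=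
    funext fun x => (hf.hasDerivAt_mul_conj_bdry x).deriv
  have := ConvFamily.logForm_eq_neg_integral (A := A)
    (K := (C' * B + C' * B) * (B * B + 1 * Real.pi * B'))
    hf.contDiff_mul_conj_bdry (fun x hx => by simp [hA x hx]) (fb.add fb.conjugate)
    (q := fun x => ((f x : ℂ) / bdry f x + conj ((f x : ℂ) / bdry f x)) *
        (bdry f x * bdry (deriv f) x +
          Complex.I * Real.pi * bdry (deriv fun x => f x ^ 2) x)) (fun x => ?_) ?_
  · rwa [hd] at this
  · rw [hd]
    have l1 := hf.tendsto_div_horiz x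
    have l2 := hf.tendsto_horiz x
    have l3 := hf.tendsto_horiz_deriv x
    have l4 := FreeProb.tendsto_horiz hsq1 hsqc x
    refine ((l1.add ((Complex.continuous_conj.tendsto _).comp l1)).mul
      ((l2.mul l3).add (l4.const_mul (Complex.I * Real.pi)))).congr' ?_
    filter_upwards [self_mem_nhdsWithin] with ε hε
    rw [hf.cau_conj_mulDeriv (by simpa using ne_of_gt hε)]
    rfl
  · intro ε h0 h1 x hx
    rw [hd, hf.cau_conj_mulDeriv (by simpa using h0.ne'), norm_mul]
    have hpos := norm_pos_iff.2 (hf.horiz_ne_zero h0 h1 x)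
    have e1 : ‖(f x : ℂ) / horiz f ε x‖ ≤ C' * B := by
      rw [norm_div, Complex.norm_of_nonneg (hf.nonneg x), div_le_iff₀ hpos]
      refine (hC'' ε h0 h1 x).1.trans ?_
      have := (b2 ε h0 h1 x hx).1
      rw [sq, ← mul_assoc]
      gcongr
    obtain ⟨e2, e3⟩ := b2 ε h0 h1 x hx
    have e4 := b3 ε h0 h1 x hx
    rw [horiz] at e2 e3 e4
    have hpi : ‖(Real.pi : ℂ)‖ = Real.pi := Complex.norm_of_nonneg Real.pi_nonneg
    refine mul_le_mul ?_ ?_ (norm_nonneg _) (by positivity)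
    · refine (norm_add_le _ _).trans ?_
      rw [RCLike.norm_conj]
      exact add_le_add e1 e1
    · refine (norm_add_le _ _).trans ?_
      rw [norm_mul, norm_mul, norm_mul, Complex.norm_I, hpi]
      gcongr

/-- Conjugate symmetry exchanges the arguments and so brings the explicit function f G₋ into the
fixed slot required by `ConvFamily.logForm_eq_neg_integral`. The function `divDeriv f` plus its
conjugate is unchanged by conjugation. -/
theorem logForm_divDeriv_mulDeriv :
    logForm (fun x => divDeriv f x + conj (divDeriv f x)) (mulDeriv f) =
      conj (logForm (fun x => conj (mulDeriv f x)) (fun x => divDeriv f x + conj (divDeriv f x))) := by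
  obtain ⟨A, -, hA⟩ := hf.exists_support_bound
  obtain ⟨C₁, fa⟩ := hf.exists_convFamily_mul hA
  obtain ⟨C₂, fb⟩ := hf.exists_convFamily_div hA
  rw [← ConvFamily.logForm_conj fa.conjugate (fb.add fb.conjugate)]
  simp only [map_add, Complex.conj_conj]
  congr 1
  ext x
  ring

/-- The density of the entropy production term. -/
theorem integrable_div_bdry_mul {k : ℝ → ℂ} (hk : Continuous k) :
    Integrable fun x => (f x : ℂ) / bdry f x * k x := by
  obtain ⟨A, -, hA⟩ := hf.exists_support_bound
  have hb := continuous_bdry hf.contDiff_one hf.hasCompactSupport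
  have hi : Integrable ((Icc (-A) A).indicator fun x => Real.pi⁻¹ * ‖k x‖) :=
    (integrable_indicator_iff measurableSet_Icc).2
      ((continuous_const.mul hk.norm).integrableOn_Icc)
  refine Integrable.mono' hi ?_ (Eventually.of_forall fun x => ?_)
  · exact ((hf.continuous_ofReal.measurable.div hb.measurable).mul
      hk.measurable).aestronglyMeasurable
  · by_cases hx : x ∈ Icc (-A) A
    · rw [indicator_of_mem hx, norm_mul]
      gcongr
      by_cases h0 : f x = 0
      · simp [h0, Real.pi_nonneg]
      have hpos := norm_pos_iff.2 (hf.bdry_ne_zero h0)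
      rw [norm_div, Complex.norm_of_nonneg (hf.nonneg x), div_le_iff₀ hpos]
      have h1 := Complex.abs_im_le_norm (bdry f x)
      rw [bdry_im hf.contDiff_one hf.hasCompactSupport, abs_neg,
        abs_of_nonneg (mul_nonneg Real.pi_nonneg (hf.nonneg x))] at h1
      rw [← div_eq_inv_mul, le_div_iff₀ Real.pi_pos]
      linarith
    · rw [indicator_of_notMem hx, hA x (not_le.1 fun h' => hx (abs_le.1 h'))]
      simp

theorem deriv_hilbert : deriv (hilbert f) = hilbert (deriv f) :=
  funext fun x => (hasDerivAt_hilbert hf.contDiff hf.hasCompactSupport x).deriv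

theorem continuous_hilbert_deriv : Continuous (hilbert (deriv f)) :=
  FreeProb.continuous_hilbert hf.contDiff_deriv_one hf.hasCompactSupport.deriv

/-- Since f²/((Hf)² + f²) ≤ 1, the integrand is dominated by its numerator Hf f' − f (Hf)', which is
continuous with compact support. -/
theorem integrable_phase :
    Integrable fun x => (hilbert f x * deriv f x - f x * deriv (hilbert f) x) /
      (hilbert f x ^ 2 + f x ^ 2) * f x ^ 2 := by
  have hc := hf.contDiff.continuous
  have hc' := hf.contDiff_deriv_one.continuous
  have hh := hf.continuous_hilbert
  have hh' := hf.continuous_hilbert_deriv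
  rw [hf.deriv_hilbert]
  have hi : Integrable fun x => hilbert f x * deriv f x - f x * hilbert (deriv f) x :=
    ((hh.mul hc').sub (hc.mul hh')).integrable_of_hasCompactSupport
      (hf.hasCompactSupport.deriv.mul_left.sub hf.hasCompactSupport.mul_right)
  refine Integrable.mono' hi.norm ?_ (Eventually.of_forall fun x => ?_)
  · exact ((((hh.mul hc').sub (hc.mul hh')).measurable.div
      ((hh.pow 2).add (hc.pow 2)).measurable).mul (hc.pow 2).measurable).aestronglyMeasurable
  · have h1 : 0 ≤ hilbert f x ^ 2 + f x ^ 2 := by positivity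
    rw [div_mul_eq_mul_div, norm_div, norm_mul, Real.norm_of_nonneg h1, Real.norm_of_nonneg (sq_nonneg _)]
    refine div_le_of_le_mul₀ h1 (norm_nonneg _) ?_
    gcongr
    nlinarith [sq_nonneg (hilbert f x)]

/-- The limit of the singular part of the kernel. -/
theorem tendsto_singInt_total :
    Tendsto (fun ε => singInt f ε ε + singInt f (-ε) ε + singInt f ε (-ε) + singInt f (-ε) (-ε))
      (𝓝[>] 0) (𝓝 ((-(4 * Real.pi * ∫ x,
        (hilbert f x * deriv f x - f x * deriv (hilbert f) x) /
          (hilbert f x ^ 2 + f x ^ 2) * f x ^ 2) : ℝ) : ℂ)) := by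
  set E₀ : ℂ := ∫ x, (f x : ℂ) * bdry (deriv f) x with hE₀
  set E₁ : ℂ := ∫ x, ((f x : ℂ) / bdry f x + conj ((f x : ℂ) / bdry f x)) *
        (bdry f x * bdry (deriv f) x +
          Complex.I * Real.pi * bdry (deriv fun x => f x ^ 2) x) with hE₁
  have h1 := hf.tendsto_singInt_sum
  rw [hf.logForm_symMul_divDeriv, hf.logForm_divDeriv_mulDeriv, hf.logForm_mulDeriv_divDeriv,
    hf.logForm_deriv_deriv, integral_const_mul, ← hE₀, ← hE₁] at h1
  -- The two remaining height pairs are the negatives of the first two, so they contribute the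
  -- complex conjugate.
  have h2 := h1.add ((Complex.continuous_conj.tendsto _).comp h1)
  have hb := continuous_bdry hf.contDiff_one hf.hasCompactSupport
  have hb' := continuous_bdry hf.contDiff_deriv_one hf.hasCompactSupport.deriv
  have hsq1 := contDiff_deriv hf.contDiff_sq
  have hsqc := hf.hasCompactSupport_sq.deriv
  have hbs := continuous_bdry hsq1 hsqc
  have hk : Continuous fun x => bdry f x * bdry (deriv f) x +
      Complex.I * Real.pi * bdry (deriv fun x => f x ^ 2) x := by fun_prop
  have i0 : Integrable fun x => (f x : ℂ) * bdry (deriv f) x :=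
    (hf.continuous_ofReal.mul hb').integrable_of_hasCompactSupport (hf.hasCompactSupport_mul_right _)
  have i1 : Integrable fun x => ((f x : ℂ) / bdry f x + conj ((f x : ℂ) / bdry f x)) *
        (bdry f x * bdry (deriv f) x +
          Complex.I * Real.pi * bdry (deriv fun x => f x ^ 2) x) := by
    have j1 := hf.integrable_div_bdry_mul hk
    have j2 := hf.integrable_div_bdry_mul (Complex.continuous_conj.comp hk)
    have j3 : Integrable fun x => conj ((f x : ℂ) / bdry f x *
        conj (bdry f x * bdry (deriv f) x +
          Complex.I * Real.pi * bdry (deriv fun x => f x ^ 2) x)) :=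
      (LinearIsometryEquiv.integrable_comp_iff Complex.conjLIE).2 j2
    refine (j1.add j3).congr (Eventually.of_forall fun x => ?_)
    simp only [Pi.add_apply, map_mul (starRingEnd ℂ) ((f x : ℂ) / bdry f x), Complex.conj_conj]
    ring
  have r0 : E₀.re = ∫ x, ((f x : ℂ) * bdry (deriv f) x).re := (integral_re i0).symm
  have r1 : E₁.re = ∫ x, (((f x : ℂ) / bdry f x + conj ((f x : ℂ) / bdry f x)) *
        (bdry f x * bdry (deriv f) x +
          Complex.I * Real.pi * bdry (deriv fun x => f x ^ 2) x)).re := (integral_re i1).symm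
  have hfin : 4 * E₀.re - 2 * E₁.re = -(4 * Real.pi * ∫ x,
        (hilbert f x * deriv f x - f x * deriv (hilbert f) x) /
          (hilbert f x ^ 2 + f x ^ 2) * f x ^ 2) := by
    rw [r0, r1, ← integral_const_mul, ← integral_const_mul, ← integral_const_mul, ← integral_neg,
      ← integral_sub (by exact i0.re.const_mul 4) (by exact i1.re.const_mul 2)]
    congr 1 with x
    rw [hf.deriv_hilbert]
    have hre := bdry_re hf.contDiff_one hf.hasCompactSupport x
    have him := bdry_im hf.contDiff_one hf.hasCompactSupport x
    have hre' := bdry_re hf.contDiff_deriv_one hf.hasCompactSupport.deriv x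
    have him' := bdry_im hf.contDiff_deriv_one hf.hasCompactSupport.deriv x
    have hims := bdry_im hsq1 hsqc x
    rw [hf.deriv_sq] at hims ⊢
    by_cases hx : f x = 0
    · simp [hx]
    have hden : hilbert f x ^ 2 + f x ^ 2 ≠ 0 := by positivity
    have hpi := Real.pi_ne_zero
    -- This factor is real, so only the imaginary part −π f² type term of the transform of (f²)'
    -- enters; the Hilbert transform of (f²)' drops out.
    have hv : (f x : ℂ) / bdry f x + conj ((f x : ℂ) / bdry f x) =
        ((2 * (f x * (Real.pi * hilbert f x) /
          (Real.pi ^ 2 * (hilbert f x ^ 2 + f x ^ 2))) : ℝ) : ℂ) := by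
      rw [Complex.add_conj, Complex.div_re, Complex.normSq_apply, hre, him]
      congr 2
      simp only [Complex.ofReal_re, Complex.ofReal_im, zero_mul, zero_div, add_zero]
      congr 1
      ring
    rw [hv, Complex.re_ofReal_mul, Complex.re_ofReal_mul]
    simp only [Complex.add_re, Complex.mul_re, Complex.mul_im, Complex.I_re, Complex.I_im,
      Complex.ofReal_re, Complex.ofReal_im, hre, him, hre', him', hims]
    field_simp
    ring
  have hcomplex : -(2 * E₀) + conj (-E₁) - 4 * -E₀ + conj (-(2 * E₀) + conj (-E₁) - 4 * -E₀) =
      ((4 * E₀.re - 2 * E₁.re : ℝ) : ℂ) := by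
    rw [Complex.add_conj]
    congr 1
    simp
    ring
  rw [hcomplex, hfin] at h2
  refine h2.congr fun ε => ?_
  have e1 := singInt_neg f ε ε
  have e2 := singInt_neg f (-ε) ε
  rw [neg_neg] at e2
  simp only [Function.comp_apply, map_add]
  rw [← e1, ← e2]
  ring

end IsSmoothDensity

/-! ### The kernel -/

namespace IsSmoothDensity

variable {f : ℝ → ℝ} (hf : IsSmoothDensity f)

include hf

theorem kernelK_eq {z w : ℂ} (hz : z.im ≠ 0) (hw : w.im ≠ 0) :
    kernelK (cau fun t => (f t : ℂ)) z w =
      divDiff f z w ^ 2 / (cau (fun t => (f t : ℂ)) z * cau (fun t => (f t : ℂ)) w) +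
        2 * divDiff f z w + cau (fun t => (f t : ℂ)) z * cau (fun t => (f t : ℂ)) w := by
  have hne : ∀ {z : ℂ}, z.im ≠ 0 → cau (fun t => (f t : ℂ)) z ≠ 0 := by
    intro z hz
    have := hf.horiz_ne_zero' hz z.re
    rwa [horiz, Complex.re_add_im] at this
  have h1 := hne hz
  have h2 := hne hw
  rw [kernelK, dslope_cau hf.integrable_complex hz hw]
  field_simp
  ring

theorem kernelK_horiz {s t : ℝ} (hs : s ≠ 0) (ht : t ≠ 0) (x y : ℝ) :
    kernelK (cau fun t => (f t : ℂ)) (x + s * Complex.I) (y + t * Complex.I) =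
      divDiff f (x + s * Complex.I) (y + t * Complex.I) ^ 2 / (horiz f s x * horiz f t y) +
        2 * divDiff f (x + s * Complex.I) (y + t * Complex.I) + horiz f s x * horiz f t y :=
  hf.kernelK_eq (by simpa using hs) (by simpa using ht)

theorem continuous_kernelK {s t : ℝ} (hs : s ≠ 0) (ht : t ≠ 0) :
    Continuous fun p : ℝ × ℝ =>
      kernelK (cau fun t => (f t : ℂ)) (p.1 + s * Complex.I) (p.2 + t * Complex.I) := by
  simp only [hf.kernelK_horiz hs ht]
  exact ((hf.continuous_singInt_kernel hs ht).add
    (continuous_const.mul (hf.continuous_divDiff hs ht))).add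
    (((hf.continuous_horiz hs).comp continuous_fst).mul
      ((hf.continuous_horiz ht).comp continuous_snd))

/-- Expanding the square in K separates the singular term, a multiple of the difference quotient,
and a product of two one-variable integrals. -/
theorem integral_kernelK {s t : ℝ} (hs : s ≠ 0) (ht : t ≠ 0) :
    ∫ x : ℝ, ∫ y : ℝ, (f x : ℂ) * f y *
        kernelK (cau fun t => (f t : ℂ)) (x + s * Complex.I) (y + t * Complex.I) =
      singInt f s t + -(2 * ∫ r : ℝ, (f r : ℂ) * (horiz f (-s) r * horiz f (-t) r)) +
        (∫ x, (f x : ℂ) * horiz f s x) * ∫ x, (f x : ℂ) * horiz f t x := by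
  have c1 := hf.continuous_singInt_kernel hs ht
  have c2 := hf.continuous_divDiff hs ht
  have c3 : Continuous fun p : ℝ × ℝ => horiz f s p.1 * horiz f t p.2 :=
    ((hf.continuous_horiz hs).comp continuous_fst).mul
      ((hf.continuous_horiz ht).comp continuous_snd)
  have i1 := hf.integrable_of_continuous c1
  have i2 := hf.integrable_of_continuous c2
  have i3 := hf.integrable_of_continuous c3
  have e2 := hf.integral_integral_divDiff hs ht
  rw [← integral_prod (fun p : ℝ × ℝ => (f p.1 : ℂ) * f p.2 *
    divDiff f (p.1 + s * Complex.I) (p.2 + t * Complex.I)) i2, ← Measure.volume_eq_prod] at e2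
  have e3 : (∫ x, (f x : ℂ) * horiz f s x) * ∫ x, (f x : ℂ) * horiz f t x =
      ∫ p : ℝ × ℝ, (f p.1 : ℂ) * f p.2 * (horiz f s p.1 * horiz f t p.2) := by
    rw [← integral_prod_mul, ← Measure.volume_eq_prod]
    congr 1 with p
    ring
  rw [← mul_neg, ← e2, e3, hf.singInt_eq_integral_prod hs ht, ← integral_const_mul,
    ← integral_add i1 (i2.const_mul 2), ← integral_add (by exact i1.add (i2.const_mul 2)) i3,
    ← integral_prod (fun p : ℝ × ℝ => (f p.1 : ℂ) * f p.2 *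
      kernelK (cau fun t => (f t : ℂ)) (p.1 + s * Complex.I) (p.2 + t * Complex.I))
      (hf.integrable_of_continuous (hf.continuous_kernelK hs ht)), ← Measure.volume_eq_prod]
  congr 1 with p
  rw [hf.kernelK_horiz hs ht]
  ring

/-- The limit of the regular part of the kernel. -/
theorem tendsto_integral_mul_sq_horiz :
    Tendsto (fun ε => ∫ r : ℝ, (f r : ℂ) * (horiz f ε r + horiz f (-ε) r) ^ 2) (𝓝[>] 0)
      (𝓝 ((4 * Real.pi ^ 2 / 3 * ∫ x, f x ^ 3 : ℝ) : ℂ)) := by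
  obtain ⟨A, -, hA⟩ := hf.exists_support_bound
  obtain ⟨B, hB, b0, b1, b2⟩ := hf.exists_bounds A
  have h : Tendsto (fun ε => ∫ r : ℝ, (f r : ℂ) * (horiz f ε r + horiz f (-ε) r) ^ 2) (𝓝[>] 0)
      (𝓝 (∫ r : ℝ, (f r : ℂ) * (bdry f r + conj (bdry f r)) ^ 2)) := by
    simp only [horiz_neg]
    refine tendsto_integral_of_bounded (A := A) (C := B * (B + B) ^ 2) ?_ ?_ ?_ ?_
    · filter_upwards [self_mem_nhdsWithin] with ε hε
      have hc := hf.continuous_horiz (ne_of_gt hε)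
      exact (hf.continuous_ofReal.mul
        ((hc.add (Complex.continuous_conj.comp hc)).pow 2)).aestronglyMeasurable
    · exact Eventually.of_forall fun ε x hx => by simp [hA x hx]
    · filter_upwards [Ioc_mem_nhdsGT one_pos] with ε hε x hx
      rw [norm_mul, norm_pow, Complex.norm_of_nonneg (hf.nonneg x)]
      have e1 := (b2 ε hε.1 hε.2 x hx).1
      have e2 := b0 x
      have e3 : ‖horiz f ε x + conj (horiz f ε x)‖ ≤ B + B := by
        refine (norm_add_le _ _).trans ?_
        rw [RCLike.norm_conj]
        linarith
      gcongr
    · intro x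
      have h := hf.tendsto_horiz x
      exact ((h.add ((Complex.continuous_conj.tendsto _).comp h)).pow 2).const_mul _
  convert h using 2
  have e : ∀ r : ℝ, (f r : ℂ) * (bdry f r + conj (bdry f r)) ^ 2 =
      ((4 * Real.pi ^ 2 * (f r * hilbert f r ^ 2) : ℝ) : ℂ) := by
    intro r
    rw [Complex.add_conj, bdry_re hf.contDiff_one hf.hasCompactSupport]
    push_cast
    ring
  simp_rw [e]
  rw [integral_complex_ofReal, integral_const_mul, ← hf.integral_mul_hilbert_sq]
  congr 1
  ring

/-- In the sum over signs the products of one-variable integrals cancel by `integral_mul_horiz_neg`,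
and the four regular terms complete the square (G₊ + G₋)² at height ε. -/
theorem tendsto_kernel_sum :
    Tendsto (fun ε : ℝ => ∑ α ∈ ({-1, 1} : Finset ℝ), ∑ β ∈ ({-1, 1} : Finset ℝ),
        ∫ x : ℝ, ∫ y : ℝ, (f x : ℂ) * (f y : ℂ) *
          kernelK (cau fun t => (f t : ℂ))
            ((x : ℂ) + Complex.I * (α : ℂ) * (ε : ℂ)) ((y : ℂ) + Complex.I * (β : ℂ) * (ε : ℂ)))
      (𝓝[>] 0)
      (𝓝 ((-(8 * Real.pi ^ 2 / 3 * (∫ x, f x ^ 3)) -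
        4 * Real.pi * ∫ x,
          (hilbert f x * deriv f x - f x * deriv (hilbert f) x) /
            (hilbert f x ^ 2 + f x ^ 2) * f x ^ 2 : ℝ) : ℂ)) := by
  have h := hf.tendsto_singInt_total.sub (hf.tendsto_integral_mul_sq_horiz.const_mul 2)
  have e : ∀ a b : ℝ, ((-b : ℝ) : ℂ) - 2 * ((4 * Real.pi ^ 2 / 3 * a : ℝ) : ℂ) =
      ((-(8 * Real.pi ^ 2 / 3 * a) - b : ℝ) : ℂ) := by
    intro a b
    push_cast
    ring
  rw [e] at h
  refine h.congr' ?_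
  filter_upwards [self_mem_nhdsWithin] with ε hε
  have hε' : ε ≠ 0 := ne_of_gt hε
  have hne : (-1 : ℝ) ≠ 1 := by norm_num
  have a1 : ∀ x : ℝ, (x : ℂ) + Complex.I * ((1 : ℝ) : ℂ) * (ε : ℂ) = x + ε * Complex.I := by
    intro x
    push_cast
    ring
  have a2 : ∀ x : ℝ, (x : ℂ) + Complex.I * ((-1 : ℝ) : ℂ) * (ε : ℂ) =
      x + (-ε : ℝ) * Complex.I := by
    intro x
    push_cast
    ring
  have hε'' := neg_ne_zero.2 hε'
  simp only [Finset.sum_pair hne, a1, a2]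
  rw [hf.integral_kernelK hε' hε', hf.integral_kernelK hε' hε'', hf.integral_kernelK hε'' hε',
    hf.integral_kernelK hε'' hε'', hf.integral_mul_horiz_neg hε']
  have hi : ∀ {s t : ℝ}, s ≠ 0 → t ≠ 0 → Integrable fun r : ℝ =>
      (f r : ℂ) * (horiz f s r * horiz f t r) := fun hs ht =>
    (hf.continuous_ofReal.mul ((hf.continuous_horiz hs).mul
      (hf.continuous_horiz ht))).integrable_of_hasCompactSupport (hf.hasCompactSupport_mul_right _)
  have hexp : ∫ r : ℝ, (f r : ℂ) * (horiz f ε r + horiz f (-ε) r) ^ 2 =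
      (∫ r : ℝ, (f r : ℂ) * (horiz f ε r * horiz f ε r)) +
      (∫ r : ℝ, (f r : ℂ) * (horiz f ε r * horiz f (-ε) r)) +
      (∫ r : ℝ, (f r : ℂ) * (horiz f (-ε) r * horiz f ε r)) +
      (∫ r : ℝ, (f r : ℂ) * (horiz f (-ε) r * horiz f (-ε) r)) := by
    rw [← integral_add (hi hε' hε') (hi hε' hε''),
      ← integral_add (by exact (hi hε' hε').add (hi hε' hε'')) (hi hε'' hε'),
      ← integral_add (by exact ((hi hε' hε').add (hi hε' hε'')).add (hi hε'' hε')) (hi hε'' hε'')]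
    congr 1 with r
    ring
  rw [hexp, neg_neg]
  ring

theorem integrable_kernelK {ε α β : ℝ} (hε : 0 < ε) (hα : α ∈ ({-1, 1} : Finset ℝ))
    (hβ : β ∈ ({-1, 1} : Finset ℝ)) :
    Integrable fun p : ℝ × ℝ => (f p.1 : ℂ) * (f p.2 : ℂ) *
      kernelK (cau fun t => (f t : ℂ)) ((p.1 : ℂ) + Complex.I * (α : ℂ) * (ε : ℂ))
        ((p.2 : ℂ) + Complex.I * (β : ℂ) * (ε : ℂ)) := by
  have hne : ∀ {α : ℝ}, α ∈ ({-1, 1} : Finset ℝ) → α * ε ≠ 0 := by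
    intro α h
    simp only [Finset.mem_insert, Finset.mem_singleton] at h
    rcases h with rfl | rfl <;> simp [hε.ne']
  have e : ∀ (x α : ℝ), (x : ℂ) + Complex.I * (α : ℂ) * (ε : ℂ) =
      x + (α * ε : ℝ) * Complex.I := by
    intro x α
    push_cast
    ring
  simp only [e]
  exact hf.integrable_of_continuous (hf.continuous_kernelK (hne hα) (hne hβ))

/-- The kernel is positive semi-definite: it is the Hadamard square of a covariance matrix, scaled
by the reciprocals of the Cauchy transform. -/
theorem kernelK_posSemidef (n : ℕ) (z c : Fin n → ℂ) (hz : ∀ j, (z j).im ≠ 0) :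
    0 ≤ ∑ j, ∑ l, c j * conj (c l) *
      kernelK (cau fun t => (f t : ℂ)) (z j) (conj (z l)) := by
  set G : ℂ → ℂ := cau fun t => (f t : ℂ) with hG
  -- These are the resolvent functions centred at their means under f dt, so V below is their
  -- covariance matrix.
  set φ : Fin n → ℝ → ℂ := fun j t => (z j - t)⁻¹ - G (z j) with hφ
  have hone : ∫ t, (f t : ℂ) = 1 := by
    rw [integral_complex_ofReal, hf.integral_eq_one, Complex.ofReal_one]
  have hcz : ∀ j, (conj (z j)).im ≠ 0 := fun j => by simpa using hz j
  have hGc : ∀ j, G (conj (z j)) = conj (G (z j)) := fun j => cau_ofReal_conj f (z j)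
  have hi1 : ∀ {w : ℂ}, w.im ≠ 0 → Integrable fun t : ℝ => (f t : ℂ) * (w - t)⁻¹ := by
    intro w hw
    simpa [div_eq_mul_inv] using integrable_div_sub_pow hf.integrable_complex hw 1
  have hint : ∀ j l, Integrable fun t => (f t : ℂ) * (φ j t * conj (φ l t)) := by
    intro j l
    have j1 := integrable_div_mul hf.integrable_complex (hz j) (hcz l)
    have j2 := (hi1 (hz j)).mul_const (conj (G (z l)))
    have j3 := (hi1 (hcz l)).mul_const (G (z j))
    have j4 := hf.integrable_complex.mul_const (G (z j) * conj (G (z l)))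
    refine (((j1.sub j2).sub j3).add j4).congr (Eventually.of_forall fun t => ?_)
    simp only [hφ, Pi.add_apply, Pi.sub_apply, map_sub, map_inv₀, Complex.conj_ofReal,
      div_eq_mul_inv, mul_inv]
    ring
  set V : Matrix (Fin n) (Fin n) ℂ := fun j l => ∫ t, (f t : ℂ) * (φ j t * conj (φ l t)) with hV
  have hVeq : ∀ j l, V j l = -(divDiff f (z j) (conj (z l)) + G (z j) * G (conj (z l))) := by
    intro j l
    have j1 := integrable_div_mul hf.integrable_complex (hz j) (hcz l)
    have j2 := (hi1 (hz j)).mul_const (conj (G (z l)))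
    have j3 := (hi1 (hcz l)).mul_const (G (z j))
    have j4 := hf.integrable_complex.mul_const (G (z j) * conj (G (z l)))
    have e : V j l = ∫ t, ((f t : ℂ) / ((z j - t) * (conj (z l) - t)) -
        (f t : ℂ) * (z j - t)⁻¹ * conj (G (z l)) - (f t : ℂ) * (conj (z l) - t)⁻¹ * G (z j) +
        (f t : ℂ) * (G (z j) * conj (G (z l)))) := by
      simp only [hV]
      congr 1 with t
      simp only [hφ, map_sub, map_inv₀, Complex.conj_ofReal, div_eq_mul_inv, mul_inv]
      ring
    have hcau : ∀ w : ℂ, ∫ t : ℝ, (f t : ℂ) * (w - t)⁻¹ = G w := fun w => by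
      simp [hG, cau, div_eq_mul_inv]
    rw [e, integral_add (by exact (j1.sub j2).sub j3) j4, integral_sub (by exact j1.sub j2) j3,
      integral_sub j1 j2, integral_mul_const, integral_mul_const, integral_mul_const, hone, hcau,
      hcau, hGc, divDiff]
    ring
  have hVpos : V.PosSemidef := by
    refine Matrix.PosSemidef.of_dotProduct_mulVec_nonneg ?_ fun x => ?_
    · ext j l
      rw [Matrix.conjTranspose_apply]
      change conj (V l j) = V j l
      simp only [hV]
      rw [← integral_conj]
      congr 1 with t
      simp only [map_mul, Complex.conj_ofReal, Complex.conj_conj]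
      ring
    · have e : star x ⬝ᵥ V.mulVec x =
          ∫ t, (f t : ℂ) * ((∑ j, conj (x j) * φ j t) * conj (∑ j, conj (x j) * φ j t)) := by
        have e1 : ∀ t, (f t : ℂ) * ((∑ j, conj (x j) * φ j t) * conj (∑ j, conj (x j) * φ j t)) =
            ∑ j, ∑ l, (conj (x j) * x l) * ((f t : ℂ) * (φ j t * conj (φ l t))) := by
          intro t
          rw [map_sum, Finset.sum_mul_sum, Finset.mul_sum]
          refine Finset.sum_congr rfl fun j _ => ?_
          rw [Finset.mul_sum]
          refine Finset.sum_congr rfl fun l _ => ?_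
          rw [map_mul, Complex.conj_conj]
          ring
        simp_rw [e1]
        rw [integral_finsetSum _ fun j _ => integrable_finsetSum _ fun l _ =>
          (hint j l).const_mul _]
        simp only [dotProduct, Matrix.mulVec, Finset.mul_sum]
        refine Finset.sum_congr rfl fun j _ => ?_
        rw [integral_finsetSum _ fun l _ => (hint j l).const_mul _]
        refine Finset.sum_congr rfl fun l _ => ?_
        rw [integral_const_mul]
        simp only [hV, Pi.star_apply, RCLike.star_def]
        ring
      rw [e]
      have e2 : ∀ t, (f t : ℂ) * ((∑ j, conj (x j) * φ j t) * conj (∑ j, conj (x j) * φ j t)) =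
          ((f t * Complex.normSq (∑ j, conj (x j) * φ j t) : ℝ) : ℂ) := by
        intro t
        rw [Complex.mul_conj]
        push_cast
        rfl
      simp_rw [e2]
      rw [integral_complex_ofReal]
      exact_mod_cast integral_nonneg fun t => mul_nonneg (hf.nonneg t) (Complex.normSq_nonneg _)
  -- Schur product theorem. The minus sign in `hVeq` disappears on squaring, and the test vector
  -- absorbs the factors 1/G(z_j).
  have key := (hVpos.hadamard hVpos).dotProduct_mulVec_nonneg fun j => conj (c j / G (z j))
  convert key using 1
  simp only [dotProduct, Matrix.mulVec, Finset.mul_sum, Matrix.hadamard_apply, Pi.star_apply,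
    RCLike.star_def, Complex.conj_conj]
  refine Finset.sum_congr rfl fun j _ => Finset.sum_congr rfl fun l _ => ?_
  rw [hVeq, kernelK, dslope_cau hf.integrable_complex (hz j) (hcz l), hGc, map_div₀]
  ring

end IsSmoothDensity

/-! ### The Cauchy transform at infinity and the R-transform -/

theorem cauchyTransform_eq_neg_resolventTransform (ν : Measure ℝ) :
    cauchyTransform ν = fun z => -resolventTransform ν z := by
  ext z
  rw [cauchyTransform, resolventTransform_apply, ← integral_neg]
  congr 1 with x
  rw [resolvent, Ring.inverse_eq_inv', ← inv_neg, neg_sub]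
  rfl

theorem differentiableAt_cauchyTransform (ν : Measure ℝ) [IsFiniteMeasure ν] {z : ℂ}
    (hz : ∀ x ∈ ν.support, (x : ℂ) ≠ z) : DifferentiableAt ℂ (cauchyTransform ν) z := by
  rw [cauchyTransform_eq_neg_resolventTransform]
  refine (hasDerivAt_resolventTransform z ?_).differentiableAt.fun_neg
  rintro ⟨x, hx, rfl⟩
  exact hz x hx rfl

theorem differentiableAt_cauchyTransform_of_im_ne_zero (ν : Measure ℝ) [IsFiniteMeasure ν] {z : ℂ}
    (hz : z.im ≠ 0) : DifferentiableAt ℂ (cauchyTransform ν) z := by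
  refine differentiableAt_cauchyTransform ν fun x _ h => hz ?_
  rw [← h, Complex.ofReal_im]

/-- The Cauchy transform in the coordinate `s = z⁻¹` at infinity. -/
def invCauchy (ν : Measure ℝ) (s : ℂ) : ℂ :=
  s * ∫ x : ℝ, (1 - s * x)⁻¹ ∂ν

theorem invCauchy_inv (ν : Measure ℝ) {z : ℂ} (hz : z ≠ 0) :
    invCauchy ν z⁻¹ = cauchyTransform ν z := by
  rw [invCauchy, cauchyTransform, ← integral_const_mul]
  congr 1 with x
  rw [← mul_inv]
  congr 1
  field_simp

theorem exists_abs_le_of_isCompact_support {ν : Measure ℝ} (hν : IsCompact ν.support) :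
    ∃ A, 0 < A ∧ ∀ x ∈ ν.support, |x| ≤ A :=
  hν.isBounded.exists_pos_norm_le

theorem half_le_norm_one_sub {s : ℂ} {x A : ℝ} (hA : 0 < A) (hs : ‖s‖ ≤ 1 / (2 * A))
    (hx : |x| ≤ A) : 1 / 2 ≤ ‖1 - s * x‖ := by
  have h1 : ‖s * x‖ ≤ 1 / 2 := by
    rw [norm_mul, Complex.norm_real, Real.norm_eq_abs]
    calc ‖s‖ * |x| ≤ 1 / (2 * A) * A := by gcongr
      _ = 1 / 2 := by field_simp
  have h2 := norm_sub_norm_le (1 : ℂ) (s * x)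
  rw [norm_one] at h2
  linarith

section compactSupport

variable {ν : Measure ℝ} [IsProbabilityMeasure ν] (hν : IsCompact ν.support)

include hν

theorem continuousAt_integral_inv_one_sub :
    ContinuousAt (fun s : ℂ => ∫ x : ℝ, (1 - s * x)⁻¹ ∂ν) 0 := by
  obtain ⟨A, hA, hsupp⟩ := exists_abs_le_of_isCompact_support hν
  refine continuousAt_of_dominated (bound := fun _ => 2) ?_ ?_ (integrable_const _) ?_
  · exact Eventually.of_forall fun s => Measurable.aestronglyMeasurable (by fun_prop)
  · filter_upwards [Metric.ball_mem_nhds (0 : ℂ) (by positivity : 0 < 1 / (2 * A))] with s hs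
    filter_upwards [Measure.support_mem_ae] with x hx
    rw [norm_inv]
    refine inv_le_of_inv_le₀ two_pos ?_
    have := half_le_norm_one_sub hA (mem_ball_zero_iff.1 hs).le (hsupp x hx)
    simpa using this
  · refine Eventually.of_forall fun x => ?_
    refine ContinuousAt.inv₀ (by fun_prop) (by simp)

/-- A removable singularity: for small s ≠ 0 the function is s⁻¹ G(s⁻¹), holomorphic because s⁻¹
avoids the compact support, and it is continuous at 0. -/
theorem analyticAt_integral_inv_one_sub :
    AnalyticAt ℂ (fun s : ℂ => ∫ x : ℝ, (1 - s * x)⁻¹ ∂ν) 0 := by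
  refine Complex.analyticAt_of_differentiable_on_punctured_nhds_of_continuousAt ?_
    (continuousAt_integral_inv_one_sub hν)
  obtain ⟨A, hA, hsupp⟩ := exists_abs_le_of_isCompact_support hν
  have hball : ∀ᶠ s in 𝓝 (0 : ℂ), ‖s‖ < 1 / (2 * A) := by
    filter_upwards [Metric.ball_mem_nhds (0 : ℂ) (by positivity : 0 < 1 / (2 * A))] with s hs
    exact mem_ball_zero_iff.1 hs
  filter_upwards [hball.filter_mono nhdsWithin_le_nhds, self_mem_nhdsWithin] with s hs hs0
  have hs0 : s ≠ 0 := hs0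
  have hd : DifferentiableAt ℂ (fun s => s⁻¹ * cauchyTransform ν s⁻¹) s := by
    have hG : DifferentiableAt ℂ (cauchyTransform ν) s⁻¹ := by
      refine differentiableAt_cauchyTransform ν fun x hx h => ?_
      have h1 := half_le_norm_one_sub hA hs.le (hsupp x hx)
      rw [h, mul_inv_cancel₀ hs0, sub_self, norm_zero] at h1
      norm_num at h1
    have hi : DifferentiableAt ℂ (fun s : ℂ => s⁻¹) s := differentiableAt_inv hs0
    exact hi.fun_mul (DifferentiableAt.fun_comp' s hG hi)
  refine hd.congr_of_eventuallyEq ?_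
  filter_upwards [isOpen_ne.mem_nhds hs0] with w hw
  have hw : w ≠ 0 := hw
  rw [← invCauchy_inv ν (inv_ne_zero hw), inv_inv, invCauchy, inv_mul_cancel_left₀ hw]

theorem analyticAt_invCauchy : AnalyticAt ℂ (invCauchy ν) 0 :=
  analyticAt_id.mul (analyticAt_integral_inv_one_sub hν)

omit hν in
theorem invCauchy_zero : invCauchy ν 0 = 0 := by
  simp [invCauchy]

theorem hasStrictDerivAt_invCauchy : HasStrictDerivAt (invCauchy ν) 1 0 := by
  have h := ((hasDerivAt_id (0 : ℂ)).fun_mul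
    (analyticAt_integral_inv_one_sub hν).differentiableAt.hasDerivAt).deriv
  have h' : deriv (invCauchy ν) 0 = 1 := by
    refine h.trans ?_
    simp
  rw [← h']
  exact (analyticAt_invCauchy hν).hasStrictDerivAt

theorem tendsto_cauchyTransform_cobounded :
    Tendsto (cauchyTransform ν) (Bornology.cobounded ℂ) (𝓝 0) := by
  have h := (analyticAt_invCauchy hν).continuousAt.tendsto.comp
    (tendsto_inv₀_cobounded (α := ℂ))
  rw [invCauchy_zero] at h
  refine h.congr' ?_
  filter_upwards [Bornology.eventually_ne_cobounded (0 : ℂ)] with z hz using invCauchy_inv ν hz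

/-- Near `0` the map `s ↦ G_ν(1/s)` has an analytic inverse. -/
theorem exists_inverse_invCauchy : ∃ ψ : ℂ → ℂ, AnalyticAt ℂ ψ 0 ∧ ψ 0 = 0 ∧ deriv ψ 0 = 1 ∧
    (∀ᶠ s in 𝓝 0, ψ (invCauchy ν s) = s) ∧ ∀ᶠ s in 𝓝 0, invCauchy ν (ψ s) = s := by
  have hs := hasStrictDerivAt_invCauchy hν
  have hF := hs.hasStrictFDerivAt_equiv one_ne_zero
  have hψd := hs.to_localInverse one_ne_zero
  refine ⟨hs.localInverse _ _ _ one_ne_zero, ?_, ?_, ?_, ?_, ?_⟩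
  · have hc : ContDiffAt ℂ ⊤ (invCauchy ν) 0 := (analyticAt_invCauchy hν).contDiffAt
    have := hc.to_localInverse hF.hasFDerivAt (by simp)
    rw [invCauchy_zero] at this
    exact this.analyticAt
  · have := hF.localInverse_apply_image
    rwa [invCauchy_zero] at this
  · rw [invCauchy_zero, inv_one] at hψd
    exact hψd.hasDerivAt.deriv
  · exact hF.eventually_left_inverse
  · have := hF.eventually_right_inverse
    rwa [invCauchy_zero] at this

/-- If ψ is the local inverse of s ↦ G(1/s), the defining relation forces R(s) = 1/ψ(s) − 1/s off 0.
The singularity is removable since ψ(0) = 0 and ψ'(0) = 1, and the germ is unique by the identity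
theorem. -/
theorem exists_isRTransform : ∃ R₀ : ℂ → ℂ, IsRTransform ν R₀ ∧
    ∀ R, IsRTransform ν R → R =ᶠ[𝓝 0] R₀ := by
  obtain ⟨ψ, hψ, hψ0, hψ1, hl, hr⟩ := exists_inverse_invCauchy hν
  obtain ⟨R₀, hR₀, hRψ⟩ : ∃ R₀ : ℂ → ℂ, AnalyticAt ℂ R₀ 0 ∧
      ∀ᶠ s in 𝓝[≠] (0 : ℂ), R₀ s = (ψ s)⁻¹ - s⁻¹ := by
    have hχ : AnalyticAt ℂ (dslope ψ 0) 0 := by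
      obtain ⟨p, hp⟩ := hψ
      exact ⟨_, hp.has_fpower_series_dslope_fslope⟩
    have hχ0 : dslope ψ 0 0 = 1 := by rw [dslope_same, hψ1]
    have hinv : AnalyticAt ℂ (fun s => (dslope ψ 0 s)⁻¹) 0 := hχ.inv (by rw [hχ0]; exact one_ne_zero)
    -- The function s/ψ(s) is analytic with value 1 at 0, so its difference quotient at 0 is 1/ψ(s)
    -- − 1/s off 0.
    refine ⟨dslope (fun s => (dslope ψ 0 s)⁻¹) 0, ?_, ?_⟩
    · obtain ⟨p, hp⟩ := hinv
      exact ⟨_, hp.has_fpower_series_dslope_fslope⟩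
    · have hne : ∀ᶠ s in 𝓝 (0 : ℂ), dslope ψ 0 s ≠ 0 :=
        hχ.continuousAt.eventually_ne (by rw [hχ0]; exact one_ne_zero)
      filter_upwards [self_mem_nhdsWithin, hne.filter_mono nhdsWithin_le_nhds] with s hs hs1
      have hs : s ≠ 0 := hs
      have e := dslope_of_ne ψ hs
      rw [slope_def_field, hψ0, sub_zero, sub_zero] at e
      rw [dslope_of_ne _ hs, slope_def_field, hχ0, e, inv_one, sub_zero]
      have : ψ s ≠ 0 := by
        intro h
        rw [e, h, zero_div] at hs1
        exact hs1 rfl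
      field_simp
  have hψne : ∀ᶠ s in 𝓝[≠] (0 : ℂ), ψ s ≠ 0 := by
    filter_upwards [self_mem_nhdsWithin, hr.filter_mono nhdsWithin_le_nhds] with s hs h1 h2
    rw [h2, invCauchy_zero] at h1
    exact hs h1.symm
  refine ⟨R₀, ⟨hR₀, ?_⟩, fun R hR => ?_⟩
  · have hz : Tendsto (fun z : ℂ => z⁻¹) (Bornology.cobounded ℂ) (𝓝 0) := tendsto_inv₀_cobounded
    have hne : ∀ᶠ z in Bornology.cobounded ℂ, cauchyTransform ν z ≠ 0 := by
      filter_upwards [hz.eventually hl, Bornology.eventually_ne_cobounded (0 : ℂ)] with z h1 h2 h3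
      rw [invCauchy_inv ν h2, h3, hψ0] at h1
      exact inv_ne_zero h2 h1.symm
    have ht : Tendsto (cauchyTransform ν) (Bornology.cobounded ℂ) (𝓝[≠] 0) :=
      tendsto_nhdsWithin_iff.2 ⟨tendsto_cauchyTransform_cobounded hν, hne⟩
    filter_upwards [ht.eventually hRψ, hz.eventually hl, Bornology.eventually_ne_cobounded (0 : ℂ)]
      with z h1 h2 h3
    rw [invCauchy_inv ν h3] at h2
    rw [h1, h2, inv_inv]
    ring
  · refine (hR.1.frequently_eq_iff_eventually_eq hR₀).1 (Eventually.frequently ?_)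
    have hψt : Tendsto (fun s => (ψ s)⁻¹) (𝓝[≠] 0) (Bornology.cobounded ℂ) := by
      refine tendsto_inv₀_nhdsNE_zero.comp (tendsto_nhdsWithin_iff.2 ⟨?_, hψne⟩)
      have := hψ.continuousAt.tendsto
      rw [hψ0] at this
      exact this.mono_left nhdsWithin_le_nhds
    filter_upwards [hψt.eventually hR.2, hRψ, hψne, hr.filter_mono nhdsWithin_le_nhds]
      with s h1 h2 h3 h4
    rw [← invCauchy_inv ν (inv_ne_zero h3), inv_inv, h4] at h1
    rw [h2, ← h1]
    ring

theorem isFreeConvPow_one : IsFreeConvPow ν 1 ν := by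
  obtain ⟨R, hR, -⟩ := exists_isRTransform hν
  exact ⟨inferInstance, hν, R, R, hR, hR, by simp⟩

end compactSupport

theorem IsFreeConvPow.eventually_eq {μ ν : Measure ℝ} {k : ℝ} (h : IsFreeConvPow μ k ν)
    {R₀ : ℂ → ℂ} (hR₀ : ∀ R, IsRTransform μ R → R =ᶠ[𝓝 0] R₀) :
    ∀ᶠ z in Bornology.cobounded ℂ,
      (cauchyTransform ν z)⁻¹ + k * R₀ (cauchyTransform ν z) = z := by
  obtain ⟨hp, hc, R, S, hR, hS, hSR⟩ := h
  have ht := tendsto_cauchyTransform_cobounded hc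
  filter_upwards [hS.2, ht.eventually hSR, ht.eventually (hR₀ R hR)] with z h1 h2 h3
  rw [← h3, ← h2, h1]

/-- `freeConvPow` has the default value 0 when no power exists, so nonvanishing certifies existence.
-/
theorem isFreeConvPow_freeConvPow {μ : Measure ℝ} {k : ℝ} (h : freeConvPow μ k ≠ 0) :
    IsFreeConvPow μ k (freeConvPow μ k) := by
  rw [freeConvPow] at h ⊢
  split_ifs with h'
  · exact h'.choose_spec
  · simp [h'] at h

/-! ### Cauchy transforms of convolution powers near infinity -/

/-- The reciprocal of `σ⁻¹ + κ R(σ)`, extended by `0` to `σ = 0`. -/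
def recipK (R : ℂ → ℂ) (κ σ : ℂ) : ℂ :=
  σ * (1 + κ * (σ * R σ))⁻¹

theorem recipK_eq {R : ℂ → ℂ} {κ σ : ℂ} (hσ : σ ≠ 0) : recipK R κ σ = (σ⁻¹ + κ * R σ)⁻¹ := by
  rw [recipK]
  have : σ⁻¹ + κ * R σ = σ⁻¹ * (1 + κ * (σ * R σ)) := by field_simp
  rw [this, mul_inv, inv_inv]

/-- `θ κ` inverts `recipK R κ` near `0`, uniformly for `κ` near `1`. -/
structure InvertsRecipK (R : ℂ → ℂ) (r : ℝ) (θ : ℂ → ℂ → ℂ) (U : Set (ℂ × ℂ)) : Prop where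
  pos : 0 < r
  isOpen : IsOpen U
  mem_zero : ∀ κ, ‖κ - 1‖ < r → (κ, (0 : ℂ)) ∈ U
  differentiableAt : ∀ κ w, ‖κ - 1‖ < r → ‖w‖ < r → DifferentiableAt ℂ (θ κ) w
  mem : ∀ κ w, ‖κ - 1‖ < r → ‖w‖ < r → (κ, θ κ w) ∈ U
  right_inv : ∀ κ w, ‖κ - 1‖ < r → ‖w‖ < r → recipK R κ (θ κ w) = w
  left_inv : ∀ κ σ, (κ, σ) ∈ U → ‖κ - 1‖ < r → ‖recipK R κ σ‖ < r → θ κ (recipK R κ σ) = σ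

/-- The inverse function theorem for (κ, σ) ↦ (κ, `recipK R κ σ`) at (1, 0), where the derivative is
the identity. Treating κ as a variable is what makes the radius common to all κ near 1. -/
theorem exists_invertsRecipK {R : ℂ → ℂ} (hR : AnalyticAt ℂ R 0) :
    ∃ r θ U, InvertsRecipK R r θ U := by
  set Φ : ℂ × ℂ → ℂ × ℂ := fun p => (p.1, recipK R p.1 p.2) with hΦ
  have hR' : AnalyticAt ℂ (fun p : ℂ × ℂ => R p.2) (1, 0) :=
    AnalyticAt.fun_comp (f := fun p : ℂ × ℂ => p.2) (x := ((1 : ℂ), (0 : ℂ))) hR analyticAt_snd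
  have hm : AnalyticAt ℂ (fun p : ℂ × ℂ => (1 + p.1 * (p.2 * R p.2))⁻¹) (1, 0) :=
    (analyticAt_const.add (analyticAt_fst.mul (analyticAt_snd.mul hR'))).inv (by simp)
  have hΦa : AnalyticAt ℂ Φ (1, 0) := analyticAt_fst.prod (analyticAt_snd.mul hm)
  have hΦ0 : Φ (1, 0) = (1, 0) := by simp [hΦ, recipK]
  have hΦd : HasFDerivAt Φ ((ContinuousLinearEquiv.refl ℂ (ℂ × ℂ) : ℂ × ℂ →L[ℂ] ℂ × ℂ))
      (1, 0) := by
    have h1 := (hasFDerivAt_fst (𝕜 := ℂ) (p := ((1 : ℂ), (0 : ℂ)))).prodMk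
      ((hasFDerivAt_snd (𝕜 := ℂ) (p := ((1 : ℂ), (0 : ℂ)))).mul hm.differentiableAt.hasFDerivAt)
    refine h1.congr_fderiv ?_
    ext <;> simp
  have hc : ContDiffAt ℂ 1 Φ (1, 0) := hΦa.contDiffAt
  set e := hc.toOpenPartialHomeomorph Φ hΦd one_ne_zero with he
  have he1 : (1, 0) ∈ e.source := hc.mem_toOpenPartialHomeomorph_source hΦd one_ne_zero
  have he2 : (1, 0) ∈ e.target := by
    have := hc.image_mem_toOpenPartialHomeomorph_target hΦd one_ne_zero
    rwa [hΦ0] at this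
  have hed : ∀ᶠ p in 𝓝 ((1 : ℂ), (0 : ℂ)), DifferentiableAt ℂ e.symm p := by
    have h := hc.to_localInverse hΦd one_ne_zero
    rw [hΦ0] at h
    filter_upwards [h.eventually (by simp)] with p hp using hp.differentiableAt one_ne_zero
  have hsrc : ∀ᶠ p in 𝓝 ((1 : ℂ), (0 : ℂ)), p ∈ e.source := e.open_source.mem_nhds he1
  have htgt : ∀ᶠ p in 𝓝 ((1 : ℂ), (0 : ℂ)), p ∈ e.target := e.open_target.mem_nhds he2
  obtain ⟨r, hr, hball⟩ := Metric.eventually_nhds_iff_ball.1 (hed.and (hsrc.and htgt))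
  have hmem : ∀ κ w : ℂ, ‖κ - 1‖ < r → ‖w‖ < r → (κ, w) ∈ Metric.ball ((1 : ℂ), (0 : ℂ)) r := by
    intro κ w h1 h2
    rw [Metric.mem_ball, dist_eq_norm, Prod.norm_def]
    simpa using ⟨h1, h2⟩
  have hright : ∀ κ w : ℂ, ‖κ - 1‖ < r → ‖w‖ < r → Φ (e.symm (κ, w)) = (κ, w) :=
    fun κ w h1 h2 => e.right_inv (hball _ (hmem κ w h1 h2)).2.2
  have hfst : ∀ κ w : ℂ, ‖κ - 1‖ < r → ‖w‖ < r → e.symm (κ, w) = (κ, (e.symm (κ, w)).2) :=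
    by
    intro κ w h1 h2
    have h3 : (e.symm (κ, w)).1 = κ := congrArg Prod.fst (hright κ w h1 h2)
    exact Prod.ext h3 rfl
  refine ⟨r, fun κ w => (e.symm (κ, w)).2, e.source, hr, e.open_source, ?_, ?_, ?_, ?_, ?_⟩
  · exact fun κ h => (hball _ (hmem κ 0 h (by simpa using hr))).2.1
  · intro κ w h1 h2
    have h3 := (hball _ (hmem κ w h1 h2)).1
    have h4 : DifferentiableAt ℂ (fun w : ℂ => (κ, w)) w := by fun_prop
    exact (h3.fun_comp' w h4).snd
  · intro κ w h1 h2
    rw [← hfst κ w h1 h2]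
    exact e.map_target (hball _ (hmem κ w h1 h2)).2.2
  · intro κ w h1 h2
    have h3 := hright κ w h1 h2
    rw [hfst κ w h1 h2] at h3
    exact congrArg Prod.snd h3
  · intro κ σ h1 h2 h3
    exact congrArg Prod.snd (e.left_inv h1)

theorem InvertsRecipK.norm_inv_lt {R : ℂ → ℂ} {r : ℝ} {θ : ℂ → ℂ → ℂ} {U : Set (ℂ × ℂ)}
    (h : InvertsRecipK R r θ U) {z : ℂ} (hz : r⁻¹ < |z.re|) : ‖z⁻¹‖ < r := by
  rw [norm_inv]
  exact inv_lt_of_inv_lt₀ h.pos (hz.trans_le (Complex.abs_re_le_norm z))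

/-- A convolution power has Cauchy transform `θ k z⁻¹` over a neighbourhood of infinity on the real
line which does not depend on the power. -/
theorem InvertsRecipK.cauchyTransform_eq {μ ν : Measure ℝ} {k r : ℝ} {R : ℂ → ℂ}
    {θ : ℂ → ℂ → ℂ} {U : Set (ℂ × ℂ)} (h : InvertsRecipK R r θ U)
    (hR : ∀ S, IsRTransform μ S → S =ᶠ[𝓝 0] R) (hν : IsFreeConvPow μ k ν)
    (hk : ‖(k : ℂ) - 1‖ < r) {z : ℂ} (hz : z.im ≠ 0) (hz' : r⁻¹ < |z.re|) :
    cauchyTransform ν z = θ k z⁻¹ := by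
  have hprob := hν.1
  have ht := tendsto_cauchyTransform_cobounded hν.2.1
  -- This neighbourhood of infinity still depends on ν; the identity theorem below enlarges it to a
  -- region depending on r alone.
  have hinf : ∀ᶠ z in Bornology.cobounded ℂ, cauchyTransform ν z = θ k z⁻¹ := by
    have hU : ∀ᶠ z in Bornology.cobounded ℂ, ((k : ℂ), cauchyTransform ν z) ∈ U :=
      (tendsto_const_nhds.prodMk_nhds ht).eventually (h.isOpen.mem_nhds (h.mem_zero k hk))
    have hsmall : ∀ᶠ z in Bornology.cobounded ℂ, ‖z⁻¹‖ < r := by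
      have := (tendsto_inv₀_cobounded (α := ℂ)).norm
      rw [norm_zero] at this
      exact this.eventually_lt_const h.pos
    filter_upwards [hU, hsmall, hν.eventually_eq hR,
      Bornology.eventually_ne_cobounded ((k : ℂ) * R 0)] with z h1 h2 h3 h4
    have h5 : cauchyTransform ν z ≠ 0 := by
      intro h5
      rw [h5] at h3
      simp only [inv_zero, zero_add] at h3
      exact h4 h3.symm
    have h6 : recipK R k (cauchyTransform ν z) = z⁻¹ := by rw [recipK_eq h5, h3]
    rw [← h6] at h2 ⊢
    exact (h.left_inv k _ h1 hk h2).symm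
  obtain ⟨s, hs, hsz⟩ : ∃ s : ℝ, |s| = 1 ∧ s * z.re = |z.re| := by
    rcases le_total 0 z.re with h0 | h0
    · exact ⟨1, by simp, by rw [abs_of_nonneg h0, one_mul]⟩
    · exact ⟨-1, by simp, by rw [abs_of_nonpos h0, neg_one_mul]⟩
  have hr := inv_pos.2 h.pos
  -- The truncated quadrant containing z: it is convex, both sides are analytic on it, and it
  -- contains t z for all t ≥ 1, hence points where the equality is already known.
  set Q : Set ℂ := {w | r⁻¹ < s * w.re ∧ 0 < z.im * w.im} with hQ
  have hQo : IsOpen Q := by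
    have c1 : Continuous fun w : ℂ => s * w.re := by fun_prop
    have c2 : Continuous fun w : ℂ => z.im * w.im := by fun_prop
    exact (isOpen_lt continuous_const c1).inter (isOpen_lt continuous_const c2)
  have hQc : Convex ℝ Q := by
    refine Convex.inter ?_ ?_
    · refine convex_halfSpace_gt (f := fun w : ℂ => s * w.re) ?_ _
      exact (s • Complex.reLm).isLinear
    · refine convex_halfSpace_gt (f := fun w : ℂ => z.im * w.im) ?_ _
      exact (z.im • Complex.imLm).isLinear
  have hQre : ∀ w ∈ Q, r⁻¹ < |w.re| := by
    intro w hw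
    calc r⁻¹ < s * w.re := hw.1
      _ ≤ |s * w.re| := le_abs_self _
      _ = |w.re| := by rw [abs_mul, hs, one_mul]
  have hzQ : z ∈ Q := ⟨by rwa [hsz], mul_self_pos.2 hz⟩
  have h1 : AnalyticOnNhd ℂ (cauchyTransform ν) Q := by
    refine DifferentiableOn.analyticOnNhd (fun w hw => ?_) hQo
    exact (differentiableAt_cauchyTransform_of_im_ne_zero ν
      (right_ne_zero_of_mul hw.2.ne')).differentiableWithinAt
  have h2 : AnalyticOnNhd ℂ (fun w => θ k w⁻¹) Q := by
    refine DifferentiableOn.analyticOnNhd (fun w hw => ?_) hQo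
    have hw0 : w ≠ 0 := by
      rintro rfl
      have := hQre 0 hw
      simp only [Complex.zero_re, abs_zero] at this
      linarith
    exact ((h.differentiableAt k w⁻¹ hk (h.norm_inv_lt (hQre w hw))).fun_comp' w
      (differentiableAt_inv hw0)).differentiableWithinAt
  have hs2 : s * s = 1 := by rw [← abs_mul_abs_self, hs, one_mul]
  have hmemt : ∀ t : ℝ, 1 ≤ t → (t : ℂ) * z ∈ Q := by
    intro t ht
    refine ⟨?_, ?_⟩
    · rw [Complex.re_ofReal_mul, mul_left_comm, hsz]
      nlinarith
    · rw [Complex.im_ofReal_mul, mul_left_comm]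
      have := mul_self_pos.2 hz
      positivity
  have htend : Tendsto (fun t : ℝ => (t : ℂ) * z) atTop (Bornology.cobounded ℂ) := by
    have hz0 : z ≠ 0 := by
      rintro rfl
      simp at hz
    exact (tendsto_mul_right_cobounded hz0).comp (RCLike.tendsto_ofReal_atTop_cobounded ℂ)
  obtain ⟨N, -, hN⟩ := (Metric.hasBasis_cobounded_compl_closedBall (0 : ℂ)).eventually_iff.1 hinf
  obtain ⟨t, htN, ht1⟩ := ((htend.eventually
    ((Metric.hasBasis_cobounded_compl_closedBall (0 : ℂ)).mem_of_mem (i := N) trivial)).and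
    (eventually_ge_atTop 1)).exists
  have ht : cauchyTransform ν =ᶠ[𝓝 ((t : ℂ) * z)] fun w => θ k w⁻¹ := by
    filter_upwards [Metric.isClosed_closedBall.isOpen_compl.mem_nhds htN] with w hw using hN hw
  exact h1.eqOn_of_preconnected_of_eventuallyEq h2 hQc.isPreconnected (hmemt t ht1) ht hzQ

/-! ### Densities of normalized convolution powers -/

theorem cauchyTransform_withDensity {f : ℝ → ℝ} (hf : Continuous f) (h0 : ∀ x, 0 ≤ f x) :
    cauchyTransform (volume.withDensity fun x => ENNReal.ofReal (f x)) =
      cau fun t => (f t : ℂ) := by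
  ext z
  rw [cauchyTransform, integral_withDensity_eq_integral_toReal_smul (by fun_prop)
    (Eventually.of_forall fun x => ENNReal.ofReal_lt_top), cau]
  congr 1 with x
  rw [ENNReal.toReal_ofReal (h0 x), Complex.real_smul, div_eq_mul_inv]

theorem cauchyTransform_dilate {c : ℝ} (hc : c ≠ 0) (ν : Measure ℝ) (z : ℂ) :
    cauchyTransform (dilate c ν) z = (c : ℂ)⁻¹ * cauchyTransform ν ((c : ℂ)⁻¹ * z) := by
  have hc' : (c : ℂ) ≠ 0 := by exact_mod_cast hc
  rw [cauchyTransform, dilate, integral_map (by fun_prop)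
    (Measurable.aestronglyMeasurable (by fun_prop)), cauchyTransform, ← integral_const_mul]
  congr 1 with x
  rw [← mul_inv]
  congr 1
  push_cast
  field_simp

theorem cau_eq_of_dilate_eq {k : ℝ} (hk : 1 ≤ k) {ν : Measure ℝ} {f : ℝ → ℝ} (hf : Continuous f)
    (h0 : ∀ x, 0 ≤ f x)
    (h : dilate (√k)⁻¹ ν = volume.withDensity fun x => ENNReal.ofReal (f x)) (z : ℂ) :
    cau (fun t => (f t : ℂ)) z = (√k : ℝ) * cauchyTransform ν ((√k : ℝ) * z) := by
  have hk0 : (√k)⁻¹ ≠ 0 := inv_ne_zero (Real.sqrt_ne_zero'.2 (by linarith))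
  rw [← cauchyTransform_withDensity hf h0, ← h, cauchyTransform_dilate hk0]
  push_cast
  rw [inv_inv]

theorem one_le_sqrt {k : ℝ} (hk : 1 ≤ k) : 1 ≤ √k :=
  Real.one_le_sqrt.2 hk

/-- The densities of the normalized convolution powers vanish off a common bounded set. -/
theorem InvertsRecipK.density_eq_zero {μ ν : Measure ℝ} {k r : ℝ} {R : ℂ → ℂ}
    {θ : ℂ → ℂ → ℂ} {U : Set (ℂ × ℂ)} (h : InvertsRecipK R r θ U)
    (hR : ∀ S, IsRTransform μ S → S =ᶠ[𝓝 0] R) (hν : IsFreeConvPow μ k ν)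
    (hk : ‖(k : ℂ) - 1‖ < r) (hk1 : 1 ≤ k) {f : ℝ → ℝ} (hf : ContDiff ℝ 1 f)
    (hc : HasCompactSupport f) (h0 : ∀ x, 0 ≤ f x)
    (hd : dilate (√k)⁻¹ ν = volume.withDensity fun x => ENNReal.ofReal (f x)) {x : ℝ}
    (hx : r⁻¹ < |x|) : f x = 0 := by
  have hs := one_le_sqrt hk1
  have hs0 : √k ≠ 0 := by positivity
  have hre : r⁻¹ < |√k * x| := by
    rw [abs_mul, abs_of_nonneg (Real.sqrt_nonneg k)]
    have := abs_nonneg x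
    nlinarith
  have hx0 : ((√k : ℝ) : ℂ) * x ≠ 0 := by
    have : √k * x ≠ 0 := by
      intro h1
      rw [h1, abs_zero] at hre
      exact absurd hre (inv_pos.2 h.pos).not_gt
    exact_mod_cast this
  have key : ∀ ε : ℝ, ε ≠ 0 → cau (fun t => (f t : ℂ)) (x + ε * Complex.I) =
      (√k : ℝ) * θ k ((√k : ℝ) * (x + ε * Complex.I))⁻¹ := by
    intro ε hε
    rw [cau_eq_of_dilate_eq hk1 hf.continuous h0 hd, h.cauchyTransform_eq hR hν hk]
    · simp [hε, hs0]
    · simpa using hre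
  have hcont : ContinuousAt (θ k) (((√k : ℝ) : ℂ) * x)⁻¹ := by
    refine (h.differentiableAt k _ hk (h.norm_inv_lt ?_)).continuousAt
    simpa using hre
  have hlim : Tendsto (fun ε : ℝ => ((√k : ℝ) : ℂ) * θ k ((√k : ℝ) * (x + ε * Complex.I))⁻¹) (𝓝 0)
      (𝓝 ((√k : ℝ) * θ k (((√k : ℝ) : ℂ) * x)⁻¹)) := by
    refine (hcont.tendsto.comp ?_).const_mul _
    have h1 : ContinuousAt (fun ε : ℝ => (((√k : ℝ) : ℂ) * (x + ε * Complex.I))⁻¹) 0 := by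
      refine ContinuousAt.inv₀ (by fun_prop) ?_
      simpa using hx0
    simpa [ContinuousAt] using h1
  -- Since θ k is continuous across the real axis, the boundary values from above and below
  -- coincide. They are conjugate to each other, so the imaginary part −π f(x) is 0.
  have e1 : bdry f x = (√k : ℝ) * θ k (((√k : ℝ) : ℂ) * x)⁻¹ := by
    refine tendsto_nhds_unique (tendsto_horiz hf hc x)
      ((hlim.mono_left nhdsWithin_le_nhds).congr' ?_)
    filter_upwards [self_mem_nhdsWithin] with ε hε
    exact (key ε (ne_of_gt hε)).symm
  have e2 : conj (bdry f x) = (√k : ℝ) * θ k (((√k : ℝ) : ℂ) * x)⁻¹ := by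
    refine tendsto_nhds_unique ((Complex.continuous_conj.tendsto _).comp (tendsto_horiz hf hc x))
      (((hlim.comp (by simpa using tendsto_neg (0 : ℝ))).mono_left nhdsWithin_le_nhds).congr' ?_)
    filter_upwards [self_mem_nhdsWithin] with ε hε
    simp only [Function.comp_apply]
    rw [← key (-ε) (neg_ne_zero.2 (ne_of_gt hε)), horiz, ← cau_ofReal_conj]
    simp
  have e3 : (bdry f x).im = 0 := Complex.conj_eq_iff_im.1 (e2.trans e1.symm)
  rw [bdry_im hf hc, neg_eq_zero] at e3
  exact (mul_eq_zero.1 e3).resolve_left Real.pi_ne_zero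

/-- The curve `k ↦ F k` of functions has right derivative `g` at `k = 1`, with uniform control. -/
structure HasUniformRightDeriv (F : ℝ → ℝ → ℝ) (g : ℝ → ℝ) (C M : ℝ) : Prop where
  continuous : ∀ᶠ k in 𝓝[>] 1, Continuous (F k)
  continuous_one : Continuous (F 1)
  zero : ∀ᶠ k in 𝓝[>] 1, ∀ x, C < |x| → F k x = 0
  zero_one : ∀ x, C < |x| → F 1 x = 0
  lipschitz : ∀ᶠ k in 𝓝[>] 1, ∀ x, |F k x - F 1 x| ≤ M * (k - 1)
  tendsto : ∀ x, Tendsto (fun k => (k - 1)⁻¹ * (F k x - F 1 x)) (𝓝[>] 1) (𝓝 (g x))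

namespace HasUniformRightDeriv

variable {F : ℝ → ℝ → ℝ} {g : ℝ → ℝ} {C M : ℝ} (h : HasUniformRightDeriv F g C M)

include h

theorem tendsto_integral_smul {E : Type*} [NormedAddCommGroup E] [NormedSpace ℝ E]
    {m : ℝ → ℝ → E} {m₀ : ℝ → E} {B : ℝ}
    (hm : ∀ᶠ k in 𝓝[>] 1, AEStronglyMeasurable (m k))
    (hB : ∀ᶠ k in 𝓝[>] 1, ∀ x, |x| ≤ C → ‖m k x‖ ≤ B)
    (hlim : ∀ x, Tendsto (fun k => m k x) (𝓝[>] 1) (𝓝 (m₀ x))) :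
    Tendsto (fun k => ∫ x, ((k - 1)⁻¹ * (F k x - F 1 x)) • m k x) (𝓝[>] 1)
      (𝓝 (∫ x, g x • m₀ x)) := by
  refine tendsto_integral_of_bounded (A := C) (C := M * B) ?_ ?_ ?_ ?_
  · filter_upwards [h.continuous, hm] with k hk hmk
    have := h.continuous_one
    exact (Continuous.aestronglyMeasurable (by fun_prop)).smul hmk
  · filter_upwards [h.zero] with k hk x hx
    rw [hk x hx, h.zero_one x hx, sub_zero, mul_zero, zero_smul]
  · filter_upwards [h.lipschitz, hB, self_mem_nhdsWithin] with k h1 h2 h3 x hx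
    have h3 : 0 < k - 1 := sub_pos.2 h3
    have h4 : |(k - 1)⁻¹ * (F k x - F 1 x)| ≤ M := by
      rw [abs_mul, abs_of_pos (inv_pos.2 h3), inv_mul_le_iff₀ h3, mul_comm]
      exact h1 x
    rw [norm_smul, Real.norm_eq_abs]
    exact mul_le_mul h4 (h2 x hx) (norm_nonneg _) ((abs_nonneg _).trans h4)
  · exact fun x => (h.tendsto x).smul (hlim x)

theorem tendsto_apply (x : ℝ) : Tendsto (fun k => F k x) (𝓝[>] 1) (𝓝 (F 1 x)) := by
  have h1 : Tendsto (fun k : ℝ => k - 1) (𝓝[>] 1) (𝓝 0) := by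
    have : Tendsto (fun k : ℝ => k - 1) (𝓝 1) (𝓝 (1 - 1)) := (continuous_sub_right 1).tendsto 1
    rw [sub_self] at this
    exact this.mono_left nhdsWithin_le_nhds
  have h2 := (h1.mul (h.tendsto x)).const_add (F 1 x)
  rw [zero_mul, add_zero] at h2
  refine h2.congr' ?_
  filter_upwards [self_mem_nhdsWithin] with k hk
  rw [mul_inv_cancel_left₀ (sub_pos.2 hk).ne']
  ring

theorem right_deriv_eq_zero {x : ℝ} (hx : C < |x|) : g x = 0 := by
  refine tendsto_nhds_unique (h.tendsto x) (tendsto_const_nhds.congr' ?_)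
  filter_upwards [h.zero] with k hk
  rw [hk x hx, h.zero_one x hx, sub_zero, mul_zero]

theorem hasCompactSupport : HasCompactSupport g := by
  refine HasCompactSupport.of_support_subset_isCompact (isCompact_Icc (a := -C) (b := C)) ?_
  intro x hx
  by_contra hn
  refine hx (h.right_deriv_eq_zero (not_le.1 fun h1 => hn (abs_le.1 h1)))

/-- Factor a³ − b³ = (a − b)(a² + ab + b²); the second factor is a bounded weight converging
pointwise to 3 b². -/
theorem hasDerivWithinAt_integral_pow_three :
    HasDerivWithinAt (fun k => ∫ x, F k x ^ 3) (3 * ∫ x, F 1 x ^ 2 * g x) (Ici 1) 1 := by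
  rw [← hasDerivWithinAt_Ioi_iff_Ici, hasDerivWithinAt_iff_tendsto_slope' (by simp)]
  obtain ⟨B, hB⟩ := h.continuous_one.bounded_above_of_compact_support
    (HasCompactSupport.of_support_subset_isCompact (isCompact_Icc (a := -C) (b := C)) fun x hx => by
      by_contra hn
      exact hx (h.zero_one x (not_le.1 fun h1 => hn (abs_le.1 h1))))
  have hk1 : ∀ᶠ k : ℝ in 𝓝[>] 1, k < 2 :=
    (eventually_lt_nhds one_lt_two).filter_mono nhdsWithin_le_nhds
  have hB' : ∀ᶠ k in 𝓝[>] 1, ∀ x, |F k x| ≤ B + |M| := by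
    filter_upwards [h.lipschitz, hk1, self_mem_nhdsWithin] with k h1 h2 h3 x
    have h3 : 0 < k - 1 := sub_pos.2 h3
    have h4 := h1 x
    have h5 : |F k x| - |F 1 x| ≤ |F k x - F 1 x| := abs_sub_abs_le_abs_sub _ _
    have h6 : |F 1 x| ≤ B := hB x
    have h7 : M * (k - 1) ≤ |M| := by
      have := le_abs_self M
      nlinarith [abs_nonneg M]
    linarith
  have hint : ∀ {u : ℝ → ℝ}, Continuous u → (∀ x, C < |x| → u x = 0) →
      Integrable fun x => u x ^ 3 := by
    intro u hu hu0
    refine Continuous.integrable_of_hasCompactSupport (by fun_prop)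
      (HasCompactSupport.of_support_subset_isCompact (isCompact_Icc (a := -C) (b := C)) ?_)
    intro x hx
    by_contra hn
    refine hx ?_
    simp [hu0 x (not_le.1 fun h1 => hn (abs_le.1 h1))]
  have hlim := h.tendsto_integral_smul (m := fun k x => F k x ^ 2 + F k x * F 1 x + F 1 x ^ 2)
    (m₀ := fun x => F 1 x ^ 2 + F 1 x * F 1 x + F 1 x ^ 2) (B := 3 * (B + |M|) ^ 2) ?_ ?_ ?_
  · have e : ∫ x, g x • (F 1 x ^ 2 + F 1 x * F 1 x + F 1 x ^ 2) = 3 * ∫ x, F 1 x ^ 2 * g x := by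
      rw [← integral_const_mul]
      congr 1 with x
      rw [smul_eq_mul]
      ring
    rw [e] at hlim
    refine hlim.congr' ?_
    filter_upwards [h.continuous, h.zero] with k h1 h2
    rw [slope_def_field, ← integral_sub (hint h1 h2) (hint h.continuous_one h.zero_one),
      div_eq_inv_mul, ← integral_const_mul]
    congr 1 with x
    rw [smul_eq_mul]
    ring
  · filter_upwards [h.continuous] with k hk
    have := h.continuous_one
    exact Continuous.aestronglyMeasurable (by fun_prop)
  · filter_upwards [hB'] with k hk x _
    have h1 := abs_le.1 (hk x)
    have h2 : |F 1 x| ≤ B + |M| := (hB x).trans (le_add_of_nonneg_right (abs_nonneg M))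
    have h3 := abs_le.1 h2
    rw [Real.norm_eq_abs]
    have e1 : |F k x ^ 2| ≤ (B + |M|) ^ 2 := by
      rw [abs_pow]
      exact pow_le_pow_left₀ (abs_nonneg _) (hk x) 2
    have e2 : |F 1 x ^ 2| ≤ (B + |M|) ^ 2 := by
      rw [abs_pow]
      exact pow_le_pow_left₀ (abs_nonneg _) h2 2
    have e3 : |F k x * F 1 x| ≤ (B + |M|) ^ 2 := by
      rw [abs_mul, sq]
      exact mul_le_mul (hk x) h2 (abs_nonneg _) ((abs_nonneg _).trans h2)
    have := abs_add_three (F k x ^ 2) (F k x * F 1 x) (F 1 x ^ 2)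
    linarith
  · intro x
    have := h.tendsto_apply x
    exact ((this.pow 2).add (this.mul_const _)).add tendsto_const_nhds

end HasUniformRightDeriv

/-! ### The evolution equation of the density -/

theorem hasDerivAt_inv_sqrt_one : HasDerivAt (fun k : ℝ => (((√k)⁻¹ : ℝ) : ℂ)) (-(1 / 2)) 1 := by
  have h1 : HasDerivAt (fun k : ℝ => (√k)⁻¹) (-(1 / 2)) 1 := by
    have := (Real.hasDerivAt_sqrt one_ne_zero).fun_inv (by simp)
    simpa using this
  have := h1.ofReal_comp
  push_cast at this
  simpa using this

/-- The density curve `F` of normalized convolution powers `ν k` of `μ`, near `k = 1`. -/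
structure IsDensityCurve (μ : Measure ℝ) (ν : ℝ → Measure ℝ) (F : ℝ → ℝ → ℝ) : Prop where
  isFreeConvPow : ∀ᶠ k in 𝓝[≥] 1, IsFreeConvPow μ k (ν k)
  continuous : ∀ᶠ k in 𝓝[≥] 1, Continuous (F k)
  nonneg : ∀ᶠ k in 𝓝[≥] 1, ∀ x, 0 ≤ F k x
  dilate_eq : ∀ᶠ k in 𝓝[≥] 1,
    dilate (√k)⁻¹ (ν k) = volume.withDensity fun x => ENNReal.ofReal (F k x)

/-- The value σ is held fixed and the point moves with k: `θ k` inverts `recipK R k`, so the k-th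
power takes the value σ at 1/σ + k R(σ). In this form θ never has to be differentiated in k. -/
theorem eventually_cau_eq {μ : Measure ℝ} {ν : ℝ → Measure ℝ} {F : ℝ → ℝ → ℝ} {r : ℝ} {R : ℂ → ℂ}
    {θ : ℂ → ℂ → ℂ} {U : Set (ℂ × ℂ)} (h : InvertsRecipK R r θ U)
    (hR : ∀ S, IsRTransform μ S → S =ᶠ[𝓝 0] R) (hF : IsDensityCurve μ ν F) {z : ℂ}
    (hz : z.im ≠ 0) (hz' : r⁻¹ < |z.re|) :
    cau (fun t => (F 1 t : ℂ)) z ≠ 0 ∧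
      (cau (fun t => (F 1 t : ℂ)) z)⁻¹ + R (cau (fun t => (F 1 t : ℂ)) z) = z ∧
      ∀ᶠ k in 𝓝[≥] (1 : ℝ), cau (fun t => (F k t : ℂ)) (((cau (fun t => (F 1 t : ℂ)) z)⁻¹ +
        k * R (cau (fun t => (F 1 t : ℂ)) z)) * ((√k)⁻¹ : ℝ)) =
          (√k : ℝ) * cau (fun t => (F 1 t : ℂ)) z := by
  set σ := cau (fun t => (F 1 t : ℂ)) z with hσ
  have h11 : ‖((1 : ℝ) : ℂ) - 1‖ < r := by simpa using h.pos
  have hzr := h.norm_inv_lt hz'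
  have hσθ : σ = θ 1 z⁻¹ := by
    rw [hσ, cau_eq_of_dilate_eq le_rfl (hF.continuous.self_of_nhdsWithin self_mem_Ici)
      (hF.nonneg.self_of_nhdsWithin self_mem_Ici) (hF.dilate_eq.self_of_nhdsWithin self_mem_Ici)]
    simp only [Real.sqrt_one, Complex.ofReal_one, one_mul]
    simpa using h.cauchyTransform_eq hR (hF.isFreeConvPow.self_of_nhdsWithin self_mem_Ici) h11 hz hz'
  have h1 : ‖(1 : ℂ) - 1‖ < r := by simpa using h.pos
  have hσU : ((1 : ℂ), σ) ∈ U := hσθ ▸ h.mem 1 z⁻¹ h1 hzr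
  have hσK : recipK R 1 σ = z⁻¹ := hσθ ▸ h.right_inv 1 z⁻¹ h1 hzr
  have hz0 : z ≠ 0 := by
    rintro rfl
    simp at hz
  have hσ0 : σ ≠ 0 := by
    intro h0
    rw [h0, recipK, zero_mul] at hσK
    exact inv_ne_zero hz0 hσK.symm
  have hσz : σ⁻¹ + R σ = z := by
    rw [recipK_eq hσ0, one_mul] at hσK
    exact inv_injective hσK
  refine ⟨hσ0, hσz, ?_⟩
  set ζ : ℝ → ℂ := fun k => σ⁻¹ + k * R σ with hζ
  have hζc : Continuous ζ := by fun_prop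
  have hζ1 : ζ 1 = z := by simpa [hζ] using hσz
  have e1 : ∀ᶠ k : ℝ in 𝓝 (1 : ℝ), ((k : ℂ), σ) ∈ U := by
    have hc : Continuous fun k : ℝ => ((k : ℂ), σ) := by fun_prop
    exact hc.continuousAt.eventually_mem (h.isOpen.mem_nhds (by rwa [Complex.ofReal_one]))
  have e2 : ∀ᶠ k : ℝ in 𝓝 (1 : ℝ), ‖(k : ℂ) - 1‖ < r := by
    have hc : Continuous fun k : ℝ => ‖(k : ℂ) - 1‖ := by fun_prop
    exact hc.continuousAt.eventually_lt_const (by simpa using h.pos)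
  have e3 : ∀ᶠ k in 𝓝 (1 : ℝ), r⁻¹ < |(ζ k).re| := by
    have hc : Continuous fun k : ℝ => |(ζ k).re| := by fun_prop
    exact hc.continuousAt.eventually_const_lt (by simpa [hζ1] using hz')
  have e4 : ∀ᶠ k in 𝓝 (1 : ℝ), (ζ k).im ≠ 0 := by
    have hc : Continuous fun k : ℝ => (ζ k).im := by fun_prop
    exact hc.continuousAt.eventually_ne (by simpa [hζ1] using hz)
  filter_upwards [e1.filter_mono nhdsWithin_le_nhds, e2.filter_mono nhdsWithin_le_nhds,
    e3.filter_mono nhdsWithin_le_nhds, e4.filter_mono nhdsWithin_le_nhds, hF.isFreeConvPow,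
    hF.continuous, hF.nonneg, hF.dilate_eq, self_mem_nhdsWithin] with k h1 h2 h3 h4 h5 h6 h7 h8 h9
  have hs : ((√k : ℝ) : ℂ) ≠ 0 := by
    have := one_le_sqrt h9
    exact_mod_cast (by positivity : √k ≠ 0)
  rw [cau_eq_of_dilate_eq h9 h6 h7 h8]
  congr 1
  have e : ((√k : ℝ) : ℂ) * ((σ⁻¹ + k * R σ) * ((√k)⁻¹ : ℝ)) = ζ k := by
    rw [hζ]
    push_cast
    field_simp
  rw [e, h.cauchyTransform_eq hR h5 h2 h4 h3]
  have e' : (ζ k)⁻¹ = recipK R k σ := (recipK_eq hσ0).symm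
  rw [e']
  exact h.left_inv k σ h1 h2 (e' ▸ h.norm_inv_lt h3)

/-- The Cauchy transform of the right derivative of the density curve, near infinity. -/
theorem HasUniformRightDeriv.cau_eq_of_lt {μ : Measure ℝ} {ν : ℝ → Measure ℝ} {F : ℝ → ℝ → ℝ}
    {r : ℝ} {R : ℂ → ℂ} {θ : ℂ → ℂ → ℂ} {U : Set (ℂ × ℂ)} {g : ℝ → ℝ} {C M : ℝ}
    (hg : HasUniformRightDeriv F g C M) (h : InvertsRecipK R r θ U)
    (hR : ∀ S, IsRTransform μ S → S =ᶠ[𝓝 0] R) (hF : IsDensityCurve μ ν F)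
    (hf : IsSmoothDensity (F 1)) {z : ℂ} (hz : z.im ≠ 0) (hz' : r⁻¹ < |z.re|) :
    cau (fun t => (g t : ℂ)) z = cau (fun t => (F 1 t : ℂ)) z / 2 -
      z * cau (fun t => ((deriv (F 1) t : ℝ) : ℂ)) z / 2 +
      cau (fun t => ((deriv (F 1) t : ℝ) : ℂ)) z / cau (fun t => (F 1 t : ℂ)) z := by
  obtain ⟨hσ0, hσz, hev⟩ := eventually_cau_eq h hR hF hz hz'
  set σ := cau (fun t => (F 1 t : ℂ)) z with hσ
  set G' := cau (fun t => ((deriv (F 1) t : ℝ) : ℂ)) z with hG'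
  set w : ℝ → ℂ := fun k => (σ⁻¹ + k * R σ) * ((√k)⁻¹ : ℝ) with hw
  have hw1 : w 1 = z := by simpa [hw] using hσz
  -- The derivative is R(σ) − z/2, and R(σ) = z − 1/σ.
  have hwd : HasDerivAt w (z / 2 - σ⁻¹) 1 := by
    have h1 : HasDerivAt (fun k : ℝ => σ⁻¹ + k * R σ) (R σ) 1 := by
      have := ((hasDerivAt_id (1 : ℝ)).ofReal_comp.mul_const (R σ)).const_add σ⁻¹
      simpa using this
    refine (h1.fun_mul hasDerivAt_inv_sqrt_one).congr_deriv ?_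
    rw [← hσz]
    simp
    ring
  have hwc : ContinuousAt w 1 := hwd.continuousAt
  have hGd : HasDerivAt (cau fun t => (F 1 t : ℂ)) G' (w 1) := by
    rw [hw1]
    exact hasDerivAt_cau_ofReal hf.contDiff_one hf.hasCompactSupport hz
  have t1 : Tendsto (fun k : ℝ => ((k - 1)⁻¹ : ℝ) •
      (cau (fun t => (F 1 t : ℂ)) (w k) - σ)) (𝓝[>] 1) (𝓝 ((z / 2 - σ⁻¹) * G')) := by
    have := (hasDerivWithinAt_iff_tendsto_slope' (s := Ioi 1) (by simp)).1
      (HasDerivAt.scomp (1 : ℝ) hGd hwd).hasDerivWithinAt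
    simp only [slope_fun_def, Function.comp_apply, hw1, vsub_eq_sub, smul_eq_mul] at this
    exact this
  have t2 : Tendsto (fun k : ℝ => ((k - 1)⁻¹ : ℝ) • (((√k : ℝ) : ℂ) * σ - σ)) (𝓝[>] 1)
      (𝓝 (σ / 2)) := by
    have hs : HasDerivAt (fun k : ℝ => ((√k : ℝ) : ℂ) * σ) (σ / 2) 1 := by
      refine ((Real.hasDerivAt_sqrt one_ne_zero).ofReal_comp.mul_const σ).congr_deriv ?_
      simp
      ring
    have := (hasDerivWithinAt_iff_tendsto_slope' (s := Ioi 1) (by simp)).1 hs.hasDerivWithinAt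
    simp only [slope_fun_def, vsub_eq_sub, Real.sqrt_one, Complex.ofReal_one, one_mul] at this
    exact this
  have him : ∀ᶠ k in 𝓝[>] (1 : ℝ), |z.im| / 2 < |(w k).im| := by
    have hc : ContinuousAt (fun k => |(w k).im|) 1 :=
      (Complex.continuous_im.continuousAt.comp hwc).abs
    refine (hc.eventually_const_lt ?_).filter_mono nhdsWithin_le_nhds
    simp only [hw1]
    exact half_lt_self (abs_pos.2 hz)
  have hz2 : 0 < |z.im| / 2 := half_pos (abs_pos.2 hz)
  have t3 : Tendsto (fun k : ℝ => ((k - 1)⁻¹ : ℝ) •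
      (cau (fun t => (F k t : ℂ)) (w k) - cau (fun t => (F 1 t : ℂ)) (w k))) (𝓝[>] 1)
      (𝓝 (cau (fun t => (g t : ℂ)) z)) := by
    have := hg.tendsto_integral_smul (m := fun k x => (w k - x)⁻¹) (m₀ := fun x : ℝ => (z - x)⁻¹)
      (B := (|z.im| / 2)⁻¹) ?_ ?_ ?_
    · have e : ∫ x, g x • (z - x)⁻¹ = cau (fun t => (g t : ℂ)) z := by
        simp [cau, div_eq_mul_inv]
      rw [e] at this
      refine this.congr' ?_
      filter_upwards [hg.continuous, hg.zero, him] with k h1 h2 h3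
      have hwk : (w k).im ≠ 0 := abs_pos.1 (hz2.trans h3)
      have hi : ∀ {u : ℝ → ℝ}, Continuous u → (∀ x, C < |x| → u x = 0) →
          Integrable fun x : ℝ => (u x : ℂ) / (w k - x) := by
        intro u hu hu0
        have hui : Integrable fun x => (u x : ℂ) := by
          refine Continuous.integrable_of_hasCompactSupport (by fun_prop)
            (HasCompactSupport.of_support_subset_isCompact (isCompact_Icc (a := -C) (b := C)) ?_)
          intro x hx
          by_contra hn
          refine hx ?_
          simp [hu0 x (not_le.1 fun h1 => hn (abs_le.1 h1))]
        simpa using integrable_div_sub_pow hui hwk 1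
      rw [cau, cau, ← integral_sub (hi h1 h2) (hi hg.continuous_one hg.zero_one), ← integral_smul]
      congr 1 with x
      simp only [Complex.real_smul]
      push_cast
      ring
    · exact Eventually.of_forall fun k => Measurable.aestronglyMeasurable (by fun_prop)
    · filter_upwards [him] with k hk x _
      rw [norm_inv]
      exact inv_anti₀ hz2 (hk.le.trans (abs_im_le_norm_sub _ _))
    · intro x
      have : ContinuousAt (fun k => (w k - x)⁻¹) 1 := by
        refine ContinuousAt.inv₀ (by fun_prop) ?_
        rw [hw1]
        exact sub_ofReal_ne_zero hz x
      have := this.tendsto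
      rw [hw1] at this
      exact this.mono_left nhdsWithin_le_nhds
  -- The increment is split into the change of density at the moving point w k and the change of
  -- point for the fixed density at k = 1. Comparison with the derivative of √k σ gives a linear
  -- equation for the transform of g.
  have t4 : Tendsto (fun k : ℝ => ((k - 1)⁻¹ : ℝ) • (((√k : ℝ) : ℂ) * σ - σ)) (𝓝[>] 1)
      (𝓝 (cau (fun t => (g t : ℂ)) z + (z / 2 - σ⁻¹) * G')) := by
    refine (t3.add t1).congr' ?_
    filter_upwards [hev.filter_mono (nhdsWithin_mono _ Ioi_subset_Ici_self)] with k hk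
    rw [← hk, ← smul_add]
    congr 1
    ring
  have := tendsto_nhds_unique t4 t2
  rw [div_eq_mul_inv G' σ]
  linear_combination this

/-- The Cauchy transform of the right derivative of the density curve. -/
theorem HasUniformRightDeriv.cau_eq {μ : Measure ℝ} {ν : ℝ → Measure ℝ} {F : ℝ → ℝ → ℝ}
    {r : ℝ} {R : ℂ → ℂ} {θ : ℂ → ℂ → ℂ} {U : Set (ℂ × ℂ)} {g : ℝ → ℝ} {C M : ℝ}
    (hg : HasUniformRightDeriv F g C M) (h : InvertsRecipK R r θ U)
    (hR : ∀ S, IsRTransform μ S → S =ᶠ[𝓝 0] R) (hF : IsDensityCurve μ ν F)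
    (hf : IsSmoothDensity (F 1)) (hgc : Continuous g) {z : ℂ} (hz : 0 < z.im) :
    cau (fun t => (g t : ℂ)) z = cau (fun t => (F 1 t : ℂ)) z / 2 -
      z * cau (fun t => ((deriv (F 1) t : ℝ) : ℂ)) z / 2 +
      cau (fun t => ((deriv (F 1) t : ℝ) : ℂ)) z / cau (fun t => (F 1 t : ℂ)) z := by
  set H : Set ℂ := {z | 0 < z.im} with hH
  have hHo : IsOpen H := isOpen_lt continuous_const Complex.continuous_im
  have hHc : IsPreconnected H := (convex_halfSpace_im_gt 0).isPreconnected
  have hgi : Integrable fun t => (g t : ℂ) :=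
    Continuous.integrable_of_hasCompactSupport (by fun_prop)
      (hasCompactSupport_ofReal hg.hasCompactSupport)
  have hd : ∀ {u : ℝ → ℂ}, Integrable u → ∀ z ∈ H, DifferentiableAt ℂ (cau u) z :=
    fun hu z hz => (hasDerivAt_cau hu (ne_of_gt hz)).differentiableAt
  have hfi := integrable_ofReal hf.contDiff_one hf.hasCompactSupport
  have hfi' := integrable_ofReal (contDiff_deriv hf.contDiff) hf.hasCompactSupport.deriv
  have hne : ∀ z ∈ H, cau (fun t => (F 1 t : ℂ)) z ≠ 0 := by
    intro z hz
    have := hf.horiz_ne_zero' (s := z.im) (ne_of_gt hz) z.re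
    rwa [horiz, Complex.re_add_im] at this
  have a1 : AnalyticOnNhd ℂ (cau fun t => (g t : ℂ)) H :=
    DifferentiableOn.analyticOnNhd (fun z hz => (hd hgi z hz).differentiableWithinAt) hHo
  have a2 : AnalyticOnNhd ℂ (fun z => cau (fun t => (F 1 t : ℂ)) z / 2 -
      z * cau (fun t => ((deriv (F 1) t : ℝ) : ℂ)) z / 2 +
      cau (fun t => ((deriv (F 1) t : ℝ) : ℂ)) z / cau (fun t => (F 1 t : ℂ)) z) H := by
    refine DifferentiableOn.analyticOnNhd (fun z hz => ?_) hHo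
    have d1 := hd hfi z hz
    have d2 := hd hfi' z hz
    exact (((d1.div_const 2).fun_sub ((differentiableAt_id.fun_mul d2).div_const 2)).fun_add
      (d2.fun_div d1 (hne z hz))).differentiableWithinAt
  have hr := inv_pos.2 h.pos
  -- A point of the half-plane near which the formula is already known; the identity theorem spreads
  -- it to the whole half-plane.
  have hp : ((r⁻¹ + 1 : ℝ) : ℂ) + Complex.I ∈ H := by simp [hH]
  refine a1.eqOn_of_preconnected_of_eventuallyEq a2 hHc hp ?_ hz
  have hQ : IsOpen {z : ℂ | r⁻¹ < |z.re|} := by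
    have hc : Continuous fun z : ℂ => |z.re| := by fun_prop
    exact isOpen_lt continuous_const hc
  have hpQ : r⁻¹ < |(((r⁻¹ + 1 : ℝ) : ℂ) + Complex.I).re| := by
    rw [Complex.add_re, Complex.ofReal_re, Complex.I_re, add_zero, abs_of_pos (by linarith)]
    linarith
  filter_upwards [hHo.mem_nhds hp, hQ.mem_nhds hpQ] with z h1 h2 using hg.cau_eq_of_lt h hR hF hf (ne_of_gt h1) h2

/-- The right derivative of the density curve, in terms of boundary values. -/
theorem HasUniformRightDeriv.eq_of_ne_zero {μ : Measure ℝ} {ν : ℝ → Measure ℝ} {F : ℝ → ℝ → ℝ}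
    {r : ℝ} {R : ℂ → ℂ} {θ : ℂ → ℂ → ℂ} {U : Set (ℂ × ℂ)} {g : ℝ → ℝ} {C M : ℝ}
    (hg : HasUniformRightDeriv F g C M) (h : InvertsRecipK R r θ U)
    (hR : ∀ S, IsRTransform μ S → S =ᶠ[𝓝 0] R) (hF : IsDensityCurve μ ν F)
    (hf : IsSmoothDensity (F 1)) (hgc : ContDiff ℝ 1 g) {x : ℝ} (hx : F 1 x ≠ 0) :
    g x = F 1 x / 2 - x * deriv (F 1) x / 2 +
      1 / Real.pi * ((hilbert (F 1) x * deriv (F 1) x - F 1 x * deriv (hilbert (F 1)) x) /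
        (hilbert (F 1) x ^ 2 + F 1 x ^ 2)) := by
  have t1 := tendsto_horiz hf.contDiff_one hf.hasCompactSupport x
  have t2 := tendsto_horiz (contDiff_deriv hf.contDiff) hf.hasCompactSupport.deriv x
  have t3 := tendsto_horiz hgc hg.hasCompactSupport x
  have hB := hf.bdry_ne_zero hx
  have tz : Tendsto (fun ε : ℝ => (x : ℂ) + ε * Complex.I) (𝓝[>] 0) (𝓝 x) := by
    have hc : Continuous fun ε : ℝ => (x : ℂ) + ε * Complex.I := by fun_prop
    have := hc.tendsto 0
    simp only [Complex.ofReal_zero, zero_mul, add_zero] at this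
    exact this.mono_left nhdsWithin_le_nhds
  have key := tendsto_nhds_unique t3 ((((t1.div_const 2).sub ((tz.mul t2).div_const 2)).add
    (t2.div t1 hB)).congr' (by
      filter_upwards [self_mem_nhdsWithin] with ε hε
      exact (hg.cau_eq h hR hF hf hgc.continuous (by simpa using hε)).symm))
  -- Imaginary parts of boundary values are −π times the densities, so this isolates g and discards
  -- its Hilbert transform.
  have him := congrArg Complex.im key
  rw [bdry_im hgc hg.hasCompactSupport, bdry_eq hf.contDiff_one hf.hasCompactSupport,
    bdry_eq (contDiff_deriv hf.contDiff) hf.hasCompactSupport.deriv] at him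
  rw [hf.deriv_hilbert]
  set a := hilbert (F 1) x
  set b := F 1 x
  set a' := hilbert (deriv (F 1)) x
  set b' := deriv (F 1) x
  have hpos : a ^ 2 + b ^ 2 ≠ 0 := by positivity
  have hpos' : (a : ℂ) ^ 2 + (b : ℂ) ^ 2 ≠ 0 := by exact_mod_cast hpos
  have hπ : (Real.pi : ℂ) ≠ 0 := by exact_mod_cast Real.pi_ne_zero
  have hne : (a : ℂ) - Complex.I * b ≠ 0 := by
    intro h0
    have := congrArg Complex.im h0
    simp at this
    exact hx this
  have e : (Real.pi : ℂ) * (a' - Complex.I * b') / (Real.pi * (a - Complex.I * b)) =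
      (((a' * a + b' * b) / (a ^ 2 + b ^ 2) : ℝ) : ℂ) +
        (((a' * b - b' * a) / (a ^ 2 + b ^ 2) : ℝ) : ℂ) * Complex.I := by
    rw [mul_div_mul_left _ _ hπ]
    push_cast
    rw [div_eq_iff hne]
    field_simp
    linear_combination (a' * (b : ℂ) ^ 2 - a * b * b') * Complex.I_sq
  rw [e] at him
  generalize (a' * a + b' * b) / (a ^ 2 + b ^ 2) = P at him
  generalize hQ : (a' * b - b' * a) / (a ^ 2 + b ^ 2) = Q at him
  simp at him
  rw [← hQ] at him
  have hπ' := Real.pi_ne_zero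
  field_simp at him ⊢
  linarith

/-- The weight f² makes the values of g on the zero set of f irrelevant, so the boundary formula is
needed only where f ≠ 0. Integrating the derivative of x f³ converts ∫ x f' f² into −(1/3)∫ f³. -/
theorem HasUniformRightDeriv.integral_sq_mul {μ : Measure ℝ} {ν : ℝ → Measure ℝ}
    {F : ℝ → ℝ → ℝ} {r : ℝ} {R : ℂ → ℂ} {θ : ℂ → ℂ → ℂ} {U : Set (ℂ × ℂ)} {g : ℝ → ℝ} {C M : ℝ}
    (hg : HasUniformRightDeriv F g C M) (h : InvertsRecipK R r θ U)
    (hR : ∀ S, IsRTransform μ S → S =ᶠ[𝓝 0] R) (hF : IsDensityCurve μ ν F)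
    (hf : IsSmoothDensity (F 1)) (hgc : ContDiff ℝ 1 g) :
    3 * ∫ x, F 1 x ^ 2 * g x = 2 * (∫ x, F 1 x ^ 3) + 3 / Real.pi *
      ∫ x, (hilbert (F 1) x * deriv (F 1) x - F 1 x * deriv (hilbert (F 1)) x) /
        (hilbert (F 1) x ^ 2 + F 1 x ^ 2) * F 1 x ^ 2 := by
  have hc := hf.contDiff.continuous
  have hc' := hf.contDiff_deriv_one.continuous
  have i1 : Integrable fun x => F 1 x ^ 3 := by
    refine (hf.integrable_mul_of_continuous (k := fun x => F 1 x ^ 2) (by fun_prop)).congr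
      (Eventually.of_forall fun x => ?_)
    ring
  have i2 : Integrable fun x => x * deriv (F 1) x * F 1 x ^ 2 := by
    refine (hf.integrable_mul_of_continuous (k := fun x => x * deriv (F 1) x * F 1 x)
      (by fun_prop)).congr (Eventually.of_forall fun x => ?_)
    ring
  have hparts : ∫ x, (F 1 x ^ 3 + 3 * (x * deriv (F 1) x * F 1 x ^ 2)) = 0 := by
    refine integral_eq_zero_of_hasDerivAt_of_integrable (f := fun x => x * F 1 x ^ 3)
      (fun x => ?_) (i1.add (i2.const_mul 3)) ?_
    · have hd := ((hf.contDiff_one.differentiable one_ne_zero) x).hasDerivAt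
      refine ((hasDerivAt_id x).fun_mul (hd.fun_pow 3)).congr_deriv ?_
      simp
      ring
    · refine (hf.integrable_mul_of_continuous (k := fun x => x * F 1 x ^ 2) (by fun_prop)).congr
        (Eventually.of_forall fun x => ?_)
      ring
  rw [integral_add i1 (i2.const_mul 3), integral_const_mul] at hparts
  have e : ∀ x, F 1 x ^ 2 * g x = 1 / 2 * F 1 x ^ 3 - 1 / 2 * (x * deriv (F 1) x * F 1 x ^ 2) +
      1 / Real.pi * ((hilbert (F 1) x * deriv (F 1) x - F 1 x * deriv (hilbert (F 1)) x) /
        (hilbert (F 1) x ^ 2 + F 1 x ^ 2) * F 1 x ^ 2) := by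
    intro x
    by_cases hx : F 1 x = 0
    · rw [hx]
      ring
    · rw [hg.eq_of_ne_zero h hR hF hf hgc hx]
      ring
  simp_rw [e]
  rw [integral_add (by exact (i1.const_mul _).sub (i2.const_mul _)) (hf.integrable_phase.const_mul _),
    integral_sub (i1.const_mul _) (i2.const_mul _), integral_const_mul, integral_const_mul,
    integral_const_mul]
  linear_combination -1 / 2 * hparts

/-! ### The free Fisher information -/

theorem freeFisher_withDensity {f : ℝ → ℝ} (hf : Continuous f) (hc : HasCompactSupport f)
    (h0 : ∀ x, 0 ≤ f x) :
    freeFisher (volume.withDensity fun x => ENNReal.ofReal (f x)) =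
      ENNReal.ofReal (4 * Real.pi ^ 2 / 3 * ∫ x, f x ^ 3) := by
  have hi : Integrable fun x => f x ^ 3 :=
    (by fun_prop : Continuous fun x => f x ^ 3).integrable_of_hasCompactSupport
      (hc.comp_left (g := fun t : ℝ => t ^ 3) (by norm_num))
  have hn : 0 ≤ᵐ[volume] fun x => f x ^ 3 := Eventually.of_forall fun x => pow_nonneg (h0 x) 3
  rw [freeFisher, if_pos (withDensity_absolutelyContinuous _ _),
    ENNReal.ofReal_mul (by positivity), ofReal_integral_eq_lintegral_ofReal hi hn]
  congr 1
  refine lintegral_congr_ae ?_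
  filter_upwards [Measure.rnDeriv_withDensity (f := fun x => ENNReal.ofReal (f x)) volume
    (by fun_prop)] with x hx
  rw [hx, ENNReal.ofReal_pow (h0 x)]

section family

variable {f : ℝ → ℝ → ℝ} {k₀ : ℝ} (hk₀ : 1 < k₀)
  (hreg : ContDiffOn ℝ 2 (fun p : ℝ × ℝ => f p.1 p.2) (Ico 1 k₀ ×ˢ univ))

include hreg in
theorem contDiff_slice {k : ℝ} (hk : k ∈ Ico 1 k₀) : ContDiff ℝ 2 (f k) := by
  have h : ContDiff ℝ 2 fun x : ℝ => (k, x) := by fun_prop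
  exact contDiffOn_univ.1 (hreg.comp h.contDiffOn fun x _ => ⟨hk, mem_univ x⟩)

include hk₀

theorem eventually_mem_Ico : ∀ᶠ k : ℝ in 𝓝[≥] 1, k ∈ Ico 1 k₀ :=
  Ico_mem_nhdsGE hk₀

include hreg

/-- g is the derivative of (k, x) ↦ f_k(x) in the direction (1, 0). Two orders of smoothness make it
continuously differentiable in x, as its boundary values require, and a Lipschitz constant on a
compact box gives the uniform control. -/
theorem exists_hasUniformRightDeriv {C : ℝ}
    (hC : ∀ᶠ k in 𝓝[≥] 1, ∀ x, C < |x| → f k x = 0) :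
    ∃ g M, ContDiff ℝ 1 g ∧ HasUniformRightDeriv f g C M := by
  set S : Set (ℝ × ℝ) := Ico 1 k₀ ×ˢ univ with hS
  set Φ : ℝ × ℝ → ℝ := fun p => f p.1 p.2 with hΦ
  have h1 : (1 : ℝ) ∈ Ico 1 k₀ := ⟨le_rfl, hk₀⟩
  have hu : UniqueDiffOn ℝ S := (uniqueDiffOn_Ico 1 k₀).prod uniqueDiffOn_univ
  have hmem : ∀ x : ℝ, ((1 : ℝ), x) ∈ S := fun x => ⟨h1, mem_univ x⟩
  have hIoi : ∀ᶠ k : ℝ in 𝓝[>] 1, k ∈ Ico 1 k₀ :=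
    (eventually_mem_Ico hk₀).filter_mono (nhdsWithin_mono _ Ioi_subset_Ici_self)
  -- Stopping halfway to k₀ gives a compact convex box inside the half-open domain.
  set k₁ := (1 + k₀) / 2 with hk₁
  have hsub : Icc 1 k₁ ×ˢ Icc (-C) C ⊆ S := by
    rintro ⟨k, x⟩ ⟨hk, -⟩
    refine ⟨⟨hk.1, hk.2.trans_lt ?_⟩, mem_univ x⟩
    rw [hk₁]
    linarith
  obtain ⟨K, hK⟩ := (hreg.mono hsub).exists_lipschitzOnWith
      two_ne_zero ((convex_Icc _ _).prod (convex_Icc _ _)) (isCompact_Icc.prod isCompact_Icc)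
  refine ⟨fun x => fderivWithin ℝ Φ S (1, x) (1, 0), K, ?_, ?_, ?_, ?_, ?_, ?_, ?_⟩
  · have h2 : ContDiffOn ℝ 1 (fderivWithin ℝ Φ S) S :=
      hreg.fderivWithin hu (by norm_num)
    have h3 : ContDiff ℝ 1 fun x : ℝ => ((1 : ℝ), x) := by fun_prop
    exact (contDiffOn_univ.1 (h2.comp h3.contDiffOn fun x _ => hmem x)).clm_apply contDiff_const
  · filter_upwards [hIoi] with k hk using (contDiff_slice hreg hk).continuous
  · exact (contDiff_slice hreg h1).continuous
  · exact hC.filter_mono (nhdsWithin_mono _ Ioi_subset_Ici_self)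
  · exact hC.self_of_nhdsWithin self_mem_Ici
  · have hk₁' : ∀ᶠ k : ℝ in 𝓝[>] 1, k ≤ k₁ :=
      (eventually_le_nhds (by rw [hk₁]; linarith)).filter_mono nhdsWithin_le_nhds
    filter_upwards [hC.filter_mono (nhdsWithin_mono _ Ioi_subset_Ici_self), hk₁',
      self_mem_nhdsWithin] with k h2 h3 h4 x
    have h4 : (1 : ℝ) < k := h4
    rcases le_or_gt |x| C with hx | hx
    · have hx' := abs_le.1 hx
      have := hK.dist_le_mul (k, x) (mk_mem_prod ⟨h4.le, h3⟩ hx') (1, x)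
        (mk_mem_prod ⟨le_rfl, h4.le.trans h3⟩ hx')
      rw [Real.dist_eq, Prod.dist_eq, dist_self, Real.dist_eq, abs_of_pos (sub_pos.2 h4),
        max_eq_left (sub_pos.2 h4).le] at this
      exact this
    · rw [h2 x hx, hC.self_of_nhdsWithin self_mem_Ici x hx, sub_self, abs_zero]
      exact mul_nonneg K.2 (sub_pos.2 h4).le
  · intro x
    have hd : HasFDerivWithinAt Φ (fderivWithin ℝ Φ S (1, x)) S (1, x) :=
      ((hreg.differentiableOn two_ne_zero) _ (hmem x)).hasFDerivWithinAt
    have hl : HasDerivWithinAt (fun k : ℝ => (k, x)) (1, 0) (Ico 1 k₀) 1 :=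
      ((hasDerivAt_id (1 : ℝ)).prodMk (hasDerivAt_const (1 : ℝ) x)).hasDerivWithinAt
    have hmaps : MapsTo (fun k : ℝ => (k, x)) (Ico 1 k₀) S := fun k hk =>
      mk_mem_prod hk (mem_univ x)
    have hcomp := hd.comp_hasDerivWithinAt (1 : ℝ) hl hmaps
    have := (hasDerivWithinAt_iff_tendsto_slope' (s := Ioo 1 k₀) (by simp)).1
      (hcomp.mono Ioo_subset_Ico_self)
    rw [nhdsWithin_Ioo_eq_nhdsGT hk₀] at this
    exact this

end family

/-! ### Existence of the powers near k = 1, and assembly of the result -/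

theorem freeConvPow_one_ne_zero {μ : Measure ℝ} [IsProbabilityMeasure μ]
    (hμ : IsCompact μ.support) : freeConvPow μ 1 ≠ 0 := by
  have h : ∃ ν, IsFreeConvPow μ 1 ν := ⟨μ, isFreeConvPow_one hμ⟩
  rw [freeConvPow, dif_pos h]
  have := h.choose_spec.1
  exact IsProbabilityMeasure.ne_zero _

theorem integral_eq_one_of_dilate_eq {c : ℝ} {ν : Measure ℝ} [IsProbabilityMeasure ν] {f : ℝ → ℝ}
    (hf : Continuous f) (hc : HasCompactSupport f) (h0 : ∀ x, 0 ≤ f x)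
    (hd : dilate c ν = volume.withDensity fun x => ENNReal.ofReal (f x)) : ∫ x, f x = 1 := by
  have hp : IsProbabilityMeasure (dilate c ν) := Measure.isProbabilityMeasure_map (by fun_prop)
  have h1 : dilate c ν univ = 1 := measure_univ
  rw [hd, withDensity_apply _ MeasurableSet.univ, Measure.restrict_univ,
    ← ofReal_integral_eq_lintegral_ofReal (hf.integrable_of_hasCompactSupport hc)
      (Eventually.of_forall h0)] at h1
  exact ENNReal.ofReal_eq_one.1 h1

/-- At a point where f₁ > 0, continuity in k keeps f_k positive for k near 1, so the measure is not
the default value 0. Existence of the powers is thus read off from the given densities. -/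
theorem eventually_freeConvPow_ne_zero {μ : Measure ℝ} {f : ℝ → ℝ → ℝ} {k₀ : ℝ} (hk₀ : 1 < k₀)
    (hreg : ContDiffOn ℝ 2 (fun p : ℝ × ℝ => f p.1 p.2) (Ico 1 k₀ ×ˢ univ))
    (hf : IsSmoothDensity (f 1))
    (hdens : ∀ k ∈ Ico 1 k₀,
      normFreeConvPow μ k = volume.withDensity fun x => ENNReal.ofReal (f k x)) :
    ∀ᶠ k in 𝓝[≥] 1, freeConvPow μ k ≠ 0 := by
  have h1 : (1 : ℝ) ∈ Ico 1 k₀ := ⟨le_rfl, hk₀⟩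
  obtain ⟨x, hx⟩ : ∃ x, 0 < f 1 x := by
    by_contra! hn
    have h0 : ∀ x, f 1 x = 0 := fun x => le_antisymm (hn x) (hf.nonneg x)
    have := hf.integral_eq_one
    simp [h0] at this
  have hc : ContinuousOn (fun k => f k x) (Ico 1 k₀) :=
    hreg.continuousOn.comp (f := fun k : ℝ => (k, x)) (by fun_prop) fun k hk => ⟨hk, mem_univ x⟩
  have hpos : ∀ᶠ k in 𝓝[Ico 1 k₀] 1, 0 < f k x := (hc 1 h1).eventually_const_lt hx
  rw [nhdsWithin_Ico_eq_nhdsGE hk₀] at hpos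
  filter_upwards [hpos, eventually_mem_Ico hk₀] with k hk hmem h0
  have h2 := hdens k hmem
  rw [normFreeConvPow, h0, dilate, Measure.map_zero] at h2
  have hfk := (contDiff_slice hreg hmem).continuous
  have h3 := (withDensity_eq_zero_iff (by fun_prop)).1 h2.symm
  have h4 := (Continuous.ae_eq_iff_eq volume (ENNReal.continuous_ofReal.comp hfk)
    continuous_const).1 h3
  exact (ENNReal.ofReal_pos.2 hk).ne' (congrFun h4 x)

end FreeProb

end

theorem proposition3p2 (μ : Measure ℝ) [IsProbabilityMeasure μ] (hμ : IsCompact μ.support)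
    (k₀ : ℝ) (hk₀ : 1 < k₀) (f : ℝ → ℝ → ℝ)
    (hf_nonneg : ∀ k ∈ Ico 1 k₀, ∀ x, 0 ≤ f k x)
    (hf_supp : ∀ k ∈ Ico 1 k₀, HasCompactSupport (f k))
    (hf_reg : ContDiffOn ℝ 2 (fun p : ℝ × ℝ => f p.1 p.2) (Ico 1 k₀ ×ˢ univ))
    (hf_dens : ∀ k ∈ Ico 1 k₀,
      FreeProb.normFreeConvPow μ k = volume.withDensity (fun x => ENNReal.ofReal (f k x))) :
    -- the limits, derivatives and integrals that enter the claims exist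
    ((∀ y : ℝ, Tendsto (fun η => FreeProb.truncHilbert (f 1) η y) (𝓝[>] 0)
          (𝓝 (FreeProb.hilbert (f 1) y))) ∧
      Differentiable ℝ (f 1) ∧
      Differentiable ℝ (FreeProb.hilbert (f 1)) ∧
      Integrable (fun x => f 1 x ^ 3) ∧
      Integrable (fun x =>
        (FreeProb.hilbert (f 1) x * deriv (f 1) x - f 1 x * deriv (FreeProb.hilbert (f 1)) x) /
          (FreeProb.hilbert (f 1) x ^ 2 + f 1 x ^ 2) * f 1 x ^ 2) ∧
      (∀ k ∈ Ico 1 k₀, FreeProb.freeFisher (FreeProb.normFreeConvPow μ k) ≠ ∞) ∧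
      (∀ ε : ℝ, 0 < ε → ∀ α ∈ ({-1, 1} : Finset ℝ), ∀ β ∈ ({-1, 1} : Finset ℝ),
        Integrable (fun p : ℝ × ℝ => (f 1 p.1 : ℂ) * (f 1 p.2 : ℂ) *
          FreeProb.kernelK (FreeProb.cauchyTransform (FreeProb.normFreeConvPow μ 1))
            ((p.1 : ℂ) + Complex.I * (α : ℂ) * (ε : ℂ))
            ((p.2 : ℂ) + Complex.I * (β : ℂ) * (ε : ℂ))))) ∧
    -- (i)
    HasDerivWithinAt (fun k : ℝ => (FreeProb.freeFisher (FreeProb.normFreeConvPow μ k)).toReal)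
      (8 * Real.pi ^ 2 / 3 * (∫ x, f 1 x ^ 3) +
        4 * Real.pi * ∫ x,
          (FreeProb.hilbert (f 1) x * deriv (f 1) x - f 1 x * deriv (FreeProb.hilbert (f 1)) x) /
            (FreeProb.hilbert (f 1) x ^ 2 + f 1 x ^ 2) * f 1 x ^ 2)
      (Ici 1) 1 ∧
    -- (ii)
    Tendsto (fun ε : ℝ => ∑ α ∈ ({-1, 1} : Finset ℝ), ∑ β ∈ ({-1, 1} : Finset ℝ),
        ∫ x : ℝ, ∫ y : ℝ, (f 1 x : ℂ) * (f 1 y : ℂ) *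
          FreeProb.kernelK (FreeProb.cauchyTransform (FreeProb.normFreeConvPow μ 1))
            ((x : ℂ) + Complex.I * (α : ℂ) * (ε : ℂ)) ((y : ℂ) + Complex.I * (β : ℂ) * (ε : ℂ)))
      (𝓝[>] 0)
      (𝓝 ((-(8 * Real.pi ^ 2 / 3 * (∫ x, f 1 x ^ 3)) -
        4 * Real.pi * ∫ x,
          (FreeProb.hilbert (f 1) x * deriv (f 1) x - f 1 x * deriv (FreeProb.hilbert (f 1)) x) /
            (FreeProb.hilbert (f 1) x ^ 2 + f 1 x ^ 2) * f 1 x ^ 2 : ℝ) : ℂ)) ∧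
    -- (iii)
    (∀ (n : ℕ) (z c : Fin n → ℂ), (∀ j, (z j).im ≠ 0) →
      0 ≤ ∑ j, ∑ l, c j * conj (c l) *
        FreeProb.kernelK (FreeProb.cauchyTransform (FreeProb.normFreeConvPow μ 1))
          (z j) (conj (z l))) := by
  have hmem1 : (1 : ℝ) ∈ Ico 1 k₀ := ⟨le_rfl, hk₀⟩
  have hIco := FreeProb.eventually_mem_Ico hk₀
  have hsm := fun k hk => FreeProb.contDiff_slice (k := k) hf_reg hk
  have hne1 : FreeProb.freeConvPow μ 1 ≠ 0 := FreeProb.freeConvPow_one_ne_zero hμ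
  have hf1 : FreeProb.IsSmoothDensity (f 1) := by
    refine ⟨hsm 1 hmem1, hf_supp 1 hmem1, hf_nonneg 1 hmem1, ?_⟩
    have hp := (FreeProb.isFreeConvPow_freeConvPow hne1).1
    exact FreeProb.integral_eq_one_of_dilate_eq (hsm 1 hmem1).continuous (hf_supp 1 hmem1)
      (hf_nonneg 1 hmem1) (hf_dens 1 hmem1)
  have hne := FreeProb.eventually_freeConvPow_ne_zero hk₀ hf_reg hf1 hf_dens
  have hcurve : FreeProb.IsDensityCurve μ (FreeProb.freeConvPow μ) f :=
    { isFreeConvPow := hne.mono fun k hk => FreeProb.isFreeConvPow_freeConvPow hk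
      continuous := hIco.mono fun k hk => (hsm k hk).continuous
      nonneg := hIco.mono hf_nonneg
      dilate_eq := hIco.mono hf_dens }
  obtain ⟨R, hR, hRu⟩ := FreeProb.exists_isRTransform hμ
  obtain ⟨r, θ, U, hinv⟩ := FreeProb.exists_invertsRecipK hR.1
  -- Compact support is assumed for each k separately; this bound is common to all k near 1.
  have hsupp : ∀ᶠ k in 𝓝[≥] 1, ∀ x, r⁻¹ < |x| → f k x = 0 := by
    have hr : ∀ᶠ k : ℝ in 𝓝 (1 : ℝ), ‖(k : ℂ) - 1‖ < r := by
      have hc : Continuous fun k : ℝ => ‖(k : ℂ) - 1‖ := by fun_prop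
      exact hc.continuousAt.eventually_lt_const (by simpa using hinv.pos)
    filter_upwards [hIco, hcurve.isFreeConvPow, hr.filter_mono nhdsWithin_le_nhds]
      with k h1 h2 h3 x hx
    exact hinv.density_eq_zero hRu h2 h3 h1.1 ((hsm k h1).of_le one_le_two) (hf_supp k h1)
      (hf_nonneg k h1) (hf_dens k h1) hx
  obtain ⟨g, M, hg, hgd⟩ := FreeProb.exists_hasUniformRightDeriv hk₀ hf_reg hsupp
  have hfisher : ∀ k ∈ Ico 1 k₀, FreeProb.freeFisher (FreeProb.normFreeConvPow μ k) =
      ENNReal.ofReal (4 * Real.pi ^ 2 / 3 * ∫ x, f k x ^ 3) := fun k hk => by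
    rw [hf_dens k hk, FreeProb.freeFisher_withDensity (hsm k hk).continuous (hf_supp k hk)
      (hf_nonneg k hk)]
  have hG : FreeProb.cauchyTransform (FreeProb.normFreeConvPow μ 1) =
      FreeProb.cau fun t => (f 1 t : ℂ) := by
    rw [hf_dens 1 hmem1, FreeProb.cauchyTransform_withDensity hf1.contDiff.continuous hf1.nonneg]
  rw [hG]
  refine ⟨⟨fun y => ?_, hf1.contDiff_one.differentiable one_ne_zero, fun x =>
    (FreeProb.hasDerivAt_hilbert hf1.contDiff hf1.hasCompactSupport x).differentiableAt, ?_,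
    hf1.integrable_phase, fun k hk => ?_, fun ε hε α hα β hβ => hf1.integrable_kernelK hε hα hβ⟩,
    ?_, hf1.tendsto_kernel_sum, fun n z c hz => hf1.kernelK_posSemidef n z c hz⟩
  · rw [FreeProb.hilbert_eq hf1.contDiff_one hf1.hasCompactSupport]
    exact FreeProb.tendsto_truncHilbert hf1.contDiff_one hf1.hasCompactSupport y
  · have := hf1.contDiff.continuous
    refine (hf1.integrable_mul_of_continuous (k := fun x => f 1 x ^ 2) (by fun_prop)).congr
      (Eventually.of_forall fun x => ?_)
    ring
  · rw [hfisher k hk]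
    exact ENNReal.ofReal_ne_top
  · have hd := hgd.hasDerivWithinAt_integral_pow_three.const_mul (4 * Real.pi ^ 2 / 3)
    rw [hgd.integral_sq_mul hinv hRu hcurve hf1 hg] at hd
    have e : ∀ a b : ℝ, 4 * Real.pi ^ 2 / 3 * (2 * a + 3 / Real.pi * b) =
        8 * Real.pi ^ 2 / 3 * a + 4 * Real.pi * b := by
      intro a b
      have := Real.pi_ne_zero
      field_simp
      ring
    rw [e] at hd
    refine hd.congr_of_eventuallyEq_of_mem ?_ self_mem_Ici
    filter_upwards [hIco] with k hk
    rw [hfisher k hk, ENNReal.toReal_ofReal]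
    exact mul_nonneg (by positivity) (integral_nonneg fun x => pow_nonneg (hf_nonneg k hk x) 3)
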